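/- Let $k$ be a field, let $Q=(Q_0,Q_1;s,t)$ be a finite quiver, and let $J\subseteq kQ$ be the two-sided ideal generated by the arrows (paths are composed from right to left: $pq$ is defined when $s(p)=t(q)$). Let $I$ be a quadratic monomial ideal of $kQ$, that is, a two-sided ideal generated by some paths of length two with $J^d\subseteq I\subseteq J^2$ for some $d\ge 2$; put $A=kQ/I$. Let $\mathcal R_A$ be the relation quiver of $A$: its vertices are the arrows of $Q$, and it has one arrow $[\beta\alpha]\colon\alpha\to\beta$ for each path $\beta\alpha$ of length two in $I$. Put $B=k\mathcal R_A/J_{\mathcal R_A}^2$, where $J_{\mathcal R_A}$ is the ideal generated by the arrows of $\mathcal R_A$, and for each arrow $\alpha$ of $Q$ let $S_\alpha$ be the simple $B$-module at the vertex $\alpha$ of $\mathcal R_A$. For $R=A,B$ let $R\text{-}\underline{\rm mod}$ be the stable category of finitely generated left $R$-modules (morphisms modulo those factoring through projective modules), with the syzygy functor $\Omega_R$ given by kernels of projective covers, and with left triangles the sequences isomorphic to some $\Omega_R Z\to X\to Y\to Z$ induced by a short exact sequence $0\to X\to Y\to Z\to 0$ of finitely generated $R$-modules. Let $B\text{-}\underline{\rm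 ssmod}$ be the full subcategory of $B\text{-}\underline{\rm mod}$ on the semisimple modules; it is closed under $\Omega_B$, and its left triangles are those of $B\text{-}\underline{\rm mod}$ with all terms in it. Then there is, up to natural isomorphism, exactly one $k$-linear functor $F\colon B\text{-}\underline{\rm ssmod}\to A\text{-}\underline{\rm mod}$ with $F(S_\alpha)\simeq A\alpha$ for every arrow $\alpha$ of $Q$, where $A\alpha$ is the left ideal generated by $\alpha$. This functor is a pre-triangle equivalence: there is a natural isomorphism $\delta\colon F\Omega_B\to\Omega_A F$ such that the additive functor $(F,\delta)$ sends left triangles to left triangles (a left triangle $\Omega_B Z\xrightarrow{h}X\xrightarrow{f}Y\xrightarrow{g}Z$ being sent to $\Omega_A FZ\xrightarrow{F(h)\circ\delta_Z^{-1}}FX\xrightarrow{F(f)}FY\xrightarrow{F(g)}FZ$), and such that, with $\delta^0=\mathrm{id}$ and $\delta^{i+1}=\Omega_A^i\delta\circ\delta^i\Omega_B$, the following hold: (S1) for all $X,Y$ in $B\text{-}\underline{\rm ssmod}$ and each morphism $g\colon FX\to FY$ there are $i\ge 0$ and $f\colon\Omega_B^iX\to\Omega_B^iY$ with $\Omega_A^i(g)=\delta^i_Y\circ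 F(f)\circ(\delta^i_X)^{-1}$; (S2) for any two morphisms $f,f'\colon X\to Y$ in $B\text{-}\underline{\rm ssmod}$ with $F(f)=F(f')$ there is $i\ge 0$ with $\Omega_B^i(f)=\Omega_B^i(f')$; (S3) for each $M$ in $A\text{-}\underline{\rm mod}$ there are $i\ge 0$ and $X$ in $B\text{-}\underline{\rm ssmod}$ with $\Omega_A^i(M)\simeq F(X)$. -/

import Mathlib

open CategoryTheory

universe u

noncomputable section

namespace QuadMon

/-! ### Looped categories and pre-triangle equivalences -/

section Looped

universe v₁ v₂ u₁ u₂

variable {C : Type u₁} [Category.{v₁} C] {D : Type u₂} [Category.{v₂} D]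

/-- The iterates `Ω^i` of a loop functor, `Ω^(i+1) = Ω^i Ω`. -/
def loopPow (Ω : C ⥤ C) : ℕ → (C ⥤ C)
  | 0 => 𝟭 C
  | i + 1 => Ω ⋙ loopPow Ω i

/-- For a looped functor `(F, δ)`, with `δ : F Ω ≅ Δ F`, the natural isomorphisms
`δ^i : F Ω^i ≅ Δ^i F`: `δ^0` is the identity, and `δ^(i+1) = Δ^i δ ∘ δ^i Ω`. -/
def loopIsoPow {Ω : C ⥤ C} {Δ : D ⥤ D} {F : C ⥤ D} (δ : Ω ⋙ F ≅ F ⋙ Δ) :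
    (i : ℕ) → (loopPow Ω i ⋙ F ≅ F ⋙ loopPow Δ i)
  | 0 => F.leftUnitor ≪≫ F.rightUnitor.symm
  | i + 1 => Functor.associator _ _ _ ≪≫ Functor.isoWhiskerLeft Ω (loopIsoPow δ i) ≪≫
      (Functor.associator _ _ _).symm ≪≫ Functor.isoWhiskerRight δ (loopPow Δ i) ≪≫
      Functor.associator _ _ _

/-- Pre-stable equivalences of looped categories. -/
structure IsPreStableEquivalence {Ω : C ⥤ C} {Δ : D ⥤ D} (F : C ⥤ D) (δ : Ω ⋙ F ≅ F ⋙ Δ) :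
    Prop where
  /-- morphisms between objects in the image of `F` come from `C` after enough loops -/
  s1 : ∀ {X Y : C} (g : F.obj X ⟶ F.obj Y), ∃ (i : ℕ)
    (f : (loopPow Ω i).obj X ⟶ (loopPow Ω i).obj Y),
    (loopPow Δ i).map g = (loopIsoPow δ i).inv.app X ≫ F.map f ≫ (loopIsoPow δ i).hom.app Y
  /-- morphisms identified by `F` become equal after enough loops -/
  s2 : ∀ {X Y : C} (f f' : X ⟶ Y), F.map f = F.map f' →
    ∃ i : ℕ, (loopPow Ω i).map f = (loopPow Ω i).map f'
  /-- every object of `D` is in the essential image of `F` after enough loops -/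
  s3 : ∀ Z : D, ∃ (i : ℕ) (X : C), Nonempty ((loopPow Δ i).obj Z ≅ F.obj X)

/-- Sequences `Ω Z ⟶ X ⟶ Y ⟶ Z` in a looped category. -/
structure LeftTriangle (Ω : C ⥤ C) where
  X : C
  Y : C
  Z : C
  h : Ω.obj Z ⟶ X
  f : X ⟶ Y
  g : Y ⟶ Z

/-- Isomorphism of sequences `Ω Z ⟶ X ⟶ Y ⟶ Z`. -/
def LeftTriangle.IsIsomorphic {Ω : C ⥤ C} (T T' : LeftTriangle Ω) : Prop :=
  ∃ (a : T.X ≅ T'.X) (b : T.Y ≅ T'.Y) (c : T.Z ≅ T'.Z),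
    T.h ≫ a.hom = Ω.map c.hom ≫ T'.h ∧ T.f ≫ b.hom = a.hom ≫ T'.f ∧
      T.g ≫ c.hom = b.hom ≫ T'.g

/-- The image `Δ F Z ≅ F Ω Z ⟶ F X ⟶ F Y ⟶ F Z` of a sequence under a looped functor `(F, δ)`. -/
def LeftTriangle.map {Ω : C ⥤ C} {Δ : D ⥤ D} (T : LeftTriangle Ω) (F : C ⥤ D)
    (δ : Ω ⋙ F ≅ F ⋙ Δ) : LeftTriangle Δ where
  X := F.obj T.X
  Y := F.obj T.Y
  Z := F.obj T.Z
  h := δ.inv.app T.Z ≫ F.map T.h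
  f := F.map T.f
  g := F.map T.g

/-- Pre-triangle equivalences, for looped categories with classes `𝓔`, `𝓔'` of left triangles:
additive looped functors that send left triangles to left triangles and are pre-stable
equivalences. -/
structure IsPreTriangleEquivalence [Preadditive C] [Preadditive D] {Ω : C ⥤ C} {Δ : D ⥤ D}
    (𝓔 : Set (LeftTriangle Ω)) (𝓔' : Set (LeftTriangle Δ)) (F : C ⥤ D)
    (δ : Ω ⋙ F ≅ F ⋙ Δ) : Prop where
  additive : F.Additive
  map_leftTriangle : ∀ T ∈ 𝓔, T.map F δ ∈ 𝓔'
  preStable : IsPreStableEquivalence F δ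

end Looped

/-! ### Stable module categories and syzygies -/

section Stable

variable {R : Type u} [Ring R]

/-- A morphism of finitely generated modules factors through a (finitely generated) projective
module. -/
def FactorsThroughProjective {X Y : FGModuleCat.{u} R} (f : X ⟶ Y) : Prop :=
  ∃ (P : FGModuleCat.{u} R) (_ : Module.Projective R P) (a : X ⟶ P) (b : P ⟶ Y), a ≫ b = f

variable (R) in
/-- Two morphisms are identified in the stable category if their difference factors through a
projective module. -/
def stableRel : HomRel (FGModuleCat.{u} R) :=
  fun _ _ f g => FactorsThroughProjective (f - g)

lemma FactorsThroughProjective.zero (X Y : FGModuleCat.{u} R) :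
    FactorsThroughProjective (0 : X ⟶ Y) :=
  ⟨FGModuleCat.of R PUnit, inferInstance, 0, 0, by simp⟩

lemma FactorsThroughProjective.add {X Y : FGModuleCat.{u} R} {f g : X ⟶ Y}
    (hf : FactorsThroughProjective f) (hg : FactorsThroughProjective g) :
    FactorsThroughProjective (f + g) := by
  obtain ⟨P, hP, a, b, rfl⟩ := hf
  obtain ⟨P', hP', a', b', rfl⟩ := hg
  refine ⟨FGModuleCat.of R (P × P'), inferInstanceAs (Module.Projective R (P × P')),
    FGModuleCat.ofHom (LinearMap.prod a.hom.hom a'.hom.hom),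
    FGModuleCat.ofHom (LinearMap.coprod b.hom.hom b'.hom.hom), ?_⟩
  ext x
  rfl

lemma FactorsThroughProjective.precomp {X Y Z : FGModuleCat.{u} R} (f : X ⟶ Y) {g : Y ⟶ Z}
    (hg : FactorsThroughProjective g) : FactorsThroughProjective (f ≫ g) := by
  obtain ⟨P, hP, a, b, rfl⟩ := hg
  exact ⟨P, hP, f ≫ a, b, by simp⟩

lemma FactorsThroughProjective.postcomp {X Y Z : FGModuleCat.{u} R} {f : X ⟶ Y} (g : Y ⟶ Z)
    (hf : FactorsThroughProjective f) : FactorsThroughProjective (f ≫ g) := by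
  obtain ⟨P, hP, a, b, rfl⟩ := hf
  exact ⟨P, hP, a, b ≫ g, by simp⟩

lemma FactorsThroughProjective.neg {X Y : FGModuleCat.{u} R} {f : X ⟶ Y}
    (hf : FactorsThroughProjective f) : FactorsThroughProjective (-f) := by
  obtain ⟨P, hP, a, b, rfl⟩ := hf
  exact ⟨P, hP, a, -b, by simp⟩

instance : Congruence (stableRel R) where
  comp_left f _ _ h := by
    have := FactorsThroughProjective.precomp f h
    rwa [Preadditive.comp_sub] at this
  comp_right g h := by
    have := FactorsThroughProjective.postcomp g h
    rwa [Preadditive.sub_comp] at this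
  equivalence :=
    { refl := fun f => by
        simpa [stableRel] using FactorsThroughProjective.zero _ _
      symm := fun h => by
        have := FactorsThroughProjective.neg h
        rwa [neg_sub] at this
      trans := fun h h' => by
        have := FactorsThroughProjective.add h h'
        rwa [sub_add_sub_cancel] at this }

variable (R) in
/-- The stable category of finitely generated left `R`-modules: morphisms are taken modulo those
that factor through projective modules. -/
abbrev StableCat : Type (u + 1) := CategoryTheory.Quotient (stableRel R)

lemma stableRel_add ⦃X Y : FGModuleCat.{u} R⦄ (f₁ f₂ g₁ g₂ : X ⟶ Y) (h : stableRel R f₁ f₂)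
    (h' : stableRel R g₁ g₂) : stableRel R (f₁ + g₁) (f₂ + g₂) := by
  have := FactorsThroughProjective.add h h'
  rwa [sub_add_sub_comm] at this

instance : Preadditive (StableCat R) := CategoryTheory.Quotient.preadditive _ stableRel_add

instance : (CategoryTheory.Quotient.functor (stableRel R)).Additive :=
  CategoryTheory.Quotient.functor_additive _ stableRel_add

lemma stableRel_smul {k : Type u} [Field k] [Algebra k R] (c : k) ⦃X Y : FGModuleCat.{u} R⦄
    (f₁ f₂ : X ⟶ Y) (h : stableRel R f₁ f₂) : stableRel R (c • f₁) (c • f₂) := by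
  obtain ⟨P, hP, a, b, e⟩ := h
  exact ⟨P, hP, a, c • b, by rw [Linear.comp_smul, e, smul_sub]⟩

instance {k : Type u} [Field k] [Algebra k R] : Linear k (StableCat R) :=
  CategoryTheory.Quotient.linear k _ stableRel_smul

/-- A finitely generated module, as an object of the stable category. -/
abbrev StableCat.of (M : FGModuleCat.{u} R) : StableCat R := (CategoryTheory.Quotient.functor (stableRel R)).obj M

/-- The class `f̄` of a morphism `f` in the stable category. -/
abbrev StableCat.ofHom {M N : FGModuleCat.{u} R} (f : M ⟶ N) :
    StableCat.of M ⟶ StableCat.of N := (CategoryTheory.Quotient.functor (stableRel R)).map f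

/-- Projective covers: surjections from a projective module that stay surjective on no proper
submodule. -/
structure IsProjectiveCover {P M : FGModuleCat.{u} R} (p : P ⟶ M) : Prop where
  projective : Module.Projective R P
  surjective : Function.Surjective p.hom.hom
  essential : ∀ N : Submodule R P, N.map p.hom.hom = ⊤ → N = ⊤

theorem exists_isProjectiveCover [IsArtinianRing R] (M : FGModuleCat.{u} R) :
    ∃ (P : FGModuleCat.{u} R) (p : P ⟶ M), IsProjectiveCover p := by
  classical
  obtain ⟨n, q, hq⟩ := Module.Finite.exists_fin' R M
  let S : Set (Submodule R (Fin n → R)) :=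
    {N | Module.Projective R N ∧ N.map q = ⊤}
  have hS : S.Nonempty := ⟨⊤, Module.Projective.of_equiv Submodule.topEquiv.symm, by
    rw [Submodule.map_top, LinearMap.range_eq_top.2 hq]⟩
  obtain ⟨N, ⟨hN, hNq⟩, hmin⟩ := WellFounded.has_min (wellFounded_lt (α := Submodule R (Fin n → R))) S hS
  let p : N →ₗ[R] M := q.domRestrict N
  have hp : Function.Surjective p := fun m => by
    obtain ⟨x, hx, rfl⟩ : m ∈ N.map q := hNq ▸ Submodule.mem_top
    exact ⟨⟨x, hx⟩, rfl⟩
  refine ⟨FGModuleCat.of R N, FGModuleCat.ofHom p, hN, hp, ?_⟩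
  change ∀ K : Submodule R N, K.map p = ⊤ → K = ⊤
  intro K hK
  have hpK : Function.Surjective (p.domRestrict K) := fun m => by
    obtain ⟨x, hx, rfl⟩ : m ∈ K.map p := hK ▸ Submodule.mem_top
    exact ⟨⟨x, hx⟩, rfl⟩
  obtain ⟨φ, hφ⟩ := Module.projective_lifting_property (p.domRestrict K) p hpK
  let ψ : Module.End R N := K.subtype ∘ₗ φ
  have hψ : ∀ x, p (ψ x) = p x := fun x => congrArg (fun f => f x) hφ
  have hψn : ∀ (m : ℕ) (x : N), p ((ψ ^ m) x) = p x := by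
    intro m
    induction m with
    | zero => intro x; rfl
    | succ m ih => intro x; rw [pow_succ, Module.End.mul_apply, ih, hψ]
  obtain ⟨m, hm⟩ := Filter.eventually_atTop.1 ψ.eventually_isCompl_ker_pow_range_pow
  have hc := hm (m + 1) (by omega)
  have hproj : Module.Projective R (LinearMap.range (ψ ^ (m + 1))) :=
    Module.Projective.of_split (LinearMap.range (ψ ^ (m + 1))).subtype
      (Submodule.projectionOnto _ _ hc.symm)
      (by ext x; simp)
  let N' : Submodule R (Fin n → R) := (LinearMap.range (ψ ^ (m + 1))).map N.subtype
  have hN' : N' ∈ S := by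
    refine ⟨Module.Projective.of_equiv
      (Submodule.equivMapOfInjective N.subtype N.injective_subtype _), ?_⟩
    rw [eq_top_iff]
    rintro y -
    obtain ⟨x, rfl⟩ := hp y
    exact ⟨((ψ ^ (m + 1)) x : N), ⟨_, ⟨x, rfl⟩, rfl⟩, hψn (m + 1) x⟩
  have hle : N ≤ N' := by
    have h1 : N' ≤ N := Submodule.map_subtype_le _ _
    by_contra h2
    exact hmin N' hN' (lt_of_le_not_ge h1 h2)
  rw [eq_top_iff]
  rintro x -
  obtain ⟨y, ⟨z, rfl⟩, hz⟩ := hle x.2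
  have : x = (ψ ^ (m + 1)) z := (Subtype.ext hz).symm
  rw [this, pow_succ', Module.End.mul_apply]
  exact (φ _).2

variable [IsArtinianRing R]

/-- The chosen projective cover `P(M)` of `M`. -/
def projCover (M : FGModuleCat.{u} R) : FGModuleCat.{u} R := (exists_isProjectiveCover M).choose

/-- The chosen projective cover `p_M : P(M) ⟶ M`. -/
def projCoverπ (M : FGModuleCat.{u} R) : projCover M ⟶ M :=
  (exists_isProjectiveCover M).choose_spec.choose

lemma isProjectiveCover_projCoverπ (M : FGModuleCat.{u} R) : IsProjectiveCover (projCoverπ M) :=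
  (exists_isProjectiveCover M).choose_spec.choose_spec

/-- The syzygy `Ω(M)`, the kernel of the projective cover `p_M`. -/
def syzygy (M : FGModuleCat.{u} R) : FGModuleCat.{u} R :=
  FGModuleCat.of R (LinearMap.ker (projCoverπ M).hom.hom)

/-- The inclusion `i_M : Ω(M) ⟶ P(M)`. -/
def syzygyι (M : FGModuleCat.{u} R) : syzygy M ⟶ projCover M :=
  FGModuleCat.ofHom (LinearMap.ker (projCoverπ M).hom.hom).subtype

lemma syzygyι_comp (M : FGModuleCat.{u} R) : syzygyι M ≫ projCoverπ M = 0 := by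
  ext x
  exact x.2

lemma syzygyι_cancel {X M : FGModuleCat.{u} R} {f g : X ⟶ syzygy M}
    (h : f ≫ syzygyι M = g ≫ syzygyι M) : f = g := by
  ext x
  have := congrArg (fun a => a.hom.hom x) h
  exact Subtype.ext this

lemma exists_factor_syzygyι {X M : FGModuleCat.{u} R} (f : X ⟶ projCover M)
    (h : f ≫ projCoverπ M = 0) : ∃ g : X ⟶ syzygy M, g ≫ syzygyι M = f := by
  refine ⟨FGModuleCat.ofHom (LinearMap.codRestrict _ f.hom.hom fun x => ?_), ?_⟩
  · exact congrArg (fun a => a.hom.hom x) h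
  · ext x
    rfl

lemma exists_lift_projCoverπ {P M : FGModuleCat.{u} R} [Module.Projective R P] (f : P ⟶ M) :
    ∃ g : P ⟶ projCover M, g ≫ projCoverπ M = f := by
  obtain ⟨g, hg⟩ := Module.projective_lifting_property (projCoverπ M).hom.hom f.hom.hom
    (isProjectiveCover_projCoverπ M).surjective
  exact ⟨FGModuleCat.ofHom g, FGModuleCat.hom_ext hg⟩

/-- `v : Ω(M) ⟶ Ω(N)` is induced by `f : M ⟶ N` through some lift `P(M) ⟶ P(N)` of `f`. -/
def IsSyzygyMap {M N : FGModuleCat.{u} R} (f : M ⟶ N) (v : syzygy M ⟶ syzygy N) : Prop :=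
  ∃ w : projCover M ⟶ projCover N,
    w ≫ projCoverπ N = projCoverπ M ≫ f ∧ v ≫ syzygyι N = syzygyι M ≫ w

lemma exists_isSyzygyMap {M N : FGModuleCat.{u} R} (f : M ⟶ N) :
    ∃ v : syzygy M ⟶ syzygy N, IsSyzygyMap f v := by
  have := (isProjectiveCover_projCoverπ M).projective
  obtain ⟨w, hw⟩ := exists_lift_projCoverπ (projCoverπ M ≫ f)
  obtain ⟨v, hv⟩ := exists_factor_syzygyι (syzygyι M ≫ w) (by
    rw [Category.assoc, hw, ← Category.assoc, syzygyι_comp, Limits.zero_comp])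
  exact ⟨v, w, hw, hv⟩

/-- The map on syzygies is well defined in the stable category. -/
lemma IsSyzygyMap.stableRel {M N : FGModuleCat.{u} R} {f f' : M ⟶ N}
    {v v' : syzygy M ⟶ syzygy N} (hv : IsSyzygyMap f v) (hv' : IsSyzygyMap f' v')
    (h : stableRel R f f') : stableRel R v v' := by
  obtain ⟨w, hw, hwv⟩ := hv
  obtain ⟨w', hw', hwv'⟩ := hv'
  obtain ⟨P, hP, a, b, hab⟩ := h
  obtain ⟨b', rfl⟩ := exists_lift_projCoverπ b
  obtain ⟨g, hg⟩ := exists_factor_syzygyι (w - w' - projCoverπ M ≫ a ≫ b') (by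
    simp only [Preadditive.sub_comp, hw, hw', Category.assoc, hab, Preadditive.comp_sub, sub_self])
  refine ⟨projCover M, (isProjectiveCover_projCoverπ M).projective, syzygyι M, g,
    syzygyι_cancel ?_⟩
  rw [Category.assoc, hg, Preadditive.comp_sub, Preadditive.comp_sub, ← hwv, ← hwv',
    ← Category.assoc (syzygyι M), syzygyι_comp, Limits.zero_comp, sub_zero, Preadditive.sub_comp]

variable (R) in
/-- The syzygy functor on the stable category. -/
def syzygyFunctor : StableCat R ⥤ StableCat R :=
  CategoryTheory.Quotient.lift (stableRel R)
    { obj := fun M => StableCat.of (syzygy M)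
      map := fun f => StableCat.ofHom (exists_isSyzygyMap f).choose
      map_id := fun M => CategoryTheory.Quotient.sound _
        (IsSyzygyMap.stableRel (exists_isSyzygyMap (𝟙 M)).choose_spec
          (f' := 𝟙 M) ⟨𝟙 _, by simp,
            (Category.id_comp (syzygyι M)).trans (Category.comp_id _).symm⟩ (Congruence.equivalence.refl _))
      map_comp := fun {M N L} f g => by
        refine (CategoryTheory.Quotient.sound _ (IsSyzygyMap.stableRel (exists_isSyzygyMap (f ≫ g)).choose_spec
          (f' := f ≫ g) ?_ (Congruence.equivalence.refl _))).trans (Functor.map_comp _ _ _)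
        obtain ⟨w, hw, hv⟩ := (exists_isSyzygyMap f).choose_spec
        obtain ⟨w', hw', hv'⟩ := (exists_isSyzygyMap g).choose_spec
        refine ⟨w ≫ w', ?_, ?_⟩
        · rw [Category.assoc, hw', ← Category.assoc, hw, Category.assoc]
        · rw [Category.assoc, hv', ← Category.assoc, hv, Category.assoc] }
    (fun _ _ f g h => CategoryTheory.Quotient.sound _ (IsSyzygyMap.stableRel (exists_isSyzygyMap f).choose_spec
      (exists_isSyzygyMap g).choose_spec h))

/-- The left triangles of the stable category: those isomorphic to some
`Ω(Z) ⟶ X ⟶ Y ⟶ Z` induced from a short exact sequence `0 ⟶ X ⟶ Y ⟶ Z ⟶ 0` of finitely generated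
modules, the first map being obtained by comparing it with `0 ⟶ Ω(Z) ⟶ P(Z) ⟶ Z ⟶ 0`. -/
def stableLeftTriangles : Set (LeftTriangle (syzygyFunctor R)) :=
  {T | ∃ (X Y Z : FGModuleCat.{u} R) (f : X ⟶ Y) (g : Y ⟶ Z) (h : syzygy Z ⟶ X)
    (w : projCover Z ⟶ Y),
    Function.Injective f.hom.hom ∧ Function.Exact f.hom.hom g.hom.hom ∧
    Function.Surjective g.hom.hom ∧
    w ≫ g = projCoverπ Z ∧ h ≫ f = syzygyι Z ≫ w ∧
    T.IsIsomorphic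
      { X := StableCat.of X, Y := StableCat.of Y, Z := StableCat.of Z
        h := StableCat.ofHom h, f := StableCat.ofHom f, g := StableCat.ofHom g }}

end Stable

/-! ### Semisimple modules in the stable category -/

section Semisimple

variable {R : Type u} [Ring R] [IsArtinianRing R]

lemma isSemisimpleModule_of_torsion {M : Type u} [AddCommGroup M] [Module R M]
    (h : Module.IsTorsionBySet R M (Ring.jacobson R : Set R)) : IsSemisimpleModule R M := by
  let _ := h.module
  exact h.isSemisimpleModule_iff.1 inferInstance

/-- If the square of the Jacobson radical is zero, all syzygies are semisimple. -/
theorem isSemisimpleModule_syzygy (hR : Ring.jacobson R ^ 2 = ⊥) (M : FGModuleCat.{u} R) :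
    IsSemisimpleModule R (syzygy M) := by
  have hp := isProjectiveCover_projCoverπ M
  set P := projCover M
  set p := (projCoverπ M).hom.hom
  let N : Submodule R P := Ring.jacobson R • ⊤
  have hss : IsSemisimpleModule R (P ⧸ N) := isSemisimpleModule_of_torsion (by
    rintro x ⟨r, hr⟩
    obtain ⟨x, rfl⟩ := Submodule.Quotient.mk_surjective _ x
    exact (Submodule.Quotient.mk_eq_zero _).2 (Submodule.smul_mem_smul hr Submodule.mem_top))
  have h1 : Module.jacobson R P ≤ N :=
    Module.jacobson_le_of_eq_bot (IsSemisimpleModule.jacobson_eq_bot R (P ⧸ N))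
  have h2 : LinearMap.ker p ≤ Module.jacobson R P := by
    refine le_sInf fun L hL => ?_
    by_contra hle
    have hsup : L ⊔ LinearMap.ker p = ⊤ := hL.2 _ (by
      refine lt_of_le_not_ge le_sup_left fun h => hle (le_sup_right.trans h))
    refine hL.1 (hp.essential L ?_)
    have : (L ⊔ LinearMap.ker p).map p = L.map p := by
      rw [Submodule.map_sup, LinearMap.le_ker_iff_map.1 (le_refl (LinearMap.ker p)), sup_bot_eq]
    change L.map p = ⊤
    rw [← this, hsup, Submodule.map_top]
    exact LinearMap.range_eq_top.2 hp.surjective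
  refine isSemisimpleModule_of_torsion (M := LinearMap.ker p) ?_
  rintro x ⟨r, hr⟩
  refine Subtype.ext ?_
  have h3 : (x : P) ∈ N := h1 (h2 x.2)
  have h4 : r • (x : P) ∈ Ring.jacobson R • N := Submodule.smul_mem_smul hr h3
  have h5 : Ring.jacobson R • N = ⊥ := by
    rw [← Submodule.mul_smul]
    have : Ring.jacobson R * Ring.jacobson R = ⊥ := by
      rw [← hR, Submodule.pow_succ, Submodule.pow_one]
    rw [this, Submodule.bot_smul]
  rw [h5] at h4
  exact h4

variable (R) in
/-- The property of being a semisimple module, for objects of the stable category. -/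
def semisimpleProp : ObjectProperty (StableCat R) := fun X => IsSemisimpleModule R X.as

variable (R) in
/-- The full subcategory of the stable category on the semisimple modules. -/
abbrev SSCat : Type (u + 1) := (semisimpleProp R).FullSubcategory

/-- A finitely generated semisimple module, as an object of the stable category of semisimple
modules. -/
def SSCat.of (M : FGModuleCat.{u} R) (hM : IsSemisimpleModule R M) : SSCat R :=
  ⟨StableCat.of M, hM⟩

/-- The restriction of the syzygy functor to semisimple modules, for a ring whose Jacobson radical
has square zero. -/
def ssSyzygyFunctor (hR : Ring.jacobson R ^ 2 = ⊥) : SSCat R ⥤ SSCat R :=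
  (semisimpleProp R).lift ((semisimpleProp R).ι ⋙ syzygyFunctor R)
    (fun X => isSemisimpleModule_syzygy hR X.obj.as)

/-- The left triangles of the stable category all of whose terms are semisimple modules. -/
def ssLeftTriangles (hR : Ring.jacobson R ^ 2 = ⊥) : Set (LeftTriangle (ssSyzygyFunctor hR)) :=
  {T | T.map (semisimpleProp R).ι
    ((semisimpleProp R).liftCompιIso ((semisimpleProp R).ι ⋙ syzygyFunctor R) _) ∈
      stableLeftTriangles (R := R)}

end Semisimple

/-! ### Finite quivers and path algebras -/

/-- A finite quiver `(Q₀, Q₁; s, t)`. -/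
structure FinQuiver : Type (u + 1) where
  /-- vertices -/
  V : Type u
  /-- arrows -/
  E : Type u
  [fintypeV : Fintype V]
  [fintypeE : Fintype E]
  /-- the starting vertex of an arrow -/
  s : E → V
  /-- the terminating vertex of an arrow -/
  t : E → V

namespace FinQuiver

attribute [instance] fintypeV fintypeE

variable (Q : FinQuiver.{u})

/-- The vertex reached from `v` along the sequence of arrows `α_n, …, α_1`
(the last entry of the list is traversed first). -/
def endpoint (v : Q.V) : List Q.E → Q.V
  | [] => v
  | a :: _ => Q.t a

/-- `α_n, …, α_1` are composable arrows, and `α_1` starts at `v`. -/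
def IsPathFrom (v : Q.V) : List Q.E → Prop
  | [] => True
  | a :: l => Q.s a = Q.endpoint v l ∧ IsPathFrom v l

lemma endpoint_append (v : Q.V) (m l : List Q.E) :
    Q.endpoint v (m ++ l) = Q.endpoint (Q.endpoint v l) m := by
  cases m <;> rfl

lemma IsPathFrom.append {v : Q.V} {l : List Q.E} (hl : Q.IsPathFrom v l) :
    ∀ {m : List Q.E}, Q.IsPathFrom (Q.endpoint v l) m → Q.IsPathFrom v (m ++ l)
  | [], _ => hl
  | _ :: m, h => ⟨h.1.trans (Q.endpoint_append v m l).symm, IsPathFrom.append hl h.2⟩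

/-- Paths `α_n ⋯ α_2 α_1` with `s(α_i) = t(α_(i-1))`; the list of arrows is `[α_n, …, α_1]`, and
the trivial path at a vertex has no arrows. -/
@[ext]
structure QPath : Type u where
  source : Q.V
  arrows : List Q.E
  isPathFrom : Q.IsPathFrom source arrows

variable {Q}

/-- The terminating vertex of a path. -/
def QPath.target (p : Q.QPath) : Q.V := Q.endpoint p.source p.arrows

/-- The length of a path. -/
def QPath.length (p : Q.QPath) : ℕ := p.arrows.length

variable (Q) in
/-- The trivial path `e_v`. -/
def trivialPath (v : Q.V) : Q.QPath := ⟨v, [], trivial⟩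

variable (Q) in
/-- An arrow, as a path of length one. -/
def arrowPath (a : Q.E) : Q.QPath := ⟨Q.s a, [a], rfl, trivial⟩

/-- The concatenation `pq` of two paths with `s(p) = t(q)`. -/
def QPath.comp (p q : Q.QPath) (h : p.source = q.target) : Q.QPath :=
  ⟨q.source, p.arrows ++ q.arrows, IsPathFrom.append Q q.isPathFrom (by
    have := p.isPathFrom
    rw [h] at this
    exact this)⟩

lemma QPath.target_comp (p q : Q.QPath) (h : p.source = q.target) :
    (p.comp q h).target = p.target := by
  change Q.endpoint q.source (p.arrows ++ q.arrows) = Q.endpoint p.source p.arrows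
  rw [endpoint_append, h]
  rfl

end FinQuiver

open FinQuiver

/-- The path algebra `kQ`: the `k`-vector space with basis the paths in `Q`. -/
def PathAlgebra (k : Type u) [Field k] (Q : FinQuiver.{u}) : Type u := Q.QPath →₀ k

namespace PathAlgebra

variable {k : Type u} [Field k] {Q : FinQuiver.{u}}

instance : AddCommGroup (PathAlgebra k Q) := inferInstanceAs (AddCommGroup (Q.QPath →₀ k))
instance : Module k (PathAlgebra k Q) := inferInstanceAs (Module k (Q.QPath →₀ k))

variable (k) in
/-- A path, as an element of the path algebra. -/
def path (p : Q.QPath) : PathAlgebra k Q := Finsupp.single p (1 : k)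

lemma linearMap_ext {M : Type*} [AddCommGroup M] [Module k M] {f g : PathAlgebra k Q →ₗ[k] M}
    (h : ∀ p, f (path k p) = g (path k p)) : f = g :=
  Finsupp.lhom_ext' fun p => LinearMap.ext_ring (h p)

open Classical in
variable (k) in
/-- The product of two paths in the path algebra: the concatenation, if it is defined, and zero
otherwise. -/
def pathMul (p q : Q.QPath) : PathAlgebra k Q :=
  if h : p.source = q.target then path k (p.comp q h) else 0

variable (k Q) in
/-- The bilinear extension of the product of paths. -/
def mulHom : PathAlgebra k Q →ₗ[k] PathAlgebra k Q →ₗ[k] PathAlgebra k Q :=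
  Finsupp.linearCombination k (fun p => Finsupp.linearCombination k (fun q => pathMul k p q))

lemma mulHom_path (p q : Q.QPath) : mulHom k Q (path k p) (path k q) = pathMul k p q := by
  have h1 : mulHom k Q (path k p) =
      Finsupp.linearCombination k (fun q => pathMul k p q) :=
    (Finsupp.linearCombination_single k (1 : k) p).trans (one_smul _ _)
  rw [h1]
  exact (Finsupp.linearCombination_single k (1 : k) q).trans (one_smul _ _)

instance : Mul (PathAlgebra k Q) := ⟨fun f g => mulHom k Q f g⟩

/-- The unit is the sum of the trivial paths. -/
instance : One (PathAlgebra k Q) := ⟨∑ v : Q.V, path k (trivialPath Q v)⟩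

lemma mul_def (f g : PathAlgebra k Q) : f * g = mulHom k Q f g := rfl

lemma one_def : (1 : PathAlgebra k Q) = ∑ v : Q.V, path k (trivialPath Q v) := rfl

lemma path_mul_path (p q : Q.QPath) : path k p * path k q = pathMul k p q := mulHom_path p q

lemma path_mul_of_eq {p q : Q.QPath} (h : p.source = q.target) :
    path k p * path k q = path k (p.comp q h) := by
  rw [path_mul_path, pathMul, dif_pos h]

lemma path_mul_of_ne {p q : Q.QPath} (h : p.source ≠ q.target) :
    path k p * path k q = 0 := by
  rw [path_mul_path, pathMul, dif_neg h]

lemma path_mul_assoc (p q r : Q.QPath) :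
    path k p * path k q * path k r = path k p * (path k q * path k r) := by
  by_cases h1 : p.source = q.target
  · by_cases h2 : q.source = r.target
    · rw [path_mul_of_eq h1, path_mul_of_eq h2,
        path_mul_of_eq (p := p.comp q h1) (q := r) h2,
        path_mul_of_eq (p := p) (q := q.comp r h2) (h1.trans (QPath.target_comp q r h2).symm)]
      congr 1
      ext1
      · rfl
      · exact List.append_assoc _ _ _
    · rw [path_mul_of_eq h1, path_mul_of_ne h2, path_mul_of_ne (p := p.comp q h1) (q := r) h2]
      exact (map_zero _).symm
  · by_cases h2 : q.source = r.target
    · rw [path_mul_of_ne h1, path_mul_of_eq h2,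
        path_mul_of_ne (p := p) (q := q.comp r h2)
          (fun h => h1 (h.trans (QPath.target_comp q r h2)))]
      exact LinearMap.map_zero₂ (mulHom k Q) _
    · rw [path_mul_of_ne h1, path_mul_of_ne h2]
      exact (LinearMap.map_zero₂ (mulHom k Q) _).trans (map_zero _).symm

lemma mul_assoc' (f g h : PathAlgebra k Q) : f * g * h = f * (g * h) := by
  have key : (LinearMap.compr₂ (mulHom k Q) (mulHom k Q)) =
      (((LinearMap.llcomp k (PathAlgebra k Q) (PathAlgebra k Q) (PathAlgebra k Q)).flip ∘ₗ
        (mulHom k Q)).flip ∘ₗ (mulHom k Q)) := by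
    refine linearMap_ext fun p => linearMap_ext fun q => linearMap_ext fun r => ?_
    exact path_mul_assoc p q r
  exact congrArg (fun F => F f g h) key

lemma one_mul' (f : PathAlgebra k Q) : 1 * f = f := by
  classical
  have key : mulHom k Q 1 = LinearMap.id := by
    refine linearMap_ext fun p => ?_
    rw [one_def, map_sum, LinearMap.sum_apply, Finset.sum_eq_single p.target]
    · change path k (trivialPath Q p.target) * path k p = path k p
      rw [path_mul_of_eq (p := trivialPath Q p.target) (q := p) rfl]
      rfl
    · intro v _ hv
      exact path_mul_of_ne (p := trivialPath Q v) (q := p) hv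
    · intro h
      exact absurd (Finset.mem_univ _) h
  exact congrArg (fun F => F f) key

lemma mul_one' (f : PathAlgebra k Q) : f * 1 = f := by
  classical
  have key : (mulHom k Q).flip 1 = LinearMap.id := by
    refine linearMap_ext fun p => ?_
    rw [LinearMap.flip_apply, one_def, map_sum, Finset.sum_eq_single p.source]
    · change path k p * path k (trivialPath Q p.source) = path k p
      rw [path_mul_of_eq (p := p) (q := trivialPath Q p.source) rfl]
      congr 1
      ext1
      · rfl
      · exact List.append_nil _
    · intro v _ hv
      exact path_mul_of_ne (p := p) (q := trivialPath Q v) (Ne.symm hv)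
    · intro h
      exact absurd (Finset.mem_univ _) h
  exact congrArg (fun F => F f) key

instance : Ring (PathAlgebra k Q) where
  __ := (inferInstance : AddCommGroup (PathAlgebra k Q))
  mul_assoc := mul_assoc'
  one_mul := one_mul'
  mul_one := mul_one'
  left_distrib f g h := map_add (mulHom k Q f) g h
  right_distrib f g h := LinearMap.map_add₂ (mulHom k Q) f g h
  zero_mul f := LinearMap.map_zero₂ (mulHom k Q) f
  mul_zero f := map_zero (mulHom k Q f)

instance : Algebra k (PathAlgebra k Q) :=
  Algebra.ofModule (fun c f g => LinearMap.map_smul₂ (mulHom k Q) c f g)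
    (fun c f g => map_smul (mulHom k Q f) c g)

end PathAlgebra

/-! ### Admissible ideals and quadratic monomial algebras -/

section Ideals

open PathAlgebra

variable {k : Type u} [Field k] {Q : FinQuiver.{u}}

/-- The two-sided ideal generated by a set. -/
def twoSidedSpan {R : Type u} [Ring R] (S : Set R) : Ideal R := (TwoSidedIdeal.span S).asIdeal

instance {R : Type u} [Ring R] (S : Set R) : (twoSidedSpan S).IsTwoSided :=
  inferInstanceAs (TwoSidedIdeal.span S).asIdeal.IsTwoSided

lemma subset_twoSidedSpan {R : Type u} [Ring R] (S : Set R) : S ⊆ twoSidedSpan S :=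
  TwoSidedIdeal.subset_span

lemma twoSidedSpan_le {R : Type u} [Ring R] {S : Set R} {K : Ideal R} [K.IsTwoSided]
    (h : S ⊆ K) : twoSidedSpan S ≤ K := by
  intro x hx
  have hx' : x ∈ TwoSidedIdeal.span S := hx
  have := TwoSidedIdeal.mem_span_iff.1 hx' K.toTwoSided (by simpa using h)
  simpa using this

variable (k Q) in
/-- The ideal `J` of the path algebra generated by the arrows. -/
def arrowIdeal : Ideal (PathAlgebra k Q) :=
  twoSidedSpan (Set.range fun a : Q.E => path k (arrowPath Q a))

instance : (arrowIdeal k Q).IsTwoSided := inferInstanceAs (twoSidedSpan _).IsTwoSided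

/-- Admissible ideals: two-sided ideals `I` with `J ^ d ⊆ I ⊆ J ^ 2` for some `d ≥ 2`. -/
class IsAdmissible (I : Ideal (PathAlgebra k Q)) : Prop extends I.IsTwoSided where
  exists_pow_le : ∃ d : ℕ, 2 ≤ d ∧ arrowIdeal k Q ^ d ≤ I
  le_sq : I ≤ arrowIdeal k Q ^ 2

/-- Quadratic monomial ideals: admissible ideals generated by some paths of length two. -/
class IsQuadraticMonomial (I : Ideal (PathAlgebra k Q)) : Prop extends IsAdmissible I where
  exists_generators : ∃ G : Set Q.QPath, (∀ p ∈ G, p.length = 2) ∧ I = twoSidedSpan (path k '' G)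

instance : IsAdmissible (arrowIdeal k Q ^ 2) where
  exists_pow_le := ⟨2, le_rfl, le_rfl⟩
  le_sq := le_rfl

lemma path_mem_arrowIdeal_pow : ∀ (d : ℕ) (p : Q.QPath), d ≤ p.length →
    path k p ∈ arrowIdeal k Q ^ d
  | 0, p, _ => by rw [Submodule.pow_zero, Ideal.one_eq_top]; exact Submodule.mem_top
  | d + 1, ⟨v, [], _⟩, h => absurd h (by simp [QPath.length])
  | d + 1, ⟨v, a :: l, hp⟩, h => by
    have h1 := path_mem_arrowIdeal_pow d ⟨v, l, hp.2⟩
      (by simpa [QPath.length] using h)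
    have h2 : path k (⟨v, a :: l, hp⟩ : Q.QPath) =
        path k (arrowPath Q a) * path k (⟨v, l, hp.2⟩ : Q.QPath) :=
      (path_mul_of_eq (p := arrowPath Q a) (q := ⟨v, l, hp.2⟩) hp.1).symm
    rw [h2, Ideal.IsTwoSided.pow_succ]
    exact Ideal.mul_mem_mul (subset_twoSidedSpan _ ⟨a, rfl⟩) h1

lemma finite_paths_lt (d : ℕ) : {p : Q.QPath | p.length < d}.Finite := by
  refine Set.Finite.of_finite_image (f := fun p : Q.QPath => (p.source, p.arrows)) ?_ ?_
  · refine (Set.finite_univ.prod (List.finite_length_lt Q.E d)).subset ?_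
    rintro _ ⟨p, hp, rfl⟩
    exact ⟨Set.mem_univ _, hp⟩
  · intro p _ q _ h
    exact QPath.ext (congrArg Prod.fst h) (congrArg Prod.snd h)

/-- The quotient of a path algebra by an admissible ideal is finite-dimensional. -/
instance finite_quotient (I : Ideal (PathAlgebra k Q)) [IsAdmissible I] :
    Module.Finite k (PathAlgebra k Q ⧸ I) := by
  obtain ⟨d, -, hd⟩ := IsAdmissible.exists_pow_le (I := I)
  let T : Set (PathAlgebra k Q ⧸ I) :=
    (fun p : Q.QPath => Ideal.Quotient.mkₐ k I (path k p)) '' {p | p.length < d}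
  have hT : T.Finite := (finite_paths_lt d).image _
  refine ⟨⟨hT.toFinset, ?_⟩⟩
  rw [hT.coe_toFinset, eq_top_iff]
  rintro x -
  obtain ⟨f, rfl⟩ := Ideal.Quotient.mkₐ_surjective k I x
  have key : ∀ p : Q.QPath, Ideal.Quotient.mkₐ k I (path k p) ∈ Submodule.span k T := by
    intro p
    by_cases hp : p.length < d
    · exact Submodule.subset_span ⟨p, hp, rfl⟩
    · have : Ideal.Quotient.mkₐ k I (path k p) = 0 :=
        Ideal.Quotient.eq_zero_iff_mem.2 (hd (path_mem_arrowIdeal_pow d p (not_lt.1 hp)))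
      rw [this]
      exact Submodule.zero_mem _
  have h2 : (⊤ : Submodule k (PathAlgebra k Q)) ≤
      (Submodule.span k T).comap (Ideal.Quotient.mkₐ k I).toLinearMap := by
    have : Submodule.span k (Set.range (path k : Q.QPath → PathAlgebra k Q)) = ⊤ :=
      (Finsupp.basisSingleOne (R := k) (ι := Q.QPath)).span_eq
    rw [← this, Submodule.span_le]
    rintro _ ⟨p, rfl⟩
    exact key p
  exact h2 (Submodule.mem_top (x := f))

instance isArtinianRing_quotient (I : Ideal (PathAlgebra k Q)) [IsAdmissible I] :
    IsArtinianRing (PathAlgebra k Q ⧸ I) := IsArtinianRing.of_finite k _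

/-- The coefficient of the trivial path `e_v`, an algebra homomorphism `kQ → k`. -/
def vertexCoeff (v : Q.V) : PathAlgebra k Q →ₐ[k] k :=
  AlgHom.ofLinearMap (Finsupp.lapply (trivialPath Q v))
    (by
      classical
      change (Finsupp.lapply (trivialPath Q v) : (Q.QPath →₀ k) →ₗ[k] k)
        (∑ w : Q.V, Finsupp.single (trivialPath Q w) (1 : k)) = 1
      rw [map_sum, Finset.sum_eq_single v]
      · exact Finsupp.single_eq_same
      · intro w _ hw
        exact Finsupp.single_eq_of_ne fun h => hw (congrArg QPath.source h).symm
      · intro h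
        exact absurd (Finset.mem_univ _) h)
    (by
      classical
      let e : PathAlgebra k Q →ₗ[k] k :=
        (Finsupp.lapply (trivialPath Q v) : (Q.QPath →₀ k) →ₗ[k] k)
      have he : ∀ p : Q.QPath, e (path k p) = if p = trivialPath Q v then 1 else 0 :=
        fun p => Finsupp.single_apply
      have key : (mulHom k Q).compr₂ e = (LinearMap.mul k k).compl₁₂ e e := by
        refine linearMap_ext fun p => linearMap_ext fun q => ?_
        change e (path k p * path k q) = e (path k p) * e (path k q)
        by_cases hpq : p.source = q.target
        · rw [path_mul_of_eq hpq, he, he, he]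
          by_cases hp : p = trivialPath Q v
          · subst hp
            by_cases hq : q = trivialPath Q v
            · subst hq
              rw [if_pos rfl, mul_one]
              exact if_pos rfl
            · rw [if_neg hq, mul_zero, if_neg]
              exact fun h => hq (QPath.ext (congrArg QPath.source h) (congrArg QPath.arrows h))
          · rw [if_neg hp, zero_mul, if_neg]
            intro h
            have h1 : p.arrows ++ q.arrows = [] := congrArg QPath.arrows h
            obtain ⟨h2, h3⟩ := List.append_eq_nil_iff.1 h1
            have h4 : q.source = v := congrArg QPath.source h
            refine hp (QPath.ext ?_ h2)
            rw [hpq, QPath.target, h3]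
            exact h4
        · rw [path_mul_of_ne hpq, he, he, map_zero]
          by_cases hp : p = trivialPath Q v
          · by_cases hq : q = trivialPath Q v
            · subst hp; subst hq
              exact absurd rfl hpq
            · rw [if_neg hq, mul_zero]
          · rw [if_neg hp, zero_mul]
      exact fun f g => congrArg (fun F => F f g) key)

lemma arrowIdeal_le_ker (v : Q.V) :
    arrowIdeal k Q ≤ RingHom.ker (vertexCoeff (k := k) v) := by
  refine twoSidedSpan_le ?_
  rintro _ ⟨a, rfl⟩
  exact Finsupp.single_eq_of_ne fun h => by
    simpa [trivialPath, arrowPath] using congrArg QPath.arrows h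

lemma mem_arrowIdeal_of_vertexCoeff (f : PathAlgebra k Q)
    (h : ∀ v, vertexCoeff v f = 0) : f ∈ arrowIdeal k Q := by
  have h1 : f = ∑ p ∈ Finsupp.support f, Finsupp.toFun f p • path k p := by
    refine (Finsupp.sum_single (α := Q.QPath) (M := k) f).symm.trans ?_
    refine Finset.sum_congr rfl fun p _ => ?_
    exact (Finsupp.smul_single_one p (Finsupp.toFun f p)).symm
  rw [h1]
  refine Ideal.sum_mem _ fun p _ => ?_
  rw [Algebra.smul_def]
  by_cases hp : 1 ≤ p.length
  · have := path_mem_arrowIdeal_pow (k := k) 1 p hp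
    rw [Submodule.pow_one] at this
    exact Ideal.mul_mem_left _ _ this
  · have h2 : p = trivialPath Q p.source :=
      QPath.ext rfl (List.length_eq_zero_iff.1 (by simpa [QPath.length] using hp))
    have h3 : Finsupp.toFun f p = 0 := by
      rw [h2]
      exact h p.source
    rw [h3, map_zero, zero_mul]
    exact Ideal.zero_mem _

/-- The algebra `kQ/J²` with radical square zero defined by the quiver `Q`. -/
abbrev RadSquareZero (k : Type u) [Field k] (Q : FinQuiver.{u}) : Type u :=
  PathAlgebra k Q ⧸ (arrowIdeal k Q ^ 2)

/-- The algebra homomorphism `kQ/J² → k` given by the coefficient of `e_v`. -/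
def vertexChar (v : Q.V) : RadSquareZero k Q →ₐ[k] k :=
  Ideal.Quotient.liftₐ _ (vertexCoeff v) fun _ hf =>
    arrowIdeal_le_ker v (Ideal.pow_le_self two_ne_zero hf)

lemma vertexChar_mk (v : Q.V) (f : PathAlgebra k Q) :
    vertexChar v (Ideal.Quotient.mk (arrowIdeal k Q ^ 2) f) = vertexCoeff v f := rfl

lemma vertexChar_surjective (v : Q.V) :
    Function.Surjective (vertexChar v : RadSquareZero k Q →ₐ[k] k) := fun c =>
  ⟨algebraMap k _ c, AlgHom.commutes _ c⟩

lemma mem_arrowIdeal_of_mem_jacobson {f : PathAlgebra k Q}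
    (hf : Ideal.Quotient.mk (arrowIdeal k Q ^ 2) f ∈ Ring.jacobson (RadSquareZero k Q)) :
    f ∈ arrowIdeal k Q := by
  refine mem_arrowIdeal_of_vertexCoeff f fun v => ?_
  have : RingHomSurjective (vertexChar v : RadSquareZero k Q →ₐ[k] k).toRingHom :=
    ⟨vertexChar_surjective v⟩
  have h := Ring.le_comap_jacobson (vertexChar v : RadSquareZero k Q →ₐ[k] k).toRingHom hf
  have h0 : Ring.jacobson k = ⊥ := IsSemisimpleModule.jacobson_eq_bot k k
  rw [h0] at h
  exact h

lemma jacobson_radSquareZero : Ring.jacobson (RadSquareZero k Q) ^ 2 = ⊥ := by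
  have hsq : Ring.jacobson (RadSquareZero k Q) ^ 2 =
      Ring.jacobson (RadSquareZero k Q) * Ring.jacobson (RadSquareZero k Q) := by
    rw [Submodule.pow_succ (M := Ring.jacobson (RadSquareZero k Q)), Submodule.pow_one]
  rw [hsq, eq_bot_iff, Ideal.mul_le]
  intro x hx y hy
  obtain ⟨f, rfl⟩ := Ideal.Quotient.mk_surjective x
  obtain ⟨g, rfl⟩ := Ideal.Quotient.mk_surjective y
  rw [← map_mul]
  refine Ideal.Quotient.eq_zero_iff_mem.2 ?_
  rw [Submodule.pow_succ, Submodule.pow_one]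
  exact Ideal.mul_mem_mul (mem_arrowIdeal_of_mem_jacobson hx) (mem_arrowIdeal_of_mem_jacobson hy)

/-- The simple module `S_v` of `kQ/J²` at the vertex `v`: the vector space `k`, on which `e_v` acts
as the identity and all other paths act as zero. -/
def simpleModule (k : Type u) [Field k] (Q : FinQuiver.{u}) (v : Q.V) :
    ModuleCat.{u} (RadSquareZero k Q) :=
  (ModuleCat.restrictScalars (vertexChar v : RadSquareZero k Q →ₐ[k] k).toRingHom).obj
    (ModuleCat.of k k)

lemma isSimpleModule_simpleModule (v : Q.V) :
    IsSimpleModule (RadSquareZero k Q) (simpleModule k Q v) := by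
  have : Nontrivial (simpleModule k Q v) := inferInstanceAs (Nontrivial k)
  refine isSimpleModule_iff_toSpanSingleton_surjective.2 ⟨this, fun x hx y => ?_⟩
  obtain ⟨b, hb⟩ := vertexChar_surjective (k := k) v ((show k from y) / (show k from x))
  refine ⟨b, ?_⟩
  change (vertexChar v b) * (show k from x) = y
  rw [hb]
  exact div_mul_cancel₀ _ hx

/-- The simple module `S_v` as an object of the stable category of semisimple modules. -/
def simpleObj (k : Type u) [Field k] (Q : FinQuiver.{u}) (v : Q.V) :
    SSCat (RadSquareZero k Q) :=
  have := isSimpleModule_simpleModule (k := k) v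
  SSCat.of ⟨simpleModule k Q v, (inferInstance : Module.Finite _ (simpleModule k Q v))⟩
    (inferInstance : IsSemisimpleModule _ (simpleModule k Q v))

/-- The relation quiver of `kQ/I`: its vertices are the arrows of `Q`, and it has one arrow
`[βα] : α → β` for each path `βα` of length two in `I`. -/
def relationQuiver (I : Ideal (PathAlgebra k Q)) : FinQuiver.{u} where
  V := Q.E
  E := {x : Q.E × Q.E // ∃ h : Q.s x.1 = Q.t x.2,
    path k ((arrowPath Q x.1).comp (arrowPath Q x.2) h) ∈ I}
  fintypeE := Fintype.ofFinite _
  s x := x.1.2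
  t x := x.1.1

/-- The left ideal `Aα` of `A = kQ/I` generated by an arrow `α`, in the stable category. -/
def arrowObj (I : Ideal (PathAlgebra k Q)) [IsAdmissible I] (a : Q.E) :
    StableCat (PathAlgebra k Q ⧸ I) :=
  StableCat.of (FGModuleCat.of _
    (Ideal.span {Ideal.Quotient.mk I (path k (arrowPath Q a))} : Ideal (PathAlgebra k Q ⧸ I)))

/-- The `k`-linear functors from the stable category of semisimple `B`-modules to the stable
category of `A`-modules sending `S_α` to `Aα` for each arrow `α`, where `A = kQ/I`, and `B` is the
algebra with radical square zero defined by the relation quiver of `A`. -/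
structure IsKeyFunctor (I : Ideal (PathAlgebra k Q)) [IsAdmissible I]
    (F : SSCat (RadSquareZero k (relationQuiver I)) ⥤ StableCat (PathAlgebra k Q ⧸ I)) : Prop where
  additive : F.Additive
  linear : F.Linear k
  obj_simple : ∀ a : Q.E, Nonempty (F.obj (simpleObj k (relationQuiver I) a) ≅ arrowObj I a)

end Ideals

end QuadMon

end

open QuadMon

/-! In the stable category of semisimple `B`-modules every object is a finite direct sum of modules
`S_α`, and every map `S_α ⟶ S_β` is a scalar, zero unless `α = β`. A `k`-linear functor on such a
category amounts to a choice of images for the `S_α`; the only constraint is that the image be zero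
whenever `S_α` is zero. Both `S_α` and `Aα` vanish stably exactly when no arrow of the relation
quiver starts at `α` (`id_relationSimple_eq_zero_iff`). This gives existence and uniqueness of `F`
(`exists_linear_functor_of_scalar`, `exists_natIso_of_scalar`), and also its faithfulness, so that
(S2) holds with `i = 0` (`map_injective_of_scalar`).

The syzygies on the two sides decompose in the same way. Over `B`, `Ω S_α` is the sum of the `S_β`
over the arrows `[βα]` (`simpleRelationSum`). Over `A`, the kernel of `A e_{t(α)} ⟶ Aα` is the sum
of the `Aβ` over the same `β`, because `I` is spanned by the paths that contain a quadratic relation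
(`arrowRelationSum`). Matching summands defines `δ` on each `S_α`, and naturality is automatic since
maps there are scalar. A map `Aα ⟶ Aα'` is not assumed to come from `F`, but on presentations it is
right multiplication by some `w`: the multiple of a trivial path in `w` contributes scalars between
the summands of the syzygies, and the rest contributes maps that factor through the free module `A`
(`exists_component_eq_scalarHom`). So one loop turns every map into a matrix of scalars, which lifts
along `F`; this is (S1) with `i = 1` (`exists_loopIso_of_scalar`).

Triangles cause no difficulty over `B`. Maps of semisimple modules split, and left triangles are
exact under covariant Hom functors, so every left triangle of semisimple modules is a split one with
terms `ΩN ⊕ K`, `K ⊕ I`, `N ⊕ I` (`nonempty_splitting_of_mem_ssLeftTriangles`). Additive looped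
functors preserve this shape, and every sequence of this shape is a left triangle
(`LeftTriangle.Splitting.mem_stableLeftTriangles`).

For (S3), induct on composition length. The syzygy of a simple `A`-module is a sum of modules `Aα`,
hence in the image of `F`. For an extension, rotation exhibits a loop of the middle term as the
first term of a left triangle whose last two terms are in the image after enough loops; one more
loop brings the last morphism into the image, where it is completed to a split triangle. The first
term is determined by the last morphism (`EventuallyInImage.of_mem_stableLeftTriangles`). -/

noncomputable section

namespace QuadMon

/-! ### Finite direct sums, and linear functors determined on generators with scalar maps -/

section FamilySums

universe v₁ v₂ u₁ u₂ w

variable {C : Type u₁} [Category.{v₁} C] [Preadditive C]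
  {D : Type u₂} [Category.{v₂} D] [Preadditive D]

/-- The structure of a finite direct sum of the objects `S j` on an object `X`. -/
structure FamilySum {J : Type*} [Fintype J] (S : J → C) (X : C) where
  ι : ∀ j, S j ⟶ X
  π : ∀ j, X ⟶ S j
  ι_π_self : ∀ j, ι j ≫ π j = 𝟙 (S j)
  ι_π_ne : ∀ {j l}, j ≠ l → ι j ≫ π l = 0
  total : ∑ j, π j ≫ ι j = 𝟙 X

namespace FamilySum

variable {J : Type*} [Fintype J] {S S' : J → C} {X Y : C}

lemma ext_to (s : FamilySum S X) {f g : Y ⟶ X} (h : ∀ j, f ≫ s.π j = g ≫ s.π j) : f = g := by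
  rw [← Category.comp_id f, ← Category.comp_id g, ← s.total, Preadditive.comp_sum,
    Preadditive.comp_sum]
  exact Finset.sum_congr rfl fun j _ => by rw [← Category.assoc, h, Category.assoc]

lemma ext_from (s : FamilySum S X) {f g : X ⟶ Y} (h : ∀ j, s.ι j ≫ f = s.ι j ≫ g) : f = g := by
  rw [← Category.id_comp f, ← Category.id_comp g, ← s.total, Preadditive.sum_comp,
    Preadditive.sum_comp]
  exact Finset.sum_congr rfl fun j _ => by rw [Category.assoc, h, Category.assoc]

lemma ι_sum (s : FamilySum S X) (j : J) (f : ∀ l, S l ⟶ Y) :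
    s.ι j ≫ ∑ l, s.π l ≫ f l = f j := by
  rw [Preadditive.comp_sum, Finset.sum_eq_single j]
  · rw [← Category.assoc, s.ι_π_self, Category.id_comp]
  · intro l _ hl
    rw [← Category.assoc, s.ι_π_ne hl.symm, Limits.zero_comp]
  · intro h
    exact absurd (Finset.mem_univ _) h

lemma sum_π (s : FamilySum S X) (j : J) (f : ∀ l, Y ⟶ S l) :
    (∑ l, f l ≫ s.ι l) ≫ s.π j = f j := by
  rw [Preadditive.sum_comp, Finset.sum_eq_single j]
  · rw [Category.assoc, s.ι_π_self, Category.comp_id]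
  · intro l _ hl
    rw [Category.assoc, s.ι_π_ne hl, Limits.comp_zero]
  · intro h
    exact absurd (Finset.mem_univ _) h

/-- Additive functors preserve finite direct sums. -/
@[simps] def map (s : FamilySum S X) (F : C ⥤ D) [F.Additive] :
    FamilySum (fun j => F.obj (S j)) (F.obj X) where
  ι j := F.map (s.ι j)
  π j := F.map (s.π j)
  ι_π_self j := by rw [← F.map_comp, s.ι_π_self, F.map_id]
  ι_π_ne h := by rw [← F.map_comp, s.ι_π_ne h, F.map_zero]
  total := by simp only [← F.map_comp, ← F.map_sum, s.total, F.map_id]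

/-- Replacing the summands by isomorphic objects. -/
@[simps] def congr (s : FamilySum S X) (e : ∀ j, S j ≅ S' j) : FamilySum S' X where
  ι j := (e j).inv ≫ s.ι j
  π j := s.π j ≫ (e j).hom
  ι_π_self j := by
    rw [Category.assoc, ← Category.assoc (s.ι j), s.ι_π_self, Category.id_comp, Iso.inv_hom_id]
  ι_π_ne h := by
    rw [Category.assoc, ← Category.assoc (s.ι _), s.ι_π_ne h, Limits.zero_comp, Limits.comp_zero]
  total := by simpa using s.total

/-- Replacing the sum by an isomorphic object. -/
@[simps] def ofIso (s : FamilySum S X) (e : X ≅ Y) : FamilySum S Y where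
  ι j := s.ι j ≫ e.hom
  π j := e.inv ≫ s.π j
  ι_π_self j := by simp [s.ι_π_self]
  ι_π_ne h := by simp [s.ι_π_ne h]
  total := by
    have : ∑ j, (e.inv ≫ s.π j) ≫ s.ι j ≫ e.hom = e.inv ≫ (∑ j, s.π j ≫ s.ι j) ≫ e.hom := by
      simp only [Preadditive.sum_comp, Preadditive.comp_sum, Category.assoc]
    rw [this, s.total, Category.id_comp, Iso.inv_hom_id]

/-- Two direct sums of the same objects are isomorphic. -/
@[simps] def iso (s : FamilySum S X) (t : FamilySum S Y) : X ≅ Y where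
  hom := ∑ j, s.π j ≫ t.ι j
  inv := ∑ j, t.π j ≫ s.ι j
  hom_inv_id := s.ext_from fun j => by rw [← Category.assoc, s.ι_sum, t.ι_sum, Category.comp_id]
  inv_hom_id := t.ext_from fun j => by rw [← Category.assoc, t.ι_sum, s.ι_sum, Category.comp_id]

end FamilySum

/-- Natural isomorphisms between additive functors can be defined on objects whose finite direct
sums exhaust the category. -/
theorem exists_natIso_of_familySum {ι : Type w} (S : ι → C)
    (hC : ∀ X : C, ∃ (n : ℕ) (a : Fin n → ι), Nonempty (FamilySum (fun j => S (a j)) X))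
    (F F' : C ⥤ D) [F.Additive] [F'.Additive] (θ : ∀ a, F.obj (S a) ≅ F'.obj (S a))
    (hθ : ∀ (a b : ι) (f : S a ⟶ S b), F.map f ≫ (θ b).hom = (θ a).hom ≫ F'.map f) :
    ∃ η : F ≅ F', ∀ a, η.hom.app (S a) = (θ a).hom := by
  choose n a s using hC
  let s : ∀ X, FamilySum (fun j => S (a X j)) X := fun X => (s X).some
  have key : ∀ {X : C} (j : Fin (n X)) (b : ι) (u : S b ⟶ X),
      F.map u ≫ F.map ((s X).π j) ≫ (θ _).hom = (θ b).hom ≫ F'.map u ≫ F'.map ((s X).π j) := by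
    intro X j b u
    rw [← Category.assoc, ← F.map_comp, hθ, F'.map_comp]
  -- The isomorphism at `X` built from its chosen decomposition is compatible with every map from a
  -- generator, whether or not that map belongs to the decomposition.
  have key' : ∀ {X : C} (b : ι) (u : S b ⟶ X),
      F.map u ≫ ∑ j, F.map ((s X).π j) ≫ (θ _).hom ≫ F'.map ((s X).ι j) =
        (θ b).hom ≫ F'.map u := by
    intro X b u
    rw [Preadditive.comp_sum]
    have : F'.map u = ∑ j, F'.map u ≫ F'.map ((s X).π j) ≫ F'.map ((s X).ι j) := by
      rw [← Preadditive.comp_sum]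
      have := ((s X).map F').total
      simp only [FamilySum.map_ι, FamilySum.map_π] at this
      rw [this, Category.comp_id]
    rw [this, Preadditive.comp_sum]
    refine Finset.sum_congr rfl fun j _ => ?_
    have := key j b u =≫ F'.map ((s X).ι j)
    simpa only [Category.assoc] using this
  refine ⟨NatIso.ofComponents (fun X => (((s X).map F).congr fun j => θ _).iso ((s X).map F')) ?_,
    fun b => ?_⟩
  · intro X Y f
    refine ((s X).map F).ext_from fun j => ?_
    simp only [FamilySum.iso_hom, FamilySum.congr_π, FamilySum.map_π, FamilySum.map_ι,
      Category.assoc]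
    rw [← Category.assoc, ← F.map_comp, key', ← Category.assoc, key', Category.assoc,
      ← F'.map_comp]
  -- The decomposition chosen for `S b` may not be the tautological one; `key'` at the identity
  -- gives the value `θ b` regardless.
  · have := key' b (𝟙 (S b))
    simpa using this

/-- Functors can be defined on objects whose finite direct sums exhaust the category. -/
theorem exists_linear_functor {k : Type*} [Field k] [Linear k C] [Linear k D] {ι : Type w}
    (S : ι → C) (A : ι → D)
    (hC : ∀ X : C, ∃ (n : ℕ) (a : Fin n → ι), Nonempty (FamilySum (fun j => S (a j)) X))
    (hD : ∀ (n : ℕ) (a : Fin n → ι), ∃ Y : D, Nonempty (FamilySum (fun j => A (a j)) Y))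
    (Θ : ∀ {a b : ι}, (S a ⟶ S b) → (A a ⟶ A b)) (hid : ∀ a, Θ (𝟙 (S a)) = 𝟙 (A a))
    (hcomp : ∀ {a b c : ι} (f : S a ⟶ S b) (g : S b ⟶ S c), Θ (f ≫ g) = Θ f ≫ Θ g)
    (hadd : ∀ {a b : ι} (f g : S a ⟶ S b), Θ (f + g) = Θ f + Θ g)
    (hsmul : ∀ {a b : ι} (c : k) (f : S a ⟶ S b), Θ (c • f) = c • Θ f) :
    ∃ F : C ⥤ D, F.Additive ∧ F.Linear k ∧ ∀ a, Nonempty (F.obj (S a) ≅ A a) := by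
  choose n a s using hC
  let s : ∀ X, FamilySum (fun j => S (a X j)) X := fun X => (s X).some
  choose Y t using fun X => hD (n X) (a X)
  let t : ∀ X, FamilySum (fun j => A (a X j)) (Y X) := fun X => (t X).some
  have hsum : ∀ {a b : ι} {J : Type} (T : Finset J) (f : J → (S a ⟶ S b)),
      Θ (∑ j ∈ T, f j) = ∑ j ∈ T, Θ (f j) := by
    intro a b J T f
    exact map_sum (AddMonoidHom.mk' Θ hadd) f T
  have hzero : ∀ {a b : ι}, Θ (0 : S a ⟶ S b) = 0 := by
    intro a b
    exact map_zero (AddMonoidHom.mk' Θ hadd)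
  -- A morphism is sent to the matrix obtained by applying `Θ` to each entry of its own matrix.
  let m : ∀ {X X' : C}, (X ⟶ X') → (Y X ⟶ Y X') := fun {X X'} f =>
    ∑ j, (t X).π j ≫ ∑ l, Θ ((s X).ι j ≫ f ≫ (s X').π l) ≫ (t X').ι l
  have hm : ∀ {X X' : C} (f : X ⟶ X') (j : Fin (n X)) (l : Fin (n X')),
      (t X).ι j ≫ m f ≫ (t X').π l = Θ ((s X).ι j ≫ f ≫ (s X').π l) := by
    intro X X' f j l
    rw [← Category.assoc, (t X).ι_sum, (t X').sum_π]
  have hext : ∀ {X X' : C} {f g : Y X ⟶ Y X'},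
      (∀ j l, (t X).ι j ≫ f ≫ (t X').π l = (t X).ι j ≫ g ≫ (t X').π l) → f = g := by
    intro X X' f g h
    refine (t X).ext_from fun j => (t X').ext_to fun l => ?_
    simpa only [Category.assoc] using h j l
  let F : C ⥤ D :=
    { obj := Y
      map := m
      map_id := fun X => hext fun j l => by
        rw [hm, Category.id_comp, Category.id_comp]
        by_cases h : j = l
        · subst h
          rw [(s X).ι_π_self, (t X).ι_π_self, hid]
        · rw [(s X).ι_π_ne h, (t X).ι_π_ne h, hzero]
      map_comp := fun {X X' X''} f g => hext fun j l => by
        rw [hm]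
        -- Inserting the decomposition of the middle identity, on both sides, reduces functoriality
        -- to matrix multiplication.
        have h1 : (s X).ι j ≫ (f ≫ g) ≫ (s X'').π l =
            ∑ i, ((s X).ι j ≫ f ≫ (s X').π i) ≫ (s X').ι i ≫ g ≫ (s X'').π l := by
          have : (s X).ι j ≫ (f ≫ g) ≫ (s X'').π l =
            ((s X).ι j ≫ f) ≫ 𝟙 X' ≫ g ≫ (s X'').π l := by simp
          rw [this, ← (s X').total]
          simp only [Preadditive.sum_comp, Preadditive.comp_sum, Category.assoc]
        have h2 : (t X).ι j ≫ (m f ≫ m g) ≫ (t X'').π l =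
            ∑ i, ((t X).ι j ≫ m f ≫ (t X').π i) ≫ (t X').ι i ≫ m g ≫ (t X'').π l := by
          have : (t X).ι j ≫ (m f ≫ m g) ≫ (t X'').π l =
            ((t X).ι j ≫ m f) ≫ 𝟙 (Y X') ≫ m g ≫ (t X'').π l := by simp
          rw [this, ← (t X').total]
          simp only [Preadditive.sum_comp, Preadditive.comp_sum, Category.assoc]
        rw [h1, h2, hsum]
        exact Finset.sum_congr rfl fun i _ => by rw [hcomp, hm, hm] }
  refine ⟨F, ⟨fun {X X' f g} => hext fun j l => ?_⟩, ⟨fun {X X'} f c => hext fun j l => ?_⟩,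
    fun b => ⟨?_⟩⟩
  · rw [Preadditive.add_comp, Preadditive.comp_add]
    change (t X).ι j ≫ m (f + g) ≫ (t X').π l =
      (t X).ι j ≫ m f ≫ (t X').π l + (t X).ι j ≫ m g ≫ (t X').π l
    rw [hm, hm, hm, Preadditive.add_comp, Preadditive.comp_add, hadd]
  · rw [Linear.smul_comp, Linear.comp_smul]
    change (t X).ι j ≫ m (c • f) ≫ (t X').π l = c • ((t X).ι j ≫ m f ≫ (t X').π l)
    rw [hm, hm, Linear.smul_comp, Linear.comp_smul, hsmul]
  -- The object assigned to `S b` is a sum over its chosen decomposition; the comparison with `A b`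
  -- applies `Θ` to the injections and projections of that decomposition.
  · refine ⟨∑ j, (t (S b)).π j ≫ Θ ((s (S b)).ι j), ∑ j, Θ ((s (S b)).π j) ≫ (t (S b)).ι j, ?_, ?_⟩
    · refine (t (S b)).ext_from fun j => (t (S b)).ext_to fun l => ?_
      rw [← Category.assoc, (t (S b)).ι_sum, Category.assoc, (t (S b)).sum_π, ← hcomp]
      change _ = ((t (S b)).ι j ≫ 𝟙 _) ≫ (t (S b)).π l
      rw [Category.comp_id]
      by_cases h : j = l
      · subst h
        rw [(s (S b)).ι_π_self, (t (S b)).ι_π_self, hid]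
      · rw [(s (S b)).ι_π_ne h, (t (S b)).ι_π_ne h, hzero]
    · rw [Preadditive.sum_comp]
      have : 𝟙 (A b) = Θ (∑ j, (s (S b)).π j ≫ (s (S b)).ι j) := by rw [(s (S b)).total, hid]
      rw [this, hsum]
      exact Finset.sum_congr rfl fun j _ => by
        rw [Category.assoc, (t (S b)).ι_sum, hcomp]

open Classical in
/-- The scalar multiples of the identities, in a family of objects. -/
def scalarHom {k : Type*} [Field k] [Linear k C] {ι : Type w} (S : ι → C) (c : k) (a b : ι) :
    S a ⟶ S b :=
  if h : a = b then c • eqToHom (congrArg S h) else 0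

section Scalar

variable {k : Type*} [Field k] [Linear k C] [Linear k D] {ι : Type w} (S : ι → C) (A : ι → D)

@[simp] lemma scalarHom_self (c : k) (a : ι) : scalarHom S c a a = c • 𝟙 (S a) := by
  simp [scalarHom]

lemma scalarHom_ne (c : k) {a b : ι} (h : a ≠ b) : scalarHom S c a b = 0 := by
  simp [scalarHom, h]

lemma scalarHom_add (c d : k) (a b : ι) :
    scalarHom S (c + d) a b = scalarHom S c a b + scalarHom S d a b := by
  by_cases h : a = b
  · subst h; simp [add_smul]
  · simp [scalarHom_ne S _ h]

lemma scalarHom_mul (c d : k) (a b : ι) :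
    scalarHom S (c * d) a b = c • scalarHom S d a b := by
  by_cases h : a = b
  · subst h; simp [mul_smul]
  · simp [scalarHom_ne S _ h]

/-- A nonzero scalar on the diagonal gives the zero map only if the object itself is zero, and `hz`
carries this from `S` to `A`. -/
lemma scalarHom_zero_of_zero (hz : ∀ (a : ι), 𝟙 (S a) = 0 → 𝟙 (A a) = 0) {c : k} {a b : ι}
    (h : scalarHom S c a b = 0) : scalarHom A c a b = 0 := by
  by_cases hab : a = b
  · subst hab
    rw [scalarHom_self] at h ⊢
    by_cases hc : c = 0
    · rw [hc, zero_smul]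
    · rw [hz a ((smul_eq_zero_iff_right hc).1 h), smul_zero]
  · exact scalarHom_ne A c hab

/-- The functor extending a map of objects, if all morphisms between the given objects are
scalar. -/
theorem exists_linear_functor_of_scalar
    (hC : ∀ X : C, ∃ (n : ℕ) (a : Fin n → ι), Nonempty (FamilySum (fun j => S (a j)) X))
    (hD : ∀ (n : ℕ) (a : Fin n → ι), ∃ Y : D, Nonempty (FamilySum (fun j => A (a j)) Y))
    (hS : ∀ (a b : ι) (f : S a ⟶ S b), ∃ c : k, f = scalarHom S c a b)
    (hz : ∀ (a : ι), 𝟙 (S a) = 0 → 𝟙 (A a) = 0) :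
    ∃ F : C ⥤ D, F.Additive ∧ F.Linear k ∧ ∀ a, Nonempty (F.obj (S a) ≅ A a) := by
  choose c hc using hS
  -- The scalar representing a map is arbitrary when `a ≠ b` or when `S a` is zero, so the chosen
  -- `c` need not be additive or multiplicative. Only the map it induces on the side of `A` is well
  -- defined, and all functor laws are checked there.
  have huniq : ∀ {a b : ι} {x y : k}, scalarHom S x a b = scalarHom S y a b →
      scalarHom A x a b = scalarHom A y a b := by
    intro a b x y h
    have := scalarHom_zero_of_zero S A hz (c := x - y) (a := a) (b := b) (by
      rw [eq_comm, ← sub_eq_zero] at h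
      have h2 := scalarHom_add S (x - y) y a b
      rw [sub_add_cancel] at h2
      rw [← sub_eq_iff_eq_add.2 h2, ← neg_sub, h, neg_zero])
    have h2 := scalarHom_add A (x - y) y a b
    rw [sub_add_cancel, this, zero_add] at h2
    exact h2
  refine exists_linear_functor (k := k) S A hC hD (fun {a b} f => scalarHom A (c a b f) a b)
    ?_ ?_ ?_ ?_
  · intro a
    have : scalarHom A (c a a (𝟙 (S a))) a a = scalarHom A (1 : k) a a :=
      huniq (by rw [← hc]; simp)
    simpa using this
  · intro a b d f g
    by_cases hab : a = b
    · subst hab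
      have h1 : scalarHom S (c a d (f ≫ g)) a d =
          scalarHom S (c a a f * c a d g) a d := by
        rw [← hc, scalarHom_mul, ← hc]
        conv_lhs => rw [hc a a f]
        simp
      rw [huniq h1, scalarHom_mul]
      simp
    · have h0 : f = 0 := by rw [hc a b f, scalarHom_ne S _ hab]
      rw [scalarHom_ne A _ hab, Limits.zero_comp]
      have h1 : scalarHom S (c a d (f ≫ g)) a d = scalarHom S (0 : k) a d := by
        have h2 : scalarHom S (0 : k) a d = 0 := by
          by_cases h : a = d
          · subst h; simp
          · exact scalarHom_ne S _ h
        rw [← hc, h0, Limits.zero_comp, h2]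
      rw [huniq h1]
      by_cases h : a = d
      · subst h; simp
      · exact scalarHom_ne A _ h
  · intro a b f g
    rw [← scalarHom_add]
    exact huniq (by rw [← hc, scalarHom_add, ← hc, ← hc])
  · intro a b x f
    rw [← scalarHom_mul]
    exact huniq (by rw [← hc, scalarHom_mul, ← hc])

/-- Linear functors are determined by their values on the given objects, if all morphisms between
these are scalar. -/
theorem exists_natIso_of_scalar
    (hC : ∀ X : C, ∃ (n : ℕ) (a : Fin n → ι), Nonempty (FamilySum (fun j => S (a j)) X))
    (hS : ∀ (a b : ι) (f : S a ⟶ S b), ∃ c : k, f = scalarHom S c a b)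
    (F F' : C ⥤ D) [F.Additive] [F'.Additive] [F.Linear k] [F'.Linear k]
    (θ : ∀ a, F.obj (S a) ≅ F'.obj (S a)) :
    ∃ η : F ≅ F', ∀ a, η.hom.app (S a) = (θ a).hom := by
  refine exists_natIso_of_familySum S hC F F' θ fun a b f => ?_
  obtain ⟨c, rfl⟩ := hS a b f
  by_cases h : a = b
  · subst h
    simp [Functor.map_smul]
  · simp [scalarHom_ne S _ h]

/-- A linear functor is faithful if it kills none of the given objects. -/
theorem map_injective_of_scalar
    (hC : ∀ X : C, ∃ (n : ℕ) (a : Fin n → ι), Nonempty (FamilySum (fun j => S (a j)) X))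
    (hS : ∀ (a b : ι) (f : S a ⟶ S b), ∃ c : k, f = scalarHom S c a b)
    (F : C ⥤ D) [F.Additive] [F.Linear k]
    (hz : ∀ a, 𝟙 (F.obj (S a)) = 0 → 𝟙 (S a) = 0) {X Y : C} {f : X ⟶ Y} (hf : F.map f = 0) :
    f = 0 := by
  have key : ∀ (x y : ι) (c : k), F.map (scalarHom S c x y) = 0 → scalarHom S c x y = 0 := by
    intro x y c h0
    by_cases h : x = y
    · subst h
      rw [scalarHom_self, Functor.map_smul, CategoryTheory.Functor.map_id] at h0
      rw [scalarHom_self]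
      by_cases hc0 : c = 0
      · rw [hc0, zero_smul]
      · rw [hz _ ((smul_eq_zero_iff_right hc0).1 h0), smul_zero]
    · exact scalarHom_ne S _ h
  obtain ⟨n, a, ⟨s⟩⟩ := hC X
  obtain ⟨m, b, ⟨t⟩⟩ := hC Y
  -- Faithfulness is tested on matrix entries, each of which is a scalar map between generators.
  refine s.ext_from fun j => t.ext_to fun l => ?_
  rw [Limits.comp_zero, Limits.zero_comp]
  obtain ⟨c, hc⟩ := hS _ _ ((s.ι j ≫ f) ≫ t.π l)
  have h0 : F.map ((s.ι j ≫ f) ≫ t.π l) = 0 := by simp [hf]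
  rw [hc] at h0 ⊢
  exact key _ _ _ h0

end Scalar

end FamilySums

/-! ### Sequences `Ω Z ⟶ X ⟶ Y ⟶ Z`: splittings, exactness, rotation -/

section Triangles

universe v₁ v₂ u₁ u₂

variable {C : Type u₁} [Category.{v₁} C]

lemma LeftTriangle.IsIsomorphic.trans {Ω : C ⥤ C} {T T' T'' : LeftTriangle Ω} (h : T.IsIsomorphic T')
    (h' : T'.IsIsomorphic T'') : T.IsIsomorphic T'' := by
  obtain ⟨a, b, c, h₁, h₂, h₃⟩ := h
  obtain ⟨a', b', c', h₁', h₂', h₃'⟩ := h'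
  refine ⟨a ≪≫ a', b ≪≫ b', c ≪≫ c', ?_, ?_, ?_⟩
  · rw [Iso.trans_hom, ← Category.assoc, h₁, Category.assoc, h₁', Iso.trans_hom, Ω.map_comp,
      Category.assoc]
  · rw [Iso.trans_hom, ← Category.assoc, h₂, Category.assoc, h₂', Iso.trans_hom, Category.assoc]
  · rw [Iso.trans_hom, ← Category.assoc, h₃, Category.assoc, h₃', Iso.trans_hom, Category.assoc]

variable [Preadditive C] {D : Type u₂} [Category.{v₂} D] [Preadditive D]

/-- The structure of a direct sum of `A` and `B` on an object `X`. -/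
structure BinarySum (A B X : C) where
  inl : A ⟶ X
  inr : B ⟶ X
  fst : X ⟶ A
  snd : X ⟶ B
  inl_fst : inl ≫ fst = 𝟙 A
  inr_snd : inr ≫ snd = 𝟙 B
  inl_snd : inl ≫ snd = 0
  inr_fst : inr ≫ fst = 0
  total : fst ≫ inl + snd ≫ inr = 𝟙 X

namespace BinarySum

attribute [simp] inl_fst inr_snd inl_snd inr_fst

variable {A B X Y : C} (s : BinarySum A B X)

@[simp] lemma inl_fst_assoc (f : A ⟶ Y) : s.inl ≫ s.fst ≫ f = f := by
  rw [← Category.assoc, s.inl_fst, Category.id_comp]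

@[simp] lemma inr_snd_assoc (f : B ⟶ Y) : s.inr ≫ s.snd ≫ f = f := by
  rw [← Category.assoc, s.inr_snd, Category.id_comp]

@[simp] lemma inl_snd_assoc (f : B ⟶ Y) : s.inl ≫ s.snd ≫ f = 0 := by
  rw [← Category.assoc, s.inl_snd, Limits.zero_comp]

@[simp] lemma inr_fst_assoc (f : A ⟶ Y) : s.inr ≫ s.fst ≫ f = 0 := by
  rw [← Category.assoc, s.inr_fst, Limits.zero_comp]

variable {A' : C}

/-- Additive functors preserve direct sums. -/
def map (s : BinarySum A B X) (F : C ⥤ D) [F.Additive] :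
    BinarySum (F.obj A) (F.obj B) (F.obj X) where
  inl := F.map s.inl
  inr := F.map s.inr
  fst := F.map s.fst
  snd := F.map s.snd
  inl_fst := by rw [← F.map_comp, s.inl_fst, F.map_id]
  inr_snd := by rw [← F.map_comp, s.inr_snd, F.map_id]
  inl_snd := by rw [← F.map_comp, s.inl_snd, F.map_zero]
  inr_fst := by rw [← F.map_comp, s.inr_fst, F.map_zero]
  total := by rw [← F.map_comp, ← F.map_comp, ← F.map_add, s.total, F.map_id]

/-- Replacing the first summand by an isomorphic object. -/
def congrLeft (s : BinarySum A B X) (e : A ≅ A') : BinarySum A' B X where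
  inl := e.inv ≫ s.inl
  inr := s.inr
  fst := s.fst ≫ e.hom
  snd := s.snd
  inl_fst := by simp
  inr_snd := by simp
  inl_snd := by simp
  inr_fst := by simp
  total := by simpa using s.total

/-- Replacing the sum by an isomorphic object. -/
def ofIso (s : BinarySum A B X) (e : X ≅ Y) : BinarySum A B Y where
  inl := s.inl ≫ e.hom
  inr := s.inr ≫ e.hom
  fst := e.inv ≫ s.fst
  snd := e.inv ≫ s.snd
  inl_fst := by simp
  inr_snd := by simp
  inl_snd := by simp
  inr_fst := by simp
  total := by
    have : (e.inv ≫ s.fst) ≫ s.inl ≫ e.hom + (e.inv ≫ s.snd) ≫ s.inr ≫ e.hom =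
        e.inv ≫ (s.fst ≫ s.inl + s.snd ≫ s.inr) ≫ e.hom := by
      simp only [Preadditive.add_comp, Preadditive.comp_add, Category.assoc]
    rw [this, s.total, Category.id_comp, Iso.inv_hom_id]

/-- Two direct sums of the same objects are isomorphic. -/
@[simps] def iso (s : BinarySum A B X) (t : BinarySum A B Y) : X ≅ Y where
  hom := s.fst ≫ t.inl + s.snd ≫ t.inr
  inv := t.fst ≫ s.inl + t.snd ≫ s.inr
  hom_inv_id := by simpa using s.total
  inv_hom_id := by simpa using t.total

end BinarySum

/-- A direct sum decomposition of a morphism, into an isomorphism and a zero morphism. -/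
structure MorphismSplitting {Y Z : C} (g : Y ⟶ Z) where
  N : C
  K : C
  I : C
  sY : BinarySum K I Y
  sZ : BinarySum N I Z
  eq : g = sY.snd ≫ sZ.inr

namespace LeftTriangle

/-- A direct sum decomposition of a sequence `Ω Z ⟶ X ⟶ Y ⟶ Z`, into rotations of the sequences
`Ω I ⟶ 0 ⟶ I ⟶ I`. -/
structure Splitting {Ω : C ⥤ C} (T : LeftTriangle Ω) where
  N : C
  K : C
  I : C
  sX : BinarySum (Ω.obj N) K T.X
  sY : BinarySum K I T.Y
  sZ : BinarySum N I T.Z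
  h_eq : T.h = Ω.map sZ.fst ≫ sX.inl
  f_eq : T.f = sX.snd ≫ sY.inl
  g_eq : T.g = sY.snd ≫ sZ.inr

/-- Additive looped functors preserve split sequences. -/
def Splitting.map {Ω : C ⥤ C} {Δ : D ⥤ D} {T : LeftTriangle Ω} (s : T.Splitting) (F : C ⥤ D)
    [F.Additive] (δ : Ω ⋙ F ≅ F ⋙ Δ) : (T.map F δ).Splitting where
  N := F.obj s.N
  K := F.obj s.K
  I := F.obj s.I
  sX := (s.sX.map F).congrLeft (δ.app s.N)
  sY := s.sY.map F
  sZ := s.sZ.map F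
  h_eq := by
    have := δ.inv.naturality s.sZ.fst
    change Δ.map (F.map s.sZ.fst) ≫ δ.inv.app s.N = δ.inv.app T.Z ≫ F.map (Ω.map s.sZ.fst) at this
    change δ.inv.app T.Z ≫ F.map T.h = Δ.map (F.map s.sZ.fst) ≫ δ.inv.app s.N ≫ F.map s.sX.inl
    rw [s.h_eq, F.map_comp, ← Category.assoc, ← this, Category.assoc]
  f_eq := by
    change F.map T.f = F.map s.sX.snd ≫ F.map s.sY.inl
    rw [s.f_eq, F.map_comp]
  g_eq := by
    change F.map T.g = F.map s.sY.snd ≫ F.map s.sZ.inr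
    rw [s.g_eq, F.map_comp]

/-- The split sequence completing a split morphism. -/
def ofSplitting {Ω : C ⥤ C} {Y Z : C} {g : Y ⟶ Z} (s : MorphismSplitting g) {X : C}
    (t : BinarySum (Ω.obj s.N) s.K X) : LeftTriangle Ω where
  X := X
  Y := Y
  Z := Z
  h := Ω.map s.sZ.fst ≫ t.inl
  f := t.snd ≫ s.sY.inl
  g := g

/-- The sequence completing a split morphism is split. -/
def splittingOfSplitting {Ω : C ⥤ C} {Y Z : C} {g : Y ⟶ Z} (s : MorphismSplitting g) {X : C}
    (t : BinarySum (Ω.obj s.N) s.K X) : (ofSplitting s t).Splitting where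
  N := s.N
  K := s.K
  I := s.I
  sX := t
  sY := s.sY
  sZ := s.sZ
  h_eq := rfl
  f_eq := rfl
  g_eq := s.eq

/-- Two split sequences with the same summands are isomorphic. -/
lemma Splitting.isIsomorphic {Ω : C ⥤ C} {T T' : LeftTriangle Ω} (s : T.Splitting)
    (s' : T'.Splitting) (hN : s.N = s'.N) (hK : s.K = s'.K) (hI : s.I = s'.I) :
    T.IsIsomorphic T' := by
  obtain ⟨N, K, I, sX, sY, sZ, hh, hf, hg⟩ := s
  obtain ⟨N', K', I', sX', sY', sZ', hh', hf', hg'⟩ := s'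
  obtain rfl : N = N' := hN
  obtain rfl : K = K' := hK
  obtain rfl : I = I' := hI
  refine ⟨sX.iso sX', sY.iso sY', sZ.iso sZ', ?_, ?_, ?_⟩
  · rw [hh, hh', ← Category.assoc, ← Ω.map_comp]
    simp
  · rw [hf, hf']
    simp
  · rw [hg, hg']
    simp

/-- Exactness of the sequence `Ω Y ⟶ Ω Z ⟶ X ⟶ Y ⟶ Z` under all covariant Hom functors. -/
structure IsExact {Ω : C ⥤ C} (T : LeftTriangle Ω) : Prop where
  f_g : T.f ≫ T.g = 0
  h_f : T.h ≫ T.f = 0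
  map_g_h : Ω.map T.g ≫ T.h = 0
  exists_f : ∀ {W : C} (x : W ⟶ T.Y), x ≫ T.g = 0 → ∃ y : W ⟶ T.X, y ≫ T.f = x
  exists_h : ∀ {W : C} (x : W ⟶ T.X), x ≫ T.f = 0 → ∃ y : W ⟶ Ω.obj T.Z, y ≫ T.h = x
  exists_map_g : ∀ {W : C} (x : W ⟶ Ω.obj T.Z), x ≫ T.h = 0 →
    ∃ y : W ⟶ Ω.obj T.Y, y ≫ Ω.map T.g = x

lemma IsExact.of_isIsomorphic {Ω : C ⥤ C} {T T' : LeftTriangle Ω} (h : T.IsIsomorphic T')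
    (hT : T'.IsExact) : T.IsExact := by
  obtain ⟨a, b, c, h₁, h₂, h₃⟩ := h
  have c_inv : Ω.map c.hom ≫ Ω.map c.inv = 𝟙 _ := by rw [← Ω.map_comp]; simp
  have inv_c : Ω.map c.inv ≫ Ω.map c.hom = 𝟙 _ := by rw [← Ω.map_comp]; simp
  have b_inv : Ω.map b.hom ≫ Ω.map b.inv = 𝟙 _ := by rw [← Ω.map_comp]; simp
  have h₄ : Ω.map T.g ≫ Ω.map c.hom = Ω.map b.hom ≫ Ω.map T'.g := by
    rw [← Ω.map_comp, h₃, Ω.map_comp]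
  refine ⟨?_, ?_, ?_, ?_, ?_, ?_⟩
  · rw [← cancel_mono c.hom, Category.assoc, h₃, ← Category.assoc, h₂, Category.assoc, hT.f_g]
    simp
  · rw [← cancel_mono b.hom, Category.assoc, h₂, ← Category.assoc, h₁, Category.assoc, hT.h_f]
    simp
  · rw [← cancel_mono a.hom, Category.assoc, h₁, ← Category.assoc, h₄, Category.assoc, hT.map_g_h]
    simp
  · intro W x hx
    obtain ⟨y, hy⟩ := hT.exists_f (x ≫ b.hom) (by
      rw [Category.assoc, ← h₃, ← Category.assoc, hx, Limits.zero_comp])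
    refine ⟨y ≫ a.inv, ?_⟩
    rw [← cancel_mono b.hom, ← hy, Category.assoc, Category.assoc, h₂, Iso.inv_hom_id_assoc]
  · intro W x hx
    obtain ⟨y, hy⟩ := hT.exists_h (x ≫ a.hom) (by
      rw [Category.assoc, ← h₂, ← Category.assoc, hx, Limits.zero_comp])
    refine ⟨y ≫ Ω.map c.inv, ?_⟩
    rw [← cancel_mono a.hom, ← hy, Category.assoc, Category.assoc, h₁, ← Category.assoc (Ω.map _),
      inv_c, Category.id_comp]
  · intro W x hx
    obtain ⟨y, hy⟩ := hT.exists_map_g (x ≫ Ω.map c.hom) (by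
      rw [Category.assoc, ← h₁, ← Category.assoc, hx, Limits.zero_comp])
    refine ⟨y ≫ Ω.map b.inv, ?_⟩
    have h₅ : Ω.map b.inv ≫ Ω.map T.g = Ω.map T'.g ≫ Ω.map c.inv := by
      rw [← Ω.map_comp, ← Ω.map_comp]
      congr 1
      rw [Iso.inv_comp_eq, ← Category.assoc, ← h₃, Category.assoc, Iso.hom_inv_id,
        Category.comp_id]
    rw [Category.assoc, h₅, ← Category.assoc, hy, Category.assoc, c_inv, Category.comp_id]

/-- An exact sequence whose last morphism is split is split. -/
theorem IsExact.nonempty_splitting {Ω : C ⥤ C} [Ω.Additive] {T : LeftTriangle Ω} (hT : T.IsExact)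
    (s : MorphismSplitting T.g) : Nonempty T.Splitting := by
  obtain ⟨N, K, I, sY, sZ, hg⟩ := s
  have hinlg : sY.inl ≫ T.g = 0 := by rw [hg, ← Category.assoc]; simp
  have hgfst : T.g ≫ sZ.fst = 0 := by rw [hg, Category.assoc]; simp
  -- the section of the map from `X` to `K`
  obtain ⟨i, hi⟩ := hT.exists_f sY.inl hinlg
  let p := T.f ≫ sY.fst
  have hfsnd : T.f ≫ sY.snd = 0 := by
    have : (T.f ≫ T.g) ≫ sZ.snd = 0 := by rw [hT.f_g, Limits.zero_comp]
    rw [hg] at this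
    simpa using this
  have hp : T.f = p ≫ sY.inl := by
    conv_lhs => rw [← Category.comp_id T.f, ← sY.total, Preadditive.comp_add,
      ← Category.assoc T.f sY.snd, hfsnd]
    simp [p]
  have hip : i ≫ p = 𝟙 K := by
    change i ≫ T.f ≫ sY.fst = _
    rw [← Category.assoc, hi, sY.inl_fst]
  -- the component of `h` at `Ω C`
  let j := Ω.map sZ.inl ≫ T.h
  have hinrh : Ω.map sZ.inr ≫ T.h = 0 := by
    have : Ω.map sY.inr ≫ Ω.map T.g ≫ T.h = 0 := by rw [hT.map_g_h, Limits.comp_zero]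
    rw [← Category.assoc, ← Ω.map_comp, hg] at this
    simpa using this
  have hj : T.h = Ω.map sZ.fst ≫ j := by
    have h1 : Ω.map (𝟙 T.Z) ≫ T.h = T.h := by rw [Ω.map_id, Category.id_comp]
    rw [← sZ.total, Ω.map_add, Ω.map_comp, Ω.map_comp, Preadditive.add_comp, Category.assoc,
      Category.assoc, hinrh] at h1
    simpa [j] using h1.symm
  -- `j` is a monomorphism: what it kills comes from `Ω.map T.g`, and `T.g` has no component in `N`.
  have hmono : ∀ {W : C} (x : W ⟶ Ω.obj N), x ≫ j = 0 → x = 0 := by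
    intro W x hx
    obtain ⟨y, hy⟩ := hT.exists_map_g (x ≫ Ω.map sZ.inl) (by rw [Category.assoc]; exact hx)
    have h1 : x = (x ≫ Ω.map sZ.inl) ≫ Ω.map sZ.fst := by
      rw [Category.assoc, ← Ω.map_comp, sZ.inl_fst, Ω.map_id, Category.comp_id]
    rw [h1, ← hy, Category.assoc, ← Ω.map_comp, hgfst, Ω.map_zero, Limits.comp_zero]
  have hjp : j ≫ p = 0 := by
    change (Ω.map sZ.inl ≫ T.h) ≫ T.f ≫ sY.fst = 0
    rw [Category.assoc, ← Category.assoc T.h, hT.h_f]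
    simp
  -- The complement of the idempotent `p ≫ i` is killed by `T.f`, so it factors through `T.h`, hence
  -- through `j`; this yields the projection onto `Ω N`.
  obtain ⟨r, hr⟩ := hT.exists_h (𝟙 T.X - p ≫ i) (by
    rw [Preadditive.sub_comp, Category.id_comp, Category.assoc, hi, ← hp, sub_self])
  rw [hj, ← Category.assoc] at hr
  set q := r ≫ Ω.map sZ.fst
  refine ⟨N, K, I, ⟨j, i, q, p, ?_, hip, hjp, ?_, ?_⟩, sY, sZ, hj, hp, hg⟩
  · rw [← sub_eq_zero]
    refine hmono _ ?_
    rw [Preadditive.sub_comp, Category.assoc, hr, Preadditive.comp_sub, ← Category.assoc j, hjp]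
    simp
  · refine hmono _ ?_
    rw [Category.assoc, hr, Preadditive.comp_sub, ← Category.assoc i, hip]
    simp
  · rw [hr, sub_add_cancel]

/-- The five lemma for exact sequences. -/
theorem IsExact.nonempty_iso {Ω : C ⥤ C} {T T' : LeftTriangle Ω} (hT : T.IsExact)
    (hT' : T'.IsExact) (a : T.X ⟶ T'.X) (b : T.Y ≅ T'.Y) (c : T.Z ≅ T'.Z)
    (hh : T.h ≫ a = Ω.map c.hom ≫ T'.h) (hf : T.f ≫ b.hom = a ≫ T'.f)
    (hg : T.g ≫ c.hom = b.hom ≫ T'.g) : Nonempty (T.X ≅ T'.X) := by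
  have hg' : b.inv ≫ T.g = T'.g ≫ c.inv := by
    rw [Iso.inv_comp_eq, ← Category.assoc, ← hg, Category.assoc, Iso.hom_inv_id, Category.comp_id]
  have c_inv : Ω.map c.hom ≫ Ω.map c.inv = 𝟙 _ := by rw [← Ω.map_comp]; simp
  have inv_c : Ω.map c.inv ≫ Ω.map c.hom = 𝟙 _ := by rw [← Ω.map_comp]; simp
  -- By Yoneda it is enough that composition with `a` be bijective on maps from every `W`, which is
  -- a diagram chase.
  have surj : ∀ {W : C} (x : W ⟶ T'.X), ∃ y : W ⟶ T.X, y ≫ a = x := by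
    intro W x
    obtain ⟨y, hy⟩ := hT.exists_f ((x ≫ T'.f) ≫ b.inv) (by
      rw [Category.assoc, hg', Category.assoc, ← Category.assoc T'.f, hT'.f_g]
      simp)
    obtain ⟨r, hr⟩ := hT'.exists_h (x - y ≫ a) (by
      rw [Preadditive.sub_comp, Category.assoc, ← hf, ← Category.assoc, hy, Category.assoc,
        Iso.inv_hom_id, Category.comp_id, sub_self])
    refine ⟨y + r ≫ Ω.map c.inv ≫ T.h, ?_⟩
    rw [Preadditive.add_comp, Category.assoc, Category.assoc, hh, ← Category.assoc (Ω.map c.inv),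
      inv_c, Category.id_comp, hr, add_sub_cancel]
  have inj : ∀ {W : C} (x : W ⟶ T.X), x ≫ a = 0 → x = 0 := by
    intro W x hx
    obtain ⟨r, hr⟩ := hT.exists_h x (by
      rw [← cancel_mono b.hom, Category.assoc, hf, ← Category.assoc, hx]
      simp)
    obtain ⟨y, hy⟩ := hT'.exists_map_g (r ≫ Ω.map c.hom) (by
      rw [Category.assoc, ← hh, ← Category.assoc, hr, hx])
    -- `r` comes from `Ω T.Y`, so its composite with `T.h`, which is `x`, vanishes.
    have h1 : r = (y ≫ Ω.map b.inv) ≫ Ω.map T.g := by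
      rw [Category.assoc, ← Ω.map_comp, hg', Ω.map_comp, ← Category.assoc, hy, Category.assoc,
        c_inv, Category.comp_id]
    rw [← hr, h1, Category.assoc, hT.map_g_h, Limits.comp_zero]
  obtain ⟨y, hy⟩ := surj (𝟙 _)
  refine ⟨⟨a, y, ?_, hy⟩⟩
  rw [← sub_eq_zero]
  refine inj _ ?_
  rw [Preadditive.sub_comp, Category.assoc, hy]
  simp

/-- The rotated sequence. -/
def rotate {Ω : C ⥤ C} (T : LeftTriangle Ω) : LeftTriangle Ω where
  X := Ω.obj T.Z
  Y := T.X
  Z := T.Y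
  h := -Ω.map T.g
  f := T.h
  g := T.f

lemma IsIsomorphic.rotate {Ω : C ⥤ C} {T T' : LeftTriangle Ω} (h : T.IsIsomorphic T') :
    T.rotate.IsIsomorphic T'.rotate := by
  obtain ⟨a, b, c, h₁, h₂, h₃⟩ := h
  refine ⟨Ω.mapIso c, a, b, ?_, h₁, h₂⟩
  change (-Ω.map T.g) ≫ Ω.map c.hom = Ω.map b.hom ≫ (-Ω.map T'.g)
  rw [Preadditive.neg_comp, Preadditive.comp_neg, ← Ω.map_comp, h₃, Ω.map_comp]

end LeftTriangle

end Triangles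

/-! ### Short exact sequences of modules and exactness in the stable category -/

section StableCategory

variable {R : Type u} [Ring R]

namespace StableCat

lemma ofHom_eq_iff {M N : FGModuleCat.{u} R} {f g : M ⟶ N} :
    StableCat.ofHom f = StableCat.ofHom g ↔ FactorsThroughProjective (f - g) :=
  CategoryTheory.Quotient.functor_map_eq_iff _ _ _

lemma ofHom_eq_zero_iff {M N : FGModuleCat.{u} R} {f : M ⟶ N} :
    StableCat.ofHom f = 0 ↔ FactorsThroughProjective f := by
  rw [← (CategoryTheory.Quotient.functor (stableRel R)).map_zero, ofHom_eq_iff, sub_zero]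

lemma exists_ofHom {M N : FGModuleCat.{u} R} (f : StableCat.of M ⟶ StableCat.of N) :
    ∃ f' : M ⟶ N, StableCat.ofHom f' = f :=
  (CategoryTheory.Quotient.functor (stableRel R)).map_surjective f

lemma ofHom_comp {M N L : FGModuleCat.{u} R} (f : M ⟶ N) (g : N ⟶ L) :
    StableCat.ofHom (f ≫ g) = StableCat.ofHom f ≫ StableCat.ofHom g := Functor.map_comp _ _ _

lemma ofHom_id (M : FGModuleCat.{u} R) : StableCat.ofHom (𝟙 M) = 𝟙 (StableCat.of M) :=
  CategoryTheory.Functor.map_id _ _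

lemma ofHom_add {M N : FGModuleCat.{u} R} (f g : M ⟶ N) :
    StableCat.ofHom (f + g) = StableCat.ofHom f + StableCat.ofHom g := Functor.map_add _

lemma ofHom_neg {M N : FGModuleCat.{u} R} (f : M ⟶ N) :
    StableCat.ofHom (-f) = -StableCat.ofHom f := Functor.map_neg _

lemma ofHom_zero {M N : FGModuleCat.{u} R} :
    StableCat.ofHom (0 : M ⟶ N) = 0 := Functor.map_zero _ _ _

lemma ofHom_smul {k : Type u} [Field k] [Algebra k R] {M N : FGModuleCat.{u} R} (c : k)
    (f : M ⟶ N) : StableCat.ofHom (c • f) = c • StableCat.ofHom f := rfl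

end StableCat

/-- The direct sum of two modules. -/
def prodSum (M N : FGModuleCat.{u} R) : BinarySum M N (FGModuleCat.of R (M × N)) where
  inl := FGModuleCat.ofHom (LinearMap.inl R M N)
  inr := FGModuleCat.ofHom (LinearMap.inr R M N)
  fst := FGModuleCat.ofHom (LinearMap.fst R M N)
  snd := FGModuleCat.ofHom (LinearMap.snd R M N)
  inl_fst := rfl
  inr_snd := rfl
  inl_snd := rfl
  inr_fst := rfl
  total := FGModuleCat.hom_ext (LinearMap.ext fun x => Prod.ext (add_zero x.1) (zero_add x.2))

open Classical in
/-- The direct sum of a finite family of modules. -/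
def piSum {J : Type} [Fintype J] (M : J → FGModuleCat.{u} R) :
    FamilySum M (FGModuleCat.of R (∀ j, M j)) where
  ι j := FGModuleCat.ofHom (LinearMap.single R (fun j => M j) j)
  π j := FGModuleCat.ofHom (LinearMap.proj j)
  ι_π_self j := FGModuleCat.hom_ext (LinearMap.proj_comp_single_same R (fun j => M j) j)
  ι_π_ne {j l} h := FGModuleCat.hom_ext (LinearMap.proj_comp_single_ne R (fun j => M j) l j h.symm)
  total := FGModuleCat.hom_ext <| by
    refine LinearMap.ext fun x => ?_
    let φ : (FGModuleCat.of R (∀ j, M j) ⟶ FGModuleCat.of R (∀ j, M j)) →+ (∀ j, M j) :=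
      AddMonoidHom.mk' (fun f => f.hom.hom x) fun _ _ => rfl
    change φ (∑ j, _) = x
    rw [map_sum]
    exact Finset.univ_sum_single x

/-- Short exact sequences of modules. -/
structure ShortExact {X Y Z : FGModuleCat.{u} R} (f : X ⟶ Y) (g : Y ⟶ Z) : Prop where
  injective : Function.Injective f.hom.hom
  exact : Function.Exact f.hom.hom g.hom.hom
  surjective : Function.Surjective g.hom.hom

namespace ShortExact

variable {X Y Z W : FGModuleCat.{u} R} {f : X ⟶ Y} {g : Y ⟶ Z}

lemma comp (hs : ShortExact f g) : f ≫ g = 0 := by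
  ext x
  exact hs.exact.apply_apply_eq_zero x

lemma exists_lift (hs : ShortExact f g) {P : FGModuleCat.{u} R} [Module.Projective R P]
    (b : P ⟶ Z) : ∃ b' : P ⟶ Y, b' ≫ g = b := by
  obtain ⟨b', hb⟩ := Module.projective_lifting_property g.hom.hom b.hom.hom hs.surjective
  exact ⟨FGModuleCat.ofHom b', FGModuleCat.hom_ext hb⟩

lemma cancel (hs : ShortExact f g) {a b : W ⟶ X} (h : a ≫ f = b ≫ f) : a = b := by
  ext x
  exact hs.injective (congrArg (fun c => c.hom.hom x) h)

lemma exists_factor (hs : ShortExact f g) (a : W ⟶ Y) (h : a ≫ g = 0) :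
    ∃ b : W ⟶ X, b ≫ f = a := by
  have hr : ∀ w, a.hom.hom w ∈ LinearMap.range f.hom.hom := fun w =>
    (hs.exact _).1 (congrArg (fun c => c.hom.hom w) h)
  let e := LinearEquiv.ofInjective f.hom.hom hs.injective
  refine ⟨FGModuleCat.ofHom (e.symm.toLinearMap ∘ₗ a.hom.hom.codRestrict _ hr), ?_⟩
  ext w
  exact congrArg Subtype.val (e.apply_symm_apply ⟨_, hr w⟩)

end ShortExact

lemma FactorsThroughProjective.of_projective {X Y P : FGModuleCat.{u} R}
    [h : Module.Projective R P] (a : X ⟶ P) (b : P ⟶ Y) : FactorsThroughProjective (a ≫ b) :=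
  ⟨P, h, a, b, rfl⟩

/-- Adding a projective summand does not change a module, up to isomorphism in the stable
category. -/
def stableIsoOfProjective {M P X : FGModuleCat.{u} R} [Module.Projective R P]
    (s : BinarySum P M X) : StableCat.of M ≅ StableCat.of X where
  hom := StableCat.ofHom s.inr
  inv := StableCat.ofHom s.snd
  hom_inv_id := by rw [← StableCat.ofHom_comp, s.inr_snd, StableCat.ofHom_id]
  inv_hom_id := by
    rw [← StableCat.ofHom_comp, ← StableCat.ofHom_id, ← s.total, StableCat.ofHom_add,
      StableCat.ofHom_eq_zero_iff.2 (FactorsThroughProjective.of_projective s.fst s.inl), zero_add]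

variable [IsArtinianRing R]

instance (M : FGModuleCat.{u} R) : Module.Projective R (projCover M) :=
  (isProjectiveCover_projCoverπ M).projective

lemma shortExact_syzygy (M : FGModuleCat.{u} R) : ShortExact (syzygyι M) (projCoverπ M) where
  injective := Subtype.val_injective
  exact := fun x => ⟨fun h => ⟨⟨x, h⟩, rfl⟩, by rintro ⟨y, rfl⟩; exact y.2⟩
  surjective := (isProjectiveCover_projCoverπ M).surjective

lemma syzygyFunctor_map {M N : FGModuleCat.{u} R} {f : M ⟶ N} {v : syzygy M ⟶ syzygy N}
    (h : IsSyzygyMap f v) : (syzygyFunctor R).map (StableCat.ofHom f) = StableCat.ofHom v :=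
  StableCat.ofHom_eq_iff.2 (IsSyzygyMap.stableRel (exists_isSyzygyMap f).choose_spec h
    (Congruence.equivalence.refl _))

instance : (syzygyFunctor R).Additive where
  map_add {X Y f g} := by
    obtain ⟨f, rfl⟩ := StableCat.exists_ofHom f
    obtain ⟨g, rfl⟩ := StableCat.exists_ofHom g
    obtain ⟨v, w, hw, hv⟩ := exists_isSyzygyMap f
    obtain ⟨v', w', hw', hv'⟩ := exists_isSyzygyMap g
    rw [← StableCat.ofHom_add, syzygyFunctor_map ⟨w, hw, hv⟩, syzygyFunctor_map ⟨w', hw', hv'⟩,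
      syzygyFunctor_map (v := v + v') ⟨w + w', ?_, ?_⟩]
    · exact StableCat.ofHom_add v v'
    · rw [Preadditive.add_comp, Preadditive.comp_add, hw, hw']
    · rw [Preadditive.add_comp, Preadditive.comp_add, hv, hv']

instance {k : Type u} [Field k] [Algebra k R] : (syzygyFunctor R).Linear k where
  map_smul {X Y} f c := by
    obtain ⟨f, rfl⟩ := StableCat.exists_ofHom f
    obtain ⟨v, w, hw, hv⟩ := exists_isSyzygyMap f
    rw [← StableCat.ofHom_smul, syzygyFunctor_map ⟨w, hw, hv⟩,
      syzygyFunctor_map (v := c • v) ⟨c • w, ?_, ?_⟩]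
    · exact StableCat.ofHom_smul c v
    · rw [Linear.smul_comp, Linear.comp_smul, hw]
    · rw [Linear.smul_comp, Linear.comp_smul, hv]

/-- The map `Ω(Z) ⟶ X` induced by comparing `X ⟶ Y ⟶ Z` with the projective cover of `Z`. -/
def IsConnecting {X Y Z : FGModuleCat.{u} R} (f : X ⟶ Y) (g : Y ⟶ Z) (h : syzygy Z ⟶ X) : Prop :=
  ∃ w : projCover Z ⟶ Y, w ≫ g = projCoverπ Z ∧ h ≫ f = syzygyι Z ≫ w

/-- The sequence in the stable category given by a sequence of module maps. -/
abbrev moduleTriangle {X Y Z : FGModuleCat.{u} R} (f : X ⟶ Y) (g : Y ⟶ Z)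
    (h : syzygy Z ⟶ X) : LeftTriangle (syzygyFunctor R) where
  X := StableCat.of X
  Y := StableCat.of Y
  Z := StableCat.of Z
  h := StableCat.ofHom h
  f := StableCat.ofHom f
  g := StableCat.ofHom g

lemma mem_stableLeftTriangles_iff {T : LeftTriangle (syzygyFunctor R)} :
    T ∈ stableLeftTriangles (R := R) ↔ ∃ (X Y Z : FGModuleCat.{u} R) (f : X ⟶ Y) (g : Y ⟶ Z)
      (h : syzygy Z ⟶ X), ShortExact f g ∧ IsConnecting f g h ∧
        T.IsIsomorphic (moduleTriangle f g h) := by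
  constructor
  · rintro ⟨X, Y, Z, f, g, h, w, h1, h2, h3, h4, h5, h6⟩
    exact ⟨X, Y, Z, f, g, h, ⟨h1, h2, h3⟩, ⟨w, h4, h5⟩, h6⟩
  · rintro ⟨X, Y, Z, f, g, h, ⟨h1, h2, h3⟩, ⟨w, h4, h5⟩, h6⟩
    exact ⟨X, Y, Z, f, g, h, w, h1, h2, h3, h4, h5, h6⟩

lemma moduleTriangle_mem {X Y Z : FGModuleCat.{u} R} {f : X ⟶ Y} {g : Y ⟶ Z} {h : syzygy Z ⟶ X}
    (hs : ShortExact f g) (hh : IsConnecting f g h) :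
    moduleTriangle f g h ∈ stableLeftTriangles (R := R) :=
  mem_stableLeftTriangles_iff.2 ⟨X, Y, Z, f, g, h, hs, hh, Iso.refl _, Iso.refl _, Iso.refl _,
    (Category.comp_id _).trans ((congrArg (· ≫ StableCat.ofHom h)
      ((syzygyFunctor R).map_id _)).trans (Category.id_comp _)).symm,
    (Category.comp_id _).trans (Category.id_comp _).symm,
    (Category.comp_id _).trans (Category.id_comp _).symm⟩

lemma mem_stableLeftTriangles_of_isIsomorphic {T T' : LeftTriangle (syzygyFunctor R)}
    (h : T.IsIsomorphic T') (hT : T' ∈ stableLeftTriangles (R := R)) :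
    T ∈ stableLeftTriangles (R := R) := by
  rw [mem_stableLeftTriangles_iff] at hT ⊢
  obtain ⟨X, Y, Z, f, g, v, hs, hv, hT⟩ := hT
  exact ⟨X, Y, Z, f, g, v, hs, hv, h.trans hT⟩

namespace ShortExact

variable {X Y Z : FGModuleCat.{u} R} {f : X ⟶ Y} {g : Y ⟶ Z}

lemma exists_isConnecting (hs : ShortExact f g) : ∃ h, IsConnecting f g h := by
  obtain ⟨w, hw⟩ := hs.exists_lift (projCoverπ Z)
  obtain ⟨h, hh⟩ := hs.exists_factor (syzygyι Z ≫ w) (by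
    rw [Category.assoc, hw, syzygyι_comp])
  exact ⟨h, w, hw, hh⟩

/-- Connecting maps are natural in the stable category. -/
lemma connecting_naturality {X' Y' Z' : FGModuleCat.{u} R} {f' : X' ⟶ Y'} {g' : Y' ⟶ Z'}
    (hs' : ShortExact f' g') {h : syzygy Z ⟶ X} {h' : syzygy Z' ⟶ X'} (hh : IsConnecting f g h)
    (hh' : IsConnecting f' g' h') (a : X ⟶ X') (b : Y ⟶ Y') (c : Z ⟶ Z') (hf : f ≫ b = a ≫ f')
    (hg : g ≫ c = b ≫ g') :
    StableCat.ofHom h ≫ StableCat.ofHom a =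
      (syzygyFunctor R).map (StableCat.ofHom c) ≫ StableCat.ofHom h' := by
  obtain ⟨w, hw, hwh⟩ := hh
  obtain ⟨w', hw', hwh'⟩ := hh'
  obtain ⟨v, t, ht, hv⟩ := exists_isSyzygyMap c
  rw [syzygyFunctor_map ⟨t, ht, hv⟩]
  change StableCat.ofHom h ≫ StableCat.ofHom a = StableCat.ofHom v ≫ StableCat.ofHom h'
  rw [← StableCat.ofHom_comp, ← StableCat.ofHom_comp, StableCat.ofHom_eq_iff]
  -- The two ways of mapping `P(Z)` to `Y'` lift the same map to `Z'`, so they differ by a map `y`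
  -- into `X'`; the failure of the square to commute is then `y` restricted to the syzygy, which
  -- factors through `P(Z)`.
  obtain ⟨y, hy⟩ := hs'.exists_factor (w ≫ b - t ≫ w') (by
    rw [Preadditive.sub_comp, Category.assoc, Category.assoc, hw', ← hg, ← Category.assoc, hw, ht,
      sub_self])
  have : h ≫ a - v ≫ h' = syzygyι Z ≫ y := by
    refine hs'.cancel ?_
    rw [Preadditive.sub_comp, Category.assoc, Category.assoc, Category.assoc, hy, ← hf, hwh',
      ← Category.assoc, hwh, ← Category.assoc v, hv, Preadditive.comp_sub]
    simp only [Category.assoc]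
  rw [this]
  exact FactorsThroughProjective.of_projective _ _

/-- The kernel of a surjection from a projective module is isomorphic to the syzygy. -/
lemma exists_connecting_iso (hs : ShortExact f g) [Module.Projective R Y] {h : syzygy Z ⟶ X}
    (hh : IsConnecting f g h) :
    ∃ e : (syzygyFunctor R).obj (StableCat.of Z) ≅ StableCat.of X, e.hom = StableCat.ofHom h := by
  obtain ⟨w, hw, hwh⟩ := hh
  obtain ⟨t, ht⟩ := (shortExact_syzygy Z).exists_lift g
  obtain ⟨v, hv⟩ := (shortExact_syzygy Z).exists_factor (f ≫ t) (by
    rw [Category.assoc, ht, hs.comp])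
  refine ⟨⟨StableCat.ofHom h, StableCat.ofHom v, ?_, ?_⟩, rfl⟩
  · refine (StableCat.ofHom_comp h v).symm.trans
      ((syzygyFunctor_map (f := 𝟙 Z) (v := h ≫ v) ⟨w ≫ t, ?_, ?_⟩).symm.trans ?_)
    · rw [Category.assoc, ht, hw, Category.comp_id]
    · rw [Category.assoc, hv, ← Category.assoc, hwh, Category.assoc]
    · rw [StableCat.ofHom_id, CategoryTheory.Functor.map_id]
  · change StableCat.ofHom v ≫ StableCat.ofHom h = 𝟙 _
    rw [← StableCat.ofHom_comp, ← StableCat.ofHom_id, StableCat.ofHom_eq_iff]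
    -- Both `t ≫ w` and the identity of the projective module `Y` lift `g`; their difference shows
    -- that `v ≫ h` is stably the identity.
    obtain ⟨y, hy⟩ := hs.exists_factor (t ≫ w - 𝟙 Y) (by
      rw [Preadditive.sub_comp, Category.assoc, hw, ht, Category.id_comp, sub_self])
    have : v ≫ h - 𝟙 X = f ≫ y := by
      refine hs.cancel ?_
      rw [Preadditive.sub_comp, Category.assoc, hwh, ← Category.assoc, hv, Category.assoc,
        Category.assoc, hy, Preadditive.comp_sub, Category.id_comp, Category.comp_id]
    rw [this]
    exact FactorsThroughProjective.of_projective _ _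

/-- Short exact sequences induce exact sequences in the stable category. -/
theorem isExact (hs : ShortExact f g) {h : syzygy Z ⟶ X} (hh : IsConnecting f g h) :
    (moduleTriangle f g h).IsExact := by
  obtain ⟨w, hw, hwh⟩ := hh
  obtain ⟨v, w', hw', hv⟩ := exists_isSyzygyMap g
  obtain ⟨y, hy⟩ := hs.exists_factor (w' ≫ w - projCoverπ Y) (by
    rw [Preadditive.sub_comp, Category.assoc, hw, hw', sub_self])
  have hvh : v ≫ h = syzygyι Y ≫ y := by
    refine hs.cancel ?_
    rw [Category.assoc, hwh, ← Category.assoc, hv, Category.assoc, Category.assoc, hy,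
      Preadditive.comp_sub, syzygyι_comp, sub_zero]
  refine ⟨?_, ?_, ?_, ?_, ?_, ?_⟩
  · change StableCat.ofHom f ≫ StableCat.ofHom g = 0
    rw [← StableCat.ofHom_comp, hs.comp, StableCat.ofHom_zero]
  · change StableCat.ofHom h ≫ StableCat.ofHom f = 0
    rw [← StableCat.ofHom_comp, hwh, StableCat.ofHom_eq_zero_iff]
    exact FactorsThroughProjective.of_projective _ _
  · change (syzygyFunctor R).map (StableCat.ofHom g) ≫ StableCat.ofHom h = 0
    rw [syzygyFunctor_map ⟨w', hw', hv⟩]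
    change StableCat.ofHom v ≫ StableCat.ofHom h = 0
    rw [← StableCat.ofHom_comp, hvh, StableCat.ofHom_eq_zero_iff]
    exact FactorsThroughProjective.of_projective _ _
  · rintro ⟨W⟩ x hx
    obtain ⟨x, rfl⟩ := StableCat.exists_ofHom (N := Y) x
    change StableCat.ofHom x ≫ StableCat.ofHom g = 0 at hx
    rw [← StableCat.ofHom_comp, StableCat.ofHom_eq_zero_iff] at hx
    obtain ⟨P, hP, a, b, hab⟩ := hx
    obtain ⟨b', rfl⟩ := hs.exists_lift b
    obtain ⟨z, hz⟩ := hs.exists_factor (x - a ≫ b') (by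
      rw [Preadditive.sub_comp, Category.assoc, hab, sub_self])
    refine ⟨StableCat.ofHom z, ?_⟩
    change StableCat.ofHom z ≫ StableCat.ofHom f = StableCat.ofHom x
    rw [← StableCat.ofHom_comp, hz, StableCat.ofHom_eq_iff, sub_sub_cancel_left]
    exact (FactorsThroughProjective.of_projective _ _).neg
  · rintro ⟨W⟩ x hx
    obtain ⟨x, rfl⟩ := StableCat.exists_ofHom (N := X) x
    change StableCat.ofHom x ≫ StableCat.ofHom f = 0 at hx
    rw [← StableCat.ofHom_comp, StableCat.ofHom_eq_zero_iff] at hx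
    obtain ⟨P, hP, a, b, hab⟩ := hx
    -- Here `x ≫ f` factors through a projective as `a ≫ b`. Lifting `b ≫ g` to `P(Z)` turns `a`
    -- into a map `r` to the syzygy, and `r ≫ h` differs from `x` by a map through `P`.
    obtain ⟨t, ht⟩ := exists_lift_projCoverπ (b ≫ g)
    obtain ⟨r, hr⟩ := exists_factor_syzygyι (a ≫ t) (by
      rw [Category.assoc, ht, ← Category.assoc, hab, Category.assoc, hs.comp, Limits.comp_zero])
    obtain ⟨z, hz⟩ := hs.exists_factor (b - t ≫ w) (by
      rw [Preadditive.sub_comp, Category.assoc, hw, ht, sub_self])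
    refine ⟨StableCat.ofHom r, ?_⟩
    change StableCat.ofHom r ≫ StableCat.ofHom h = StableCat.ofHom x
    rw [← StableCat.ofHom_comp, eq_comm, StableCat.ofHom_eq_iff]
    have : x - r ≫ h = a ≫ z := by
      refine hs.cancel ?_
      rw [Preadditive.sub_comp, Category.assoc, hwh, ← Category.assoc, hr, ← hab, Category.assoc,
        Category.assoc, hz, Preadditive.comp_sub]
    rw [this]
    exact FactorsThroughProjective.of_projective _ _
  · rintro ⟨W⟩ x hx
    obtain ⟨x, rfl⟩ := StableCat.exists_ofHom (N := syzygy Z) x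
    change StableCat.ofHom x ≫ StableCat.ofHom h = 0 at hx
    rw [← StableCat.ofHom_comp, StableCat.ofHom_eq_zero_iff] at hx
    obtain ⟨P, hP, a, b, hab⟩ := hx
    obtain ⟨t₁, ht₁⟩ := exists_lift_projCoverπ (b ≫ f)
    obtain ⟨t₂, ht₂⟩ := exists_lift_projCoverπ w
    obtain ⟨r, hr⟩ := exists_factor_syzygyι (a ≫ t₁ - x ≫ syzygyι Z ≫ t₂) (by
      rw [Preadditive.sub_comp, Category.assoc, Category.assoc, Category.assoc, ht₁, ht₂,
        ← Category.assoc a, hab, Category.assoc, hwh, sub_self])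
    obtain ⟨y₁, hy₁⟩ := exists_factor_syzygyι (t₁ ≫ w') (by
      rw [Category.assoc, hw', ← Category.assoc, ht₁, Category.assoc, hs.comp, Limits.comp_zero])
    obtain ⟨y₂, hy₂⟩ := exists_factor_syzygyι (t₂ ≫ w' - 𝟙 _) (by
      rw [Preadditive.sub_comp, Category.assoc, hw', ← Category.assoc, ht₂, hw, Category.id_comp,
        sub_self])
    -- Stably `x = -(r ≫ v)`: the first correction term factors through `P` and the second through
    -- `P(Z)`. The sign explains the witness `-r`.
    have key : x + r ≫ v = a ≫ y₁ - x ≫ syzygyι Z ≫ y₂ := by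
      refine syzygyι_cancel ?_
      simp only [Preadditive.add_comp, Preadditive.sub_comp, Category.assoc, hv, hy₁, hy₂,
        Preadditive.comp_sub, Category.comp_id]
      rw [← Category.assoc r, hr, Preadditive.sub_comp]
      simp only [Category.assoc]
      abel
    refine ⟨StableCat.ofHom (-r), ?_⟩
    change StableCat.ofHom (-r) ≫ (syzygyFunctor R).map (StableCat.ofHom g) = StableCat.ofHom x
    rw [syzygyFunctor_map ⟨w', hw', hv⟩]
    change StableCat.ofHom (-r) ≫ StableCat.ofHom v = StableCat.ofHom x
    rw [← StableCat.ofHom_comp, eq_comm, StableCat.ofHom_eq_iff,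
      Preadditive.neg_comp, sub_neg_eq_add, key, sub_eq_add_neg, ← Category.assoc x]
    exact (FactorsThroughProjective.of_projective _ _).add
      (FactorsThroughProjective.of_projective _ _).neg

end ShortExact

/-- Left triangles in the stable category are exact. -/
theorem isExact_of_mem_stableLeftTriangles {T : LeftTriangle (syzygyFunctor R)}
    (hT : T ∈ stableLeftTriangles (R := R)) : T.IsExact := by
  obtain ⟨X, Y, Z, f, g, h, hs, hh, hT⟩ := mem_stableLeftTriangles_iff.1 hT
  exact (hs.isExact hh).of_isIsomorphic hT

/-- The first object of a left triangle is determined by its last morphism. -/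
theorem nonempty_iso_of_mem_stableLeftTriangles {T T' : LeftTriangle (syzygyFunctor R)}
    (hT : T ∈ stableLeftTriangles (R := R)) (hT' : T' ∈ stableLeftTriangles (R := R))
    (b : T.Y ≅ T'.Y) (c : T.Z ≅ T'.Z) (hg : T.g ≫ c.hom = b.hom ≫ T'.g) :
    Nonempty (T.X ≅ T'.X) := by
  obtain ⟨X, Y, Z, f, g, h, hs, hh, a₁, b₁, c₁, -, -, hT⟩ := mem_stableLeftTriangles_iff.1 hT
  obtain ⟨X', Y', Z', f', g', h', hs', hh', a₂, b₂, c₂, -, -, hT'⟩ :=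
    mem_stableLeftTriangles_iff.1 hT'
  let B : StableCat.of Y ≅ StableCat.of Y' := b₁.symm ≪≫ b ≪≫ b₂
  let E : StableCat.of Z ≅ StableCat.of Z' := c₁.symm ≪≫ c ≪≫ c₂
  have hBE : StableCat.ofHom g ≫ E.hom = B.hom ≫ StableCat.ofHom g' := by
    change StableCat.ofHom g ≫ c₁.inv ≫ c.hom ≫ c₂.hom =
      (b₁.inv ≫ b.hom ≫ b₂.hom) ≫ StableCat.ofHom g'
    have h1 : StableCat.ofHom g ≫ c₁.inv = b₁.inv ≫ T.g := by
      rw [Iso.comp_inv_eq, Category.assoc, hT, Iso.inv_hom_id_assoc]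
    have h2 : b₂.hom ≫ StableCat.ofHom g' = T'.g ≫ c₂.hom := hT'.symm
    rw [← Category.assoc, h1, Category.assoc, ← Category.assoc T.g, hg, Category.assoc,
      Category.assoc, Category.assoc, h2]
  obtain ⟨b₀, hb₀⟩ := StableCat.exists_ofHom B.hom
  obtain ⟨c₀, hc₀⟩ := StableCat.exists_ofHom E.hom
  rw [← hb₀, ← hc₀, ← StableCat.ofHom_comp, ← StableCat.ofHom_comp,
    StableCat.ofHom_eq_iff] at hBE
  obtain ⟨P, hP, s, d, hsd⟩ := hBE
  obtain ⟨d, rfl⟩ := hs'.exists_lift d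
  -- The square of representatives commutes only up to a map through a projective; absorbing that
  -- map into `b₀` makes it commute strictly without changing its stable class, so that it restricts
  -- to kernels.
  have hb₃ : g ≫ c₀ = (b₀ + s ≫ d) ≫ g' := by
    rw [Preadditive.add_comp, Category.assoc, hsd, add_sub_cancel]
  have hb₄ : StableCat.ofHom (b₀ + s ≫ d) = B.hom := by
    rw [StableCat.ofHom_add, StableCat.ofHom_eq_zero_iff.2
      (FactorsThroughProjective.of_projective s d), add_zero, hb₀]
  obtain ⟨a, ha⟩ := hs'.exists_factor (f ≫ (b₀ + s ≫ d)) (by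
    rw [Category.assoc, ← hb₃, ← Category.assoc, hs.comp, Limits.zero_comp])
  have hnat := ShortExact.connecting_naturality hs' hh hh' a _ c₀ ha.symm hb₃
  obtain ⟨e⟩ := (hs.isExact hh).nonempty_iso (hs'.isExact hh') (StableCat.ofHom a) B E
    (by rw [← hc₀]; exact hnat)
    (by
      change StableCat.ofHom f ≫ B.hom = StableCat.ofHom a ≫ StableCat.ofHom f'
      rw [← hb₄, ← StableCat.ofHom_comp, ← StableCat.ofHom_comp, ha])
    (by
      change StableCat.ofHom g ≫ E.hom = B.hom ≫ StableCat.ofHom g'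
      rw [← hb₄, ← hc₀, ← StableCat.ofHom_comp, ← StableCat.ofHom_comp, hb₃])
  exact ⟨a₁ ≪≫ e ≪≫ a₂.symm⟩

end StableCategory

/-! ### Rotated triangles and split triangles in the stable category -/

section StableTriangles

variable {R : Type u} [Ring R] [IsArtinianRing R]

/-- Left triangles can be rotated. -/
theorem rotate_mem_stableLeftTriangles {T : LeftTriangle (syzygyFunctor R)}
    (hT : T ∈ stableLeftTriangles (R := R)) : T.rotate ∈ stableLeftTriangles (R := R) := by
  obtain ⟨X, Y, Z, f, g, h, hs, ⟨w, hw, hwh⟩, hT⟩ := mem_stableLeftTriangles_iff.1 hT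
  refine mem_stableLeftTriangles_of_isIsomorphic hT.rotate ?_
  obtain ⟨v, w', hw', hv⟩ := exists_isSyzygyMap g
  obtain ⟨y, hy⟩ := hs.exists_factor (w' ≫ w - projCoverπ Y) (by
    rw [Preadditive.sub_comp, Category.assoc, hw, hw', sub_self])
  -- The rotated sequence is realized by `0 ⟶ Ω Z ⟶ P(Z) ⊕ X ⟶ Y ⟶ 0`, in which `P(Z)` is stably
  -- zero.
  let s := prodSum (projCover Z) X
  let f₁ : syzygy Z ⟶ FGModuleCat.of R (projCover Z × X) := syzygyι Z ≫ s.inl + h ≫ s.inr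
  let g₁ : FGModuleCat.of R (projCover Z × X) ⟶ Y := s.snd ≫ f - s.fst ≫ w
  have hs₁ : ShortExact f₁ g₁ := by
    have hf₁ : ∀ z, f₁.hom.hom z = ((syzygyι Z).hom.hom z, h.hom.hom z) := fun z =>
      Prod.ext (add_zero _) (zero_add _)
    have hg₁ : ∀ p : projCover Z × X, g₁.hom.hom p = f.hom.hom p.2 - w.hom.hom p.1 := fun p => rfl
    have hwπ : ∀ p, g.hom.hom (w.hom.hom p) = (projCoverπ Z).hom.hom p := fun p =>
      congrArg (fun a => a.hom.hom p) hw
    refine ⟨?_, ?_, ?_⟩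
    · intro z z' hz
      have hz : f₁.hom.hom z = f₁.hom.hom z' := hz
      rw [hf₁, hf₁] at hz
      exact (shortExact_syzygy Z).injective (congrArg Prod.fst hz)
    · rintro ⟨p, x⟩
      rw [hg₁, sub_eq_zero]
      constructor
      · intro hpx
        obtain ⟨z, rfl⟩ := ((shortExact_syzygy Z).exact p).1 (by
          rw [← hwπ, ← hpx]
          exact hs.exact.apply_apply_eq_zero x)
        refine ⟨z, ?_⟩
        rw [hf₁]
        refine Prod.ext rfl (hs.injective ?_)
        exact (congrArg (fun a => a.hom.hom z) hwh).trans hpx.symm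
      · rintro ⟨z, hz⟩
        rw [hf₁] at hz
        rw [← congrArg Prod.fst hz, ← congrArg Prod.snd hz]
        exact congrArg (fun a => a.hom.hom z) hwh
    · intro y
      obtain ⟨p, hp⟩ := (isProjectiveCover_projCoverπ Z).surjective (g.hom.hom y)
      obtain ⟨x, hx⟩ := (hs.exact (y - w.hom.hom p)).1 (by
        rw [map_sub, hwπ, hp, sub_self])
      refine ⟨(-p, x), ?_⟩
      rw [hg₁, map_neg, sub_neg_eq_add, hx, sub_add_cancel]
  have hh₁ : IsConnecting f₁ g₁ (-v) := by
    -- Under `g₁` this goes to `w' ≫ w - y ≫ f`, which is the cover of `Y`. The minus sign on `w'`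
    -- is the source of the sign in the rotated sequence.
    refine ⟨-(w' ≫ s.inl) - y ≫ s.inr, ?_, ?_⟩
    · simp only [g₁, Preadditive.sub_comp, Preadditive.comp_sub, Preadditive.neg_comp,
        Category.assoc, s.inl_fst_assoc, s.inl_snd_assoc, s.inr_fst_assoc, s.inr_snd_assoc, hy]
      simp
    · have hvh : v ≫ h = syzygyι Y ≫ y := by
        refine hs.cancel ?_
        rw [Category.assoc, hwh, ← Category.assoc, hv, Category.assoc, Category.assoc, hy,
          Preadditive.comp_sub, syzygyι_comp, sub_zero]
      simp only [f₁, Preadditive.comp_add, Preadditive.neg_comp, Preadditive.comp_sub,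
        Preadditive.comp_neg, ← Category.assoc, hv, hvh]
      abel
  refine mem_stableLeftTriangles_of_isIsomorphic ?_ (moduleTriangle_mem hs₁ hh₁)
  refine ⟨Iso.refl _, stableIsoOfProjective s, Iso.refl _, ?_, ?_, ?_⟩
  · change (-(syzygyFunctor R).map (StableCat.ofHom g)) ≫ 𝟙 _ =
      (syzygyFunctor R).map (𝟙 _) ≫ StableCat.ofHom (-v)
    rw [syzygyFunctor_map ⟨w', hw', hv⟩, CategoryTheory.Functor.map_id]
    change (-StableCat.ofHom v) ≫ 𝟙 _ = 𝟙 _ ≫ StableCat.ofHom (-v)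
    rw [Category.comp_id, Category.id_comp, StableCat.ofHom_neg]
  · change StableCat.ofHom h ≫ StableCat.ofHom s.inr = 𝟙 (StableCat.of _) ≫ StableCat.ofHom f₁
    rw [Category.id_comp, ← StableCat.ofHom_comp, eq_comm, StableCat.ofHom_eq_iff]
    have : f₁ - h ≫ s.inr = syzygyι Z ≫ s.inl := by simp [f₁]
    rw [this]
    exact FactorsThroughProjective.of_projective _ _
  · change StableCat.ofHom f ≫ 𝟙 (StableCat.of _) = StableCat.ofHom s.inr ≫ StableCat.ofHom g₁
    rw [Category.comp_id, ← StableCat.ofHom_comp]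
    simp [g₁, Preadditive.comp_sub]

/-- Left triangles are preserved by the syzygy functor, up to the sign of the last morphism. -/
theorem exists_syzygy_mem_stableLeftTriangles {T : LeftTriangle (syzygyFunctor R)}
    (hT : T ∈ stableLeftTriangles (R := R)) :
    ∃ (h : (syzygyFunctor R).obj ((syzygyFunctor R).obj T.Z) ⟶ (syzygyFunctor R).obj T.X)
      (f : (syzygyFunctor R).obj T.X ⟶ (syzygyFunctor R).obj T.Y),
      { X := (syzygyFunctor R).obj T.X, Y := (syzygyFunctor R).obj T.Y,
        Z := (syzygyFunctor R).obj T.Z, h := h, f := f, g := -(syzygyFunctor R).map T.g } ∈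
        stableLeftTriangles (R := R) :=
  -- Three rotations loop every term once and negate every looped morphism; only the last one is
  -- recorded.
  ⟨_, _, rotate_mem_stableLeftTriangles (rotate_mem_stableLeftTriangles
    (rotate_mem_stableLeftTriangles hT))⟩

/-- Split sequences are left triangles. -/
theorem LeftTriangle.Splitting.mem_stableLeftTriangles {T : LeftTriangle (syzygyFunctor R)}
    (s : T.Splitting) : T ∈ stableLeftTriangles (R := R) := by
  let N := s.N.as
  let K := s.K.as
  let I := s.I.as
  let σ := prodSum N I
  let τ := prodSum K I
  let ρ := prodSum (syzygy N) K
  -- The model is the direct sum of the short exact sequences `ΩN ⟶ P(N) ⟶ N`, `K ⟶ K ⟶ 0` and `0 ⟶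
  -- I ⟶ I`.
  let χ := prodSum (projCover N) (FGModuleCat.of R (K × I))
  let f₁ : FGModuleCat.of R (syzygy N × K) ⟶ FGModuleCat.of R (projCover N × (K × I)) :=
    ρ.fst ≫ syzygyι N ≫ χ.inl + ρ.snd ≫ τ.inl ≫ χ.inr
  let g₁ : FGModuleCat.of R (projCover N × (K × I)) ⟶ FGModuleCat.of R (N × I) :=
    χ.fst ≫ projCoverπ N ≫ σ.inl + χ.snd ≫ τ.snd ≫ σ.inr
  obtain ⟨v, t, ht, hv⟩ := exists_isSyzygyMap σ.fst
  have hs₁ : ShortExact f₁ g₁ := by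
    have hf₁ : ∀ p : syzygy N × K, f₁.hom.hom p = ((syzygyι N).hom.hom p.1, (p.2, 0)) := fun p =>
      Prod.ext (add_zero _) (zero_add _)
    have hg₁ : ∀ p : projCover N × (K × I),
        g₁.hom.hom p = ((projCoverπ N).hom.hom p.1, p.2.2) := fun p =>
      Prod.ext (add_zero _) (zero_add _)
    refine ⟨?_, ?_, ?_⟩
    · intro p p' hp
      have hp : f₁.hom.hom p = f₁.hom.hom p' := hp
      rw [hf₁, hf₁] at hp
      exact Prod.ext ((shortExact_syzygy N).injective (congrArg Prod.fst hp))
        (congrArg (fun a => a.2.1) hp)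
    · rintro ⟨p, x, i⟩
      rw [hg₁]
      constructor
      · intro h
        obtain ⟨z, rfl⟩ := ((shortExact_syzygy N).exact p).1 (congrArg Prod.fst h)
        obtain rfl : i = 0 := congrArg Prod.snd h
        exact ⟨(z, x), hf₁ _⟩
      · rintro ⟨⟨z, x'⟩, h⟩
        rw [hf₁] at h
        obtain rfl : _ = p := congrArg Prod.fst h
        obtain rfl : 0 = i := congrArg (fun a => a.2.2) h
        exact Prod.ext ((shortExact_syzygy N).exact.apply_apply_eq_zero z) rfl
    · rintro ⟨n, i⟩
      obtain ⟨p, rfl⟩ := (isProjectiveCover_projCoverπ N).surjective n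
      exact ⟨(p, (0, i)), hg₁ _⟩
  have hh₁ : IsConnecting f₁ g₁ (v ≫ ρ.inl) := by
    refine ⟨t ≫ χ.inl + projCoverπ _ ≫ σ.snd ≫ τ.inr ≫ χ.inr, ?_, ?_⟩
    · simp only [g₁, Preadditive.add_comp, Preadditive.comp_add, Category.assoc, χ.inl_fst_assoc,
        χ.inl_snd_assoc, χ.inr_fst_assoc, χ.inr_snd_assoc, τ.inr_snd_assoc]
      rw [← Category.assoc t, ht]
      simp only [Limits.comp_zero, add_zero, zero_add, Category.assoc]
      rw [← Preadditive.comp_add, σ.total, Category.comp_id]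
    · simp only [f₁, Preadditive.comp_add, Category.assoc, ρ.inl_fst_assoc, ρ.inl_snd_assoc,
        Limits.comp_zero, add_zero]
      rw [← Category.assoc (syzygyι _) (projCoverπ _), syzygyι_comp, Limits.zero_comp, add_zero,
        ← Category.assoc, hv, Category.assoc]
  refine mem_stableLeftTriangles_of_isIsomorphic ?_ (moduleTriangle_mem hs₁ hh₁)
  let Φ := CategoryTheory.Quotient.functor (stableRel R)
  let e := stableIsoOfProjective χ
  let s₁ : (moduleTriangle f₁ g₁ (v ≫ ρ.inl)).Splitting :=
    { N := StableCat.of N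
      K := StableCat.of K
      I := StableCat.of I
      sX := ρ.map Φ
      sY := (τ.map Φ).ofIso e
      sZ := σ.map Φ
      h_eq := by
        change StableCat.ofHom (v ≫ ρ.inl) =
          (syzygyFunctor R).map (StableCat.ofHom σ.fst) ≫ StableCat.ofHom ρ.inl
        rw [syzygyFunctor_map ⟨t, ht, hv⟩]
        exact StableCat.ofHom_comp _ _
      f_eq := by
        change StableCat.ofHom f₁ = StableCat.ofHom ρ.snd ≫ StableCat.ofHom τ.inl ≫
          StableCat.ofHom χ.inr
        rw [← StableCat.ofHom_comp, ← StableCat.ofHom_comp, StableCat.ofHom_eq_iff,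
          add_sub_cancel_right, ← Category.assoc]
        exact FactorsThroughProjective.of_projective _ _
      g_eq := by
        change StableCat.ofHom g₁ = (StableCat.ofHom χ.snd ≫ StableCat.ofHom τ.snd) ≫
          StableCat.ofHom σ.inr
        rw [Category.assoc, ← StableCat.ofHom_comp, ← StableCat.ofHom_comp,
          StableCat.ofHom_eq_iff, add_sub_cancel_right]
        exact FactorsThroughProjective.of_projective _ _ }
  exact s.isIsomorphic s₁ rfl rfl rfl

end StableTriangles

/-! ### Direct sums in full subcategories -/

section FullSubcategories

universe v₁ u₁

variable {C : Type u₁} [Category.{v₁} C] [Preadditive C] {P : ObjectProperty C}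

/-- Direct sums in a full subcategory. -/
def BinarySum.toFullSubcategory {A B X : P.FullSubcategory} (s : BinarySum A.obj B.obj X.obj) :
    BinarySum A B X where
  inl := P.homMk s.inl
  inr := P.homMk s.inr
  fst := P.homMk s.fst
  snd := P.homMk s.snd
  inl_fst := P.hom_ext s.inl_fst
  inr_snd := P.hom_ext s.inr_snd
  inl_snd := P.hom_ext s.inl_snd
  inr_fst := P.hom_ext s.inr_fst
  total := P.hom_ext s.total

instance : P.ι.Additive where
  map_add := rfl

/-- Finite direct sums in a full subcategory. -/
def FamilySum.toFullSubcategory {J : Type*} [Fintype J] {S : J → P.FullSubcategory}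
    {X : P.FullSubcategory} (s : FamilySum (fun j => (S j).obj) X.obj) : FamilySum S X where
  ι j := P.homMk (s.ι j)
  π j := P.homMk (s.π j)
  ι_π_self j := P.hom_ext (s.ι_π_self j)
  ι_π_ne h := P.hom_ext (s.ι_π_ne h)
  total := P.ι.map_injective (by
    rw [Functor.map_sum]
    exact s.total)

end FullSubcategories

/-! ### Semisimple modules: sums, split morphisms, split triangles -/

section SemisimpleModules

variable {R : Type u} [Ring R]

/-- Finite direct sums exist in the stable category of semisimple modules. -/
theorem SSCat.exists_familySum {J : Type} [Fintype J] (X : J → SSCat R) :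
    ∃ Z : SSCat R, Nonempty (FamilySum X Z) := by
  have : ∀ j, IsSemisimpleModule R (X j).obj.as := fun j => (X j).property
  refine ⟨SSCat.of (FGModuleCat.of R (∀ j, (X j).obj.as))
    (inferInstanceAs (IsSemisimpleModule R (∀ j, (X j).obj.as))), ⟨?_⟩⟩
  exact ((piSum fun j => (X j).obj.as).map
    (CategoryTheory.Quotient.functor (stableRel R))).toFullSubcategory

/-- Finite direct sums exist in the stable category. -/
theorem StableCat.exists_familySum {J : Type} [Fintype J] (X : J → StableCat R) :
    ∃ Z : StableCat R, Nonempty (FamilySum X Z) :=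
  ⟨_, ⟨(piSum fun j => (X j).as).map (CategoryTheory.Quotient.functor (stableRel R))⟩⟩

/-- Direct sums exist in the stable category of semisimple modules. -/
theorem SSCat.exists_binarySum (X Y : SSCat R) :
    ∃ Z : SSCat R, Nonempty (BinarySum X Y Z) := by
  obtain ⟨⟨M⟩, hM⟩ := X
  obtain ⟨⟨N⟩, hN⟩ := Y
  have : IsSemisimpleModule R M := hM
  have : IsSemisimpleModule R N := hN
  have h : IsSemisimpleModule R ↥(LinearMap.range (LinearMap.inl R M N) ⊔
      LinearMap.range (LinearMap.inr R M N)) :=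
    have := IsSemisimpleModule.range (LinearMap.inl R M N)
    have := IsSemisimpleModule.range (LinearMap.inr R M N)
    IsSemisimpleModule.sup ‹_› ‹_›
  rw [LinearMap.sup_range_inl_inr] at h
  refine ⟨SSCat.of (FGModuleCat.of R (M × N)) (.congr (Submodule.topEquiv (R := R)).symm), ⟨?_⟩⟩
  exact ((prodSum M N).map (CategoryTheory.Quotient.functor (stableRel R))).toFullSubcategory

variable [IsArtinianRing R]

/-- A retraction splits a module. -/
def kerSum {M N : FGModuleCat.{u} R} (p : M ⟶ N) (r : N ⟶ M) (h : r ≫ p = 𝟙 N) :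
    BinarySum (FGModuleCat.of R (LinearMap.ker p.hom.hom)) N M :=
  have hp : ∀ x, p.hom.hom (r.hom.hom x) = x := fun x => congrArg (fun a => a.hom.hom x) h
  { inl := FGModuleCat.ofHom (LinearMap.ker p.hom.hom).subtype
    inr := r
    fst := FGModuleCat.ofHom (LinearMap.codRestrict _ (LinearMap.id - r.hom.hom ∘ₗ p.hom.hom)
      fun x => by
        change p.hom.hom (x - r.hom.hom (p.hom.hom x)) = 0
        rw [map_sub, hp, sub_self])
    snd := p
    inl_fst := FGModuleCat.hom_ext <| LinearMap.ext fun x => Subtype.ext <| by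
      change x.1 - r.hom.hom (p.hom.hom x.1) = x.1
      rw [LinearMap.mem_ker.1 x.2, map_zero, sub_zero]
    inr_snd := h
    inl_snd := FGModuleCat.hom_ext <| LinearMap.ext fun x => x.2
    inr_fst := FGModuleCat.hom_ext <| LinearMap.ext fun x => Subtype.ext <| by
      change r.hom.hom x - r.hom.hom (p.hom.hom (r.hom.hom x)) = 0
      rw [hp, sub_self]
    total := FGModuleCat.hom_ext <| LinearMap.ext fun x => sub_add_cancel _ _ }

/-- All morphisms between semisimple modules split. -/
theorem nonempty_morphismSplitting {X Y : SSCat R} (g : X ⟶ Y) :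
    Nonempty (MorphismSplitting g) := by
  obtain ⟨⟨M⟩, hM⟩ := X
  obtain ⟨⟨N⟩, hN⟩ := Y
  have : IsSemisimpleModule R M := hM
  have : IsSemisimpleModule R N := hN
  obtain ⟨g₀, hg₀⟩ := StableCat.exists_ofHom (M := M) (N := N) g.hom
  let I := FGModuleCat.of R (LinearMap.range g₀.hom.hom)
  let q : M ⟶ I := FGModuleCat.ofHom g₀.hom.hom.rangeRestrict
  let j : I ⟶ N := FGModuleCat.ofHom (LinearMap.range g₀.hom.hom).subtype
  -- Semisimplicity makes the image of `g₀` a direct summand both of the source, through `r`, and of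
  -- the target, through `p`.
  obtain ⟨r, hr⟩ := IsSemisimpleModule.lifting_property g₀.hom.hom.rangeRestrict
    g₀.hom.hom.surjective_rangeRestrict LinearMap.id
  obtain ⟨p, hp⟩ := IsSemisimpleModule.extension_property (LinearMap.range g₀.hom.hom).subtype
    (Submodule.injective_subtype _) LinearMap.id
  let s := kerSum q (FGModuleCat.ofHom r) (FGModuleCat.hom_ext hr)
  let t := kerSum (FGModuleCat.ofHom p : N ⟶ I) j (FGModuleCat.hom_ext hp)
  let Φ := CategoryTheory.Quotient.functor (stableRel R)
  refine ⟨⟨SSCat.of (FGModuleCat.of R (LinearMap.ker (FGModuleCat.ofHom p : N ⟶ I).hom.hom))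
      (inferInstanceAs (IsSemisimpleModule R (LinearMap.ker p))),
    SSCat.of (FGModuleCat.of R (LinearMap.ker q.hom.hom))
      (inferInstanceAs (IsSemisimpleModule R (LinearMap.ker g₀.hom.hom.rangeRestrict))),
    SSCat.of I (IsSemisimpleModule.range g₀.hom.hom),
    (s.map Φ).toFullSubcategory, (t.map Φ).toFullSubcategory, ?_⟩⟩
  refine ObjectProperty.hom_ext _ (hg₀.symm.trans ?_)
  exact StableCat.ofHom_comp q j

variable (hR : Ring.jacobson R ^ 2 = ⊥)

instance : (ssSyzygyFunctor hR).Additive where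
  map_add {_ _ f g} := ObjectProperty.hom_ext _
    ((syzygyFunctor R).map_add (f := f.hom) (g := g.hom))

instance {k : Type u} [Field k] [Algebra k R] : (ssSyzygyFunctor hR).Linear k where
  map_smul f c := ObjectProperty.hom_ext _ (Functor.Linear.map_smul (F := syzygyFunctor R) f.hom c)

/-- Left triangles of semisimple modules are exact. -/
theorem isExact_of_mem_ssLeftTriangles {T : LeftTriangle (ssSyzygyFunctor hR)}
    (hT : T ∈ ssLeftTriangles hR) : T.IsExact := by
  obtain ⟨h₁, h₂, h₃, h₄, h₅, h₆⟩ := isExact_of_mem_stableLeftTriangles hT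
  -- `LeftTriangle.map` prefixes `T.h` with a comparison isomorphism, which for the inclusion of the
  -- full subcategory is an identity.
  have hh : 𝟙 _ ≫ T.h.hom = T.h.hom := Category.id_comp _
  refine ⟨ObjectProperty.hom_ext _ h₁, ObjectProperty.hom_ext _ ?_, ObjectProperty.hom_ext _ ?_,
    ?_, ?_, ?_⟩
  · exact (congrArg (· ≫ T.f.hom) hh).symm.trans h₂
  · exact (congrArg ((syzygyFunctor R).map T.g.hom ≫ ·) hh).symm.trans h₃
  · intro W x hx
    obtain ⟨y, hy⟩ := h₄ x.hom (congrArg (fun a => a.hom) hx)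
    exact ⟨ObjectProperty.homMk y, ObjectProperty.hom_ext _ hy⟩
  · intro W x hx
    obtain ⟨y, hy⟩ := h₅ x.hom (congrArg (fun a => a.hom) hx)
    exact ⟨ObjectProperty.homMk y, ObjectProperty.hom_ext _
      ((congrArg (y ≫ ·) hh).symm.trans hy)⟩
  · intro W x hx
    obtain ⟨y, hy⟩ := h₆ x.hom ((congrArg (x.hom ≫ ·) hh).trans (congrArg (fun a => a.hom) hx))
    exact ⟨ObjectProperty.homMk y, ObjectProperty.hom_ext _ hy⟩

/-- Left triangles of semisimple modules split. -/
theorem nonempty_splitting_of_mem_ssLeftTriangles {T : LeftTriangle (ssSyzygyFunctor hR)}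
    (hT : T ∈ ssLeftTriangles hR) : Nonempty T.Splitting :=
  (nonempty_morphismSplitting T.g).elim (isExact_of_mem_ssLeftTriangles hR hT).nonempty_splitting

/-- Additive looped functors from semisimple modules to a stable category send left triangles to
left triangles. -/
theorem map_mem_stableLeftTriangles {S : Type u} [Ring S] [IsArtinianRing S]
    (F : SSCat R ⥤ StableCat S) [F.Additive] (δ : ssSyzygyFunctor hR ⋙ F ≅ F ⋙ syzygyFunctor S)
    {T : LeftTriangle (ssSyzygyFunctor hR)} (hT : T ∈ ssLeftTriangles hR) :
    T.map F δ ∈ stableLeftTriangles (R := S) :=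
  (nonempty_splitting_of_mem_ssLeftTriangles hR hT).elim fun s =>
    (s.map F δ).mem_stableLeftTriangles

end SemisimpleModules

/-! ### Iterated loops and objects eventually in the image -/

section LoopPowers

universe v₁ u₁

variable {C : Type u₁} [Category.{v₁} C]

/-- By definition the additional loop is applied first; extending an isomorphism by one loop
requires it to be applied last. -/
lemma loopPow_succ (Ω : C ⥤ C) : ∀ i : ℕ, loopPow Ω (i + 1) = loopPow Ω i ⋙ Ω
  | 0 => rfl
  | i + 1 => by
    change Ω ⋙ loopPow Ω (i + 1) = (Ω ⋙ loopPow Ω i) ⋙ Ω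
    rw [loopPow_succ Ω i]
    rfl

lemma loopPow_succ_obj (Ω : C ⥤ C) (i : ℕ) (X : C) :
    (loopPow Ω (i + 1)).obj X = Ω.obj ((loopPow Ω i).obj X) := by
  rw [loopPow_succ]
  rfl

end LoopPowers

section EventuallyInImage

universe v₁ v₂ u₁ u₂

variable {C : Type u₁} [Category.{v₁} C] {D : Type u₂} [Category.{v₂} D]

/-- Objects that are in the essential image of `F` after enough loops. -/
def EventuallyInImage (Δ : D ⥤ D) (F : C ⥤ D) (Z : D) : Prop :=
  ∃ (i : ℕ) (X : C), Nonempty ((loopPow Δ i).obj Z ≅ F.obj X)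

variable {Ω : C ⥤ C} {Δ : D ⥤ D} {F : C ⥤ D} {Z : D}

lemma EventuallyInImage.of_loop (h : EventuallyInImage Δ F (Δ.obj Z)) :
    EventuallyInImage Δ F Z :=
  h.elim fun i hi => ⟨i + 1, hi⟩

lemma eventuallyInImage_obj {X : C} (e : Z ≅ F.obj X) : EventuallyInImage Δ F Z := ⟨0, X, ⟨e⟩⟩

/-- Since `Δ F ≅ F Ω`, an object in the image stays there under further loops. This allows a common
exponent for several objects. -/
lemma exists_loopPow_iso_of_le (δ : Ω ⋙ F ≅ F ⋙ Δ) {i j : ℕ} (hij : i ≤ j) {X : C}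
    (e : (loopPow Δ i).obj Z ≅ F.obj X) : ∃ Y : C, Nonempty ((loopPow Δ j).obj Z ≅ F.obj Y) := by
  induction hij with
  | refl => exact ⟨X, ⟨e⟩⟩
  | step _ ih =>
    obtain ⟨Y, ⟨a⟩⟩ := ih
    exact ⟨Ω.obj Y, ⟨eqToIso (loopPow_succ_obj Δ _ Z) ≪≫ Δ.mapIso a ≪≫ (δ.app Y).symm⟩⟩

end EventuallyInImage

/-! ### Closure of the eventual image under extensions -/

section StableTriangles

variable {R : Type u} [Ring R] [IsArtinianRing R]

/-- Each loop comes from three rotations and changes signs; as only the terms matter later, the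
morphisms are left existential. -/
theorem exists_loopPow_mem_stableLeftTriangles (i : ℕ) {T : LeftTriangle (syzygyFunctor R)}
    (hT : T ∈ stableLeftTriangles (R := R)) :
    ∃ (h : (syzygyFunctor R).obj ((loopPow (syzygyFunctor R) i).obj T.Z) ⟶
        (loopPow (syzygyFunctor R) i).obj T.X)
      (f : (loopPow (syzygyFunctor R) i).obj T.X ⟶ (loopPow (syzygyFunctor R) i).obj T.Y)
      (g : (loopPow (syzygyFunctor R) i).obj T.Y ⟶ (loopPow (syzygyFunctor R) i).obj T.Z),
      (⟨_, _, _, h, f, g⟩ : LeftTriangle (syzygyFunctor R)) ∈ stableLeftTriangles (R := R) := by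
  induction i generalizing T with
  | zero => exact ⟨T.h, T.f, T.g, hT⟩
  | succ i ih =>
    obtain ⟨h, f, hT'⟩ := exists_syzygy_mem_stableLeftTriangles hT
    exact ih hT'

/-- If morphisms can be lifted along a looped functor from semisimple modules after one loop, then
the objects that are in its essential image after enough loops are closed under extensions. -/
theorem EventuallyInImage.of_mem_stableLeftTriangles {S : Type u} [Ring S] [IsArtinianRing S]
    {hR : Ring.jacobson R ^ 2 = ⊥} {F : SSCat R ⥤ StableCat S} [F.Additive]
    (δ : ssSyzygyFunctor hR ⋙ F ≅ F ⋙ syzygyFunctor S)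
    (hδ : ∀ {X Y : SSCat R} (g : F.obj X ⟶ F.obj Y),
      ∃ f : (ssSyzygyFunctor hR).obj X ⟶ (ssSyzygyFunctor hR).obj Y,
        (syzygyFunctor S).map g = δ.inv.app X ≫ F.map f ≫ δ.hom.app Y)
    {T : LeftTriangle (syzygyFunctor S)} (hT : T ∈ stableLeftTriangles (R := S))
    (hX : EventuallyInImage (syzygyFunctor S) F T.X)
    (hZ : EventuallyInImage (syzygyFunctor S) F T.Z) :
    EventuallyInImage (syzygyFunctor S) F T.Y := by
  obtain ⟨i, X₀, ⟨eX⟩⟩ := hX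
  obtain ⟨j, Z₀, ⟨eZ⟩⟩ := hZ
  obtain ⟨V, ⟨β⟩⟩ := exists_loopPow_iso_of_le δ (le_max_left i j) eX
  -- `Z` is looped once more than `X`: after two rotations the triangle has terms `ΩY`, `ΩZ`, `X`.
  obtain ⟨U, ⟨α⟩⟩ := exists_loopPow_iso_of_le δ
    ((le_max_right i j).trans (Nat.le_succ (max i j))) eZ
  set n := max i j
  obtain ⟨h, f, g, hT₂⟩ := exists_loopPow_mem_stableLeftTriangles n
    (rotate_mem_stableLeftTriangles (rotate_mem_stableLeftTriangles hT))
  obtain ⟨h', f', hT₃⟩ := exists_syzygy_mem_stableLeftTriangles hT₂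
  change (loopPow (syzygyFunctor S) n).obj ((syzygyFunctor S).obj T.Z) ≅ _ at α
  let g₀ : (loopPow (syzygyFunctor S) n).obj ((syzygyFunctor S).obj T.Z) ⟶
    (loopPow (syzygyFunctor S) n).obj T.X := g
  -- Transported to the image of `F`, the last morphism lifts after one more loop. The sign in the
  -- next line matches the sign introduced by that loop in `hT₃`.
  obtain ⟨u, hu⟩ := hδ (α.inv ≫ g₀ ≫ β.hom)
  obtain ⟨s⟩ := nonempty_morphismSplitting (-u)
  obtain ⟨W, ⟨t⟩⟩ := SSCat.exists_binarySum ((ssSyzygyFunctor hR).obj s.N) s.K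
  have hT₄ := ((LeftTriangle.splittingOfSplitting s t).map F δ).mem_stableLeftTriangles
  -- `hT₃` and the image of the split triangle completing `-u` have isomorphic last morphisms, hence
  -- isomorphic first terms.
  obtain ⟨e⟩ := nonempty_iso_of_mem_stableLeftTriangles hT₃ hT₄
    ((syzygyFunctor S).mapIso α ≪≫ (δ.app U).symm) ((syzygyFunctor S).mapIso β ≪≫ (δ.app V).symm)
    (by
      change (-(syzygyFunctor S).map g₀) ≫ (syzygyFunctor S).map β.hom ≫ δ.inv.app V =
        ((syzygyFunctor S).map α.hom ≫ δ.inv.app U) ≫ F.map (-u)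
      have h1 : (syzygyFunctor S).map g₀ ≫ (syzygyFunctor S).map β.hom =
          (syzygyFunctor S).map α.hom ≫ (syzygyFunctor S).map (α.inv ≫ g₀ ≫ β.hom) := by
        rw [← Functor.map_comp, ← Functor.map_comp, Iso.hom_inv_id_assoc]
      have h2 : δ.hom.app V ≫ δ.inv.app V = 𝟙 _ := by rw [← NatTrans.comp_app]; simp
      rw [Preadditive.neg_comp, ← Category.assoc, h1, hu, Functor.map_neg, Preadditive.comp_neg]
      simp only [Category.assoc]
      rw [h2]
      erw [Category.comp_id])
  -- Of the two loops beyond `n`, one comes from the rotations and one from lifting the morphism.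
  exact ⟨n + 2, W, ⟨eqToIso (loopPow_succ_obj _ n ((syzygyFunctor S).obj T.Y)) ≪≫ e⟩⟩

/-- If moreover all simple modules are in the essential image after enough loops, then so are all
modules. -/
theorem eventuallyInImage_of_isSimpleModule {S : Type u} [Ring S] [IsArtinianRing S]
    {hR : Ring.jacobson R ^ 2 = ⊥} {F : SSCat R ⥤ StableCat S} [F.Additive]
    (δ : ssSyzygyFunctor hR ⋙ F ≅ F ⋙ syzygyFunctor S)
    (hδ : ∀ {X Y : SSCat R} (g : F.obj X ⟶ F.obj Y),
      ∃ f : (ssSyzygyFunctor hR).obj X ⟶ (ssSyzygyFunctor hR).obj Y,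
        (syzygyFunctor S).map g = δ.inv.app X ≫ F.map f ≫ δ.hom.app Y)
    (hS : ∀ M : FGModuleCat.{u} S, IsSimpleModule S M →
      EventuallyInImage (syzygyFunctor S) F (StableCat.of M)) (Z : StableCat S) :
    EventuallyInImage (syzygyFunctor S) F Z := by
  have key : ∀ (M : Type u) [AddCommGroup M] [Module S M], IsFiniteLength S M →
      ∀ _ : Module.Finite S M,
        EventuallyInImage (syzygyFunctor S) F (StableCat.of (FGModuleCat.of S M)) := by
    intro M _ _ hM
    induction hM with
    | @of_subsingleton M _ _ _ =>
      intro _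
      -- The zero module is the image of the empty direct sum.
      obtain ⟨W, ⟨t⟩⟩ := SSCat.exists_familySum (R := R) (fun j : Fin 0 => j.elim0)
      have h0 : 𝟙 (FGModuleCat.of S M) = 0 :=
        FGModuleCat.hom_ext (LinearMap.ext fun x => Subsingleton.elim (α := M) _ _)
      refine eventuallyInImage_obj (X := W) ⟨0, 0, ?_, ?_⟩
      · rw [Limits.zero_comp, ← StableCat.ofHom_id, h0, StableCat.ofHom_zero]
      · rw [Limits.zero_comp]
        exact (t.map F).ext_from fun j => j.elim0
    | @of_simple_quotient M _ _ N hs hN ih =>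
      intro _
      let f : FGModuleCat.of S N ⟶ FGModuleCat.of S M := FGModuleCat.ofHom N.subtype
      let g : FGModuleCat.of S M ⟶ FGModuleCat.of S (M ⧸ N) := FGModuleCat.ofHom N.mkQ
      have hfg : ShortExact f g :=
        ⟨N.injective_subtype, LinearMap.exact_subtype_mkQ N, N.mkQ_surjective⟩
      obtain ⟨h, hh⟩ := hfg.exists_isConnecting
      exact EventuallyInImage.of_mem_stableLeftTriangles δ hδ (moduleTriangle_mem hfg hh)
        (ih inferInstance) (hS _ hs)
  have hfl : IsFiniteLength S Z.as := isFiniteLength_iff_isNoetherian_isArtinian.2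
    ⟨isNoetherian_of_isNoetherianRing_of_finite S Z.as,
      isArtinian_of_fg_of_artinian' (R := S) (M := Z.as)⟩
  exact key Z.as hfl inferInstance

end StableTriangles

open FinQuiver PathAlgebra

/-! ### Coefficients of trivial paths and of arrows in the path algebra -/

section PathAlgebras

variable {k : Type u} [Field k] {Q : FinQuiver.{u}}

/-- The coefficient of an arrow. -/
def arrowCoeff (a : Q.E) : PathAlgebra k Q →ₗ[k] k :=
  (Finsupp.lapply (arrowPath Q a) : (Q.QPath →₀ k) →ₗ[k] k)

open Classical in
lemma arrowCoeff_path (a : Q.E) (p : Q.QPath) :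
    arrowCoeff a (path k p) = if p.source = Q.s a ∧ p.arrows = [a] then 1 else 0 := by
  refine (Finsupp.single_apply (a := p) (a' := arrowPath Q a)).trans ?_
  exact if_congr ⟨fun h => ⟨congrArg QPath.source h, congrArg QPath.arrows h⟩,
    fun h => QPath.ext h.1 h.2⟩ rfl rfl

open Classical in
lemma vertexCoeff_path (v : Q.V) (p : Q.QPath) :
    vertexCoeff v (path k p) = if p.source = v ∧ p.arrows = [] then 1 else 0 := by
  refine (Finsupp.single_apply (a := p) (a' := trivialPath Q v)).trans ?_
  exact if_congr ⟨fun h => ⟨congrArg QPath.source h, congrArg QPath.arrows h⟩,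
    fun h => QPath.ext h.1 h.2⟩ rfl rfl

/-- The last entry of the list is the arrow traversed first, so removing it moves the start of the
path to its target. -/
lemma isPathFrom_concat {v : Q.V} {a : Q.E} : ∀ {l : List Q.E}, Q.IsPathFrom v (l ++ [a]) →
    Q.IsPathFrom (Q.t a) l ∧ Q.s a = v
  | [], h => ⟨trivial, h.1⟩
  | b :: l, h => by
    obtain ⟨h₁, h₂⟩ := isPathFrom_concat h.2
    refine ⟨⟨h.1.trans ?_, h₁⟩, h₂⟩
    exact Q.endpoint_append v l [a]

lemma comp_trivialPath {v : Q.V} {p : Q.QPath} (h : p.source = v) :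
    p.comp (trivialPath Q v) h = p := QPath.ext h.symm (List.append_nil _)

/-- The Leibniz rule for the coefficient of an arrow. -/
lemma arrowCoeff_mul (a : Q.E) (f g : PathAlgebra k Q) :
    arrowCoeff a (f * g) =
      vertexCoeff (Q.t a) f * arrowCoeff a g + arrowCoeff a f * vertexCoeff (Q.s a) g := by
  classical
  -- Both sides are bilinear, so two paths suffice; their product is an arrow only if one of them is
  -- trivial.
  have key : (mulHom k Q).compr₂ (arrowCoeff a) =
      (LinearMap.mul k k).compl₁₂ (vertexCoeff (k := k) (Q.t a)).toLinearMap (arrowCoeff a) +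
        (LinearMap.mul k k).compl₁₂ (arrowCoeff a) (vertexCoeff (k := k) (Q.s a)).toLinearMap := by
    refine linearMap_ext fun p => linearMap_ext fun q => ?_
    change arrowCoeff a (path k p * path k q) = vertexCoeff (Q.t a) (path k p) *
      arrowCoeff a (path k q) + arrowCoeff a (path k p) * vertexCoeff (Q.s a) (path k q)
    rw [vertexCoeff_path, vertexCoeff_path, arrowCoeff_path, arrowCoeff_path]
    by_cases hpq : p.source = q.target
    · have hc : arrowCoeff a (path k (p.comp q hpq)) =
          if q.source = Q.s a ∧ p.arrows ++ q.arrows = [a] then (1 : k) else 0 := by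
        rw [arrowCoeff_path]
        rfl
      rw [path_mul_of_eq hpq, hc]
      clear hc
      have hpq : p.source = Q.endpoint q.source q.arrows := hpq
      rw [hpq]
      generalize q.source = w
      generalize p.arrows = l
      generalize q.arrows = m
      rcases l with - | ⟨b, l⟩
      · rcases m with - | ⟨c, m⟩
        · simp
        · by_cases h : w = Q.s a ∧ c :: m = [a]
          · obtain ⟨rfl, rfl, rfl⟩ : w = Q.s a ∧ c = a ∧ m = [] := by simpa using h
            simp [endpoint]
          · have h' : ¬(w = Q.s a ∧ c = a ∧ m = []) := by simpa using h
            simp [h']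
      · rcases m with - | ⟨c, m⟩
        · by_cases h : w = Q.s a <;> simp [endpoint, h]
        · simp
    · rw [path_mul_of_ne hpq, map_zero]
      by_cases h₁ : p.source = Q.t a ∧ p.arrows = []
      · rw [if_neg (c := p.source = Q.s a ∧ p.arrows = [a]) (by simp [h₁.2]), zero_mul, add_zero,
          if_neg (c := q.source = Q.s a ∧ q.arrows = [a]), mul_zero]
        exact fun h₂ => hpq (by rw [h₁.1, QPath.target, h₂.2]; rfl)
      · rw [if_neg h₁, zero_mul, zero_add]
        by_cases h₂ : p.source = Q.s a ∧ p.arrows = [a]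
        · rw [if_neg (c := q.source = Q.s a ∧ q.arrows = []), mul_zero]
          exact fun h₃ => hpq (by rw [h₂.1, QPath.target, h₃.2, h₃.1]; rfl)
        · rw [if_neg h₂, zero_mul]
  exact congrArg (fun F => F f g) key

lemma exists_eq_comp_arrowPath {p : Q.QPath} (hp : 1 ≤ p.length) :
    ∃ (q : Q.QPath) (a : Q.E) (h : q.source = Q.t a), p = q.comp (arrowPath Q a) h := by
  obtain ⟨v, l, hl⟩ := p
  rcases List.eq_nil_or_concat l with rfl | ⟨l, a, rfl⟩
  · exact absurd hp (by simp [QPath.length])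
  · rw [List.concat_eq_append] at hl
    obtain ⟨h₁, h₂⟩ := isPathFrom_concat hl
    exact ⟨⟨Q.t a, l, h₁⟩, a, rfl, QPath.ext h₂.symm (List.concat_eq_append)⟩

end PathAlgebras

/-! ### Admissible quotients: characters, arrow coefficients, the radical, simple modules -/

section Quotients

variable {k : Type u} [Field k] {Q : FinQuiver.{u}} (I : Ideal (PathAlgebra k Q)) [IsAdmissible I]

/-- The class of the trivial path at a vertex. -/
def vertexElt (v : Q.V) : PathAlgebra k Q ⧸ I := Ideal.Quotient.mk I (path k (trivialPath Q v))

/-- The class of an arrow. -/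
def arrowElt (a : Q.E) : PathAlgebra k Q ⧸ I := Ideal.Quotient.mk I (path k (arrowPath Q a))

lemma sum_vertexElt : ∑ v, vertexElt I v = 1 := by
  rw [← map_one (Ideal.Quotient.mk I), one_def, map_sum]
  rfl

lemma vertexElt_mul_self (v : Q.V) : vertexElt I v * vertexElt I v = vertexElt I v := by
  rw [vertexElt, ← map_mul, path_mul_of_eq (p := trivialPath Q v) (q := trivialPath Q v) rfl]
  rfl

lemma vertexElt_mul_arrowElt (a : Q.E) : vertexElt I (Q.t a) * arrowElt I a = arrowElt I a := by
  rw [vertexElt, arrowElt, ← map_mul,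
    path_mul_of_eq (p := trivialPath Q (Q.t a)) (q := arrowPath Q a) rfl]
  rfl

lemma arrowElt_mul_vertexElt (a : Q.E) : arrowElt I a * vertexElt I (Q.s a) = arrowElt I a := by
  rw [vertexElt, arrowElt, ← map_mul,
    path_mul_of_eq (p := arrowPath Q a) (q := trivialPath Q (Q.s a)) rfl]
  exact congrArg _ (congrArg _ (comp_trivialPath rfl))

lemma arrowElt_mul_vertexElt_of_ne {a : Q.E} {v : Q.V} (h : Q.s a ≠ v) :
    arrowElt I a * vertexElt I v = 0 := by
  rw [vertexElt, arrowElt, ← map_mul,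
    path_mul_of_ne (p := arrowPath Q a) (q := trivialPath Q v) h, map_zero]

/-- The algebra homomorphism `kQ/I → k` given by the coefficient of `e_v`. -/
def quotChar (v : Q.V) : (PathAlgebra k Q ⧸ I) →ₐ[k] k :=
  Ideal.Quotient.liftₐ _ (vertexCoeff v) fun _ hf =>
    arrowIdeal_le_ker v (Ideal.pow_le_self two_ne_zero (IsAdmissible.le_sq hf))

lemma quotChar_mk (v : Q.V) (f : PathAlgebra k Q) :
    quotChar I v (Ideal.Quotient.mk I f) = vertexCoeff v f := rfl

@[simp] lemma quotChar_vertexElt_self (v : Q.V) : quotChar I v (vertexElt I v) = 1 := by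
  rw [vertexElt, quotChar_mk, vertexCoeff_path, if_pos ⟨rfl, rfl⟩]

lemma quotChar_vertexElt_ne {v w : Q.V} (h : v ≠ w) : quotChar I v (vertexElt I w) = 0 := by
  rw [vertexElt, quotChar_mk, vertexCoeff_path, if_neg]
  exact fun h' => h h'.1.symm

@[simp] lemma quotChar_arrowElt (v : Q.V) (a : Q.E) : quotChar I v (arrowElt I a) = 0 := by
  rw [arrowElt, quotChar_mk, vertexCoeff_path, if_neg]
  exact fun h' => List.cons_ne_nil _ _ h'.2

/-- Elements of `J` have no trivial paths, so the Leibniz rule kills products of two of them. This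
is why arrow coefficients descend to the quotient. -/
lemma arrowCoeff_eq_zero_of_mem {f : PathAlgebra k Q} (hf : f ∈ arrowIdeal k Q ^ 2) (a : Q.E) :
    arrowCoeff a f = 0 := by
  rw [Submodule.pow_succ, Submodule.pow_one] at hf
  refine Submodule.mul_induction_on hf (fun f hf g hg => ?_) fun f g hf hg => ?_
  · have h1 : vertexCoeff (Q.t a) f = 0 := arrowIdeal_le_ker _ hf
    have h2 : vertexCoeff (Q.s a) g = 0 := arrowIdeal_le_ker _ hg
    rw [arrowCoeff_mul, h1, h2, zero_mul, mul_zero, add_zero]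
  · rw [map_add, hf, hg, add_zero]

/-- The coefficient of an arrow, on the quotient of a path algebra by an admissible ideal. -/
def quotArrowCoeff (a : Q.E) : (PathAlgebra k Q ⧸ I) →ₗ[k] k :=
  (I.restrictScalars k).liftQ (arrowCoeff a) fun _ hf =>
    arrowCoeff_eq_zero_of_mem (IsAdmissible.le_sq hf) a

lemma quotArrowCoeff_mk (a : Q.E) (f : PathAlgebra k Q) :
    quotArrowCoeff I a (Ideal.Quotient.mk I f) = arrowCoeff a f := rfl

lemma quotArrowCoeff_mul (a : Q.E) (x y : PathAlgebra k Q ⧸ I) :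
    quotArrowCoeff I a (x * y) = quotChar I (Q.t a) x * quotArrowCoeff I a y +
      quotArrowCoeff I a x * quotChar I (Q.s a) y := by
  obtain ⟨f, rfl⟩ := Ideal.Quotient.mk_surjective x
  obtain ⟨g, rfl⟩ := Ideal.Quotient.mk_surjective y
  rw [← map_mul, quotArrowCoeff_mk, arrowCoeff_mul]
  rfl

@[simp] lemma quotArrowCoeff_arrowElt_self (a : Q.E) :
    quotArrowCoeff I a (arrowElt I a) = 1 := by
  rw [arrowElt, quotArrowCoeff_mk, arrowCoeff_path, if_pos ⟨rfl, rfl⟩]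

lemma quotArrowCoeff_arrowElt_ne {a b : Q.E} (h : a ≠ b) :
    quotArrowCoeff I a (arrowElt I b) = 0 := by
  rw [arrowElt, quotArrowCoeff_mk, arrowCoeff_path, if_neg]
  exact fun h' => h (List.cons.inj h'.2).1.symm

lemma quotArrowCoeff_vertexElt (a : Q.E) (v : Q.V) :
    quotArrowCoeff I a (vertexElt I v) = 0 := by
  rw [vertexElt, quotArrowCoeff_mk, arrowCoeff_path, if_neg]
  exact fun h' => List.cons_ne_nil _ _ h'.2.symm

/-- The left ideal generated by the arrows. -/
def arrowSpan : Ideal (PathAlgebra k Q ⧸ I) := Ideal.span (Set.range (arrowElt I))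

variable {I}

lemma quotChar_eq_zero_of_mem {x : PathAlgebra k Q ⧸ I} (hx : x ∈ arrowSpan I) (v : Q.V) :
    quotChar I v x = 0 := by
  have : arrowSpan I ≤ RingHom.ker (quotChar I v) := by
    rw [arrowSpan, Ideal.span_le]
    rintro _ ⟨a, rfl⟩
    exact quotChar_arrowElt I v a
  exact this hx

lemma mem_of_path_mem {P : Submodule k (PathAlgebra k Q)} {f : PathAlgebra k Q}
    (h : ∀ p : Q.QPath, Finsupp.toFun f p ≠ 0 → path k p ∈ P) : f ∈ P := by
  have h1 : f = ∑ p ∈ Finsupp.support f, Finsupp.toFun f p • path k p := by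
    refine (Finsupp.sum_single (α := Q.QPath) (M := k) f).symm.trans ?_
    refine Finset.sum_congr rfl fun p _ => ?_
    exact (Finsupp.smul_single_one p (Finsupp.toFun f p)).symm
  rw [h1]
  exact Submodule.sum_mem _ fun p hp => P.smul_mem _ (h p (Finsupp.mem_support_iff.1 hp))

/-- A path of positive length is a left multiple of its first arrow. With `quotChar_eq_zero_of_mem`
this identifies the left ideal `arrowSpan I` with the common kernel of the characters. -/
lemma mem_arrowSpan_of_quotChar {x : PathAlgebra k Q ⧸ I} (hx : ∀ v, quotChar I v x = 0) :
    x ∈ arrowSpan I := by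
  obtain ⟨f, rfl⟩ := Ideal.Quotient.mk_surjective x
  refine mem_of_path_mem (P := ((arrowSpan I).restrictScalars k).comap
    (Ideal.Quotient.mkₐ k I).toLinearMap) (f := f) fun p hp => ?_
  change Ideal.Quotient.mk I (path k p) ∈ arrowSpan I
  by_cases hl : 1 ≤ p.length
  · obtain ⟨q, a, h, rfl⟩ := exists_eq_comp_arrowPath hl
    rw [← path_mul_of_eq (p := q) (q := arrowPath Q a) h, map_mul]
    exact Ideal.mul_mem_left _ _ (Ideal.subset_span ⟨a, rfl⟩)
  · have h2 : p = trivialPath Q p.source :=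
      QPath.ext rfl (List.length_eq_zero_iff.1 (by simpa [QPath.length] using hl))
    rw [h2] at hp
    exact absurd (hx p.source) hp

/-- Such elements lift to `J`, and `J ^ d ⊆ I`. -/
lemma pow_eq_zero_of_mem_arrowSpan : ∃ d : ℕ, ∀ x ∈ arrowSpan I, x ^ d = 0 := by
  obtain ⟨d, -, hd⟩ := IsAdmissible.exists_pow_le (I := I)
  refine ⟨d, fun x hx => ?_⟩
  obtain ⟨f, rfl⟩ := Ideal.Quotient.mk_surjective x
  have hf : f ∈ arrowIdeal k Q := mem_arrowIdeal_of_vertexCoeff f fun v =>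
    quotChar_eq_zero_of_mem hx v
  have hpow : ∀ n : ℕ, f ^ n ∈ arrowIdeal k Q ^ n := by
    intro n
    induction n with
    | zero => rw [Submodule.pow_zero, Ideal.one_eq_top]; exact Submodule.mem_top
    | succ n ih =>
      rw [Ideal.IsTwoSided.pow_succ, pow_succ']
      exact Ideal.mul_mem_mul hf ih
  rw [← map_pow]
  exact Ideal.Quotient.eq_zero_iff_mem.2 (hd (hpow d))

/-- Modulo the arrows, `A e_v` is spanned over `k` by `e_v`. -/
lemma mul_vertexElt_sub_mem (x : PathAlgebra k Q ⧸ I) (v : Q.V) :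
    x * vertexElt I v - quotChar I v x • vertexElt I v ∈ arrowSpan I := by
  refine mem_arrowSpan_of_quotChar fun w => ?_
  rw [map_sub, map_mul, map_smul, smul_eq_mul]
  by_cases h : w = v
  · subst h
    exact sub_self _
  · rw [quotChar_vertexElt_ne I h, mul_zero, mul_zero, sub_zero]

/-- Simple modules are spanned by a vector on which the algebra acts by some character. -/
theorem exists_smul_eq_quotChar_smul (T : Type u) [AddCommGroup T]
    [Module (PathAlgebra k Q ⧸ I) T] [IsSimpleModule (PathAlgebra k Q ⧸ I) T] :
    ∃ (v : Q.V) (t : T), t ≠ 0 ∧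
      ∀ x : PathAlgebra k Q ⧸ I, x • t = algebraMap k (PathAlgebra k Q ⧸ I) (quotChar I v x) • t := by
  have := IsSimpleModule.nontrivial (PathAlgebra k Q ⧸ I) T
  obtain ⟨t₀, ht₀⟩ := exists_ne (0 : T)
  -- Nakayama's argument: otherwise the submodule generated by the products of `arrowSpan I` with
  -- `t` is all of `T`, so `t = y • t` for a nilpotent `y`, and `t = 0`.
  have hkill : ∀ x ∈ arrowSpan I, ∀ t : T, x • t = 0 := by
    intro x hx t
    by_contra hne
    let L : Submodule (PathAlgebra k Q ⧸ I) T :=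
      Submodule.map (LinearMap.toSpanSingleton (PathAlgebra k Q ⧸ I) T t) (arrowSpan I)
    have hL : L = ⊤ := (eq_bot_or_eq_top L).resolve_left fun h =>
      hne ((Submodule.eq_bot_iff L).1 h _ ⟨x, hx, rfl⟩)
    obtain ⟨y, hy, hyt⟩ : t ∈ L := hL ▸ Submodule.mem_top
    have hyt : y • t = t := hyt
    obtain ⟨d, hd⟩ := pow_eq_zero_of_mem_arrowSpan (I := I)
    have : ∀ n : ℕ, y ^ n • t = t := by
      intro n
      induction n with
      | zero => rw [pow_zero, one_smul]
      | succ n ih => rw [pow_succ, mul_smul, hyt, ih]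
    have h0 := this d
    rw [hd y hy, zero_smul] at h0
    exact hne (by rw [← h0, smul_zero])
  obtain ⟨v, hv⟩ : ∃ v, vertexElt I v • t₀ ≠ 0 := by
    by_contra! h
    refine ht₀ ?_
    rw [← one_smul (PathAlgebra k Q ⧸ I) t₀, ← sum_vertexElt, Finset.sum_smul]
    exact Finset.sum_eq_zero fun v _ => h v
  refine ⟨v, vertexElt I v • t₀, hv, fun x => ?_⟩
  have := hkill _ (mul_vertexElt_sub_mem x v) t₀
  rw [sub_smul, sub_eq_zero, Algebra.smul_def, mul_smul, mul_smul] at this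
  exact this

end Quotients

lemma FGModuleCat_sum_apply {R : Type u} [Ring R] {M N : FGModuleCat.{u} R} {J : Type*}
    (s : Finset J) (f : J → (M ⟶ N)) (x : M) :
    (∑ j ∈ s, f j).hom.hom x = ∑ j ∈ s, (f j).hom.hom x :=
  map_sum (AddMonoidHom.mk' (fun f : M ⟶ N => f.hom.hom x) fun _ _ => rfl) f s

/-! ### The projective modules `A e_v` and cyclic presentations -/

section Projectives

variable {k : Type u} [Field k] {Q : FinQuiver.{u}} (I : Ideal (PathAlgebra k Q)) [IsAdmissible I]

/-- The indecomposable projective module at a vertex. -/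
def vertexIdeal (v : Q.V) : Ideal (PathAlgebra k Q ⧸ I) := Ideal.span {vertexElt I v}

variable {I}

lemma mem_vertexIdeal {v : Q.V} {x : PathAlgebra k Q ⧸ I} :
    x ∈ vertexIdeal I v ↔ x * vertexElt I v = x := by
  constructor
  · intro hx
    obtain ⟨y, rfl⟩ := Ideal.mem_span_singleton'.1 hx
    rw [mul_assoc, vertexElt_mul_self]
  · intro hx
    exact Ideal.mem_span_singleton'.2 ⟨x, hx⟩

lemma mem_arrowSpan_of_mem_vertexIdeal {v : Q.V} {x : PathAlgebra k Q ⧸ I}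
    (hx : x ∈ vertexIdeal I v) (h : quotChar I v x = 0) : x ∈ arrowSpan I := by
  have := mul_vertexElt_sub_mem x v
  rwa [mem_vertexIdeal.1 hx, h, zero_smul, sub_zero] at this

instance projective_vertexIdeal (v : Q.V) :
    Module.Projective (PathAlgebra k Q ⧸ I) (vertexIdeal I v) :=
  Module.Projective.of_split (vertexIdeal I v).subtype
    ((LinearMap.toSpanSingleton (PathAlgebra k Q ⧸ I) (PathAlgebra k Q ⧸ I)
      (vertexElt I v)).codRestrict (vertexIdeal I v) fun x => by
        rw [mem_vertexIdeal, LinearMap.toSpanSingleton_apply, smul_eq_mul, mul_assoc,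
          vertexElt_mul_self])
    (LinearMap.ext fun x => Subtype.ext (mem_vertexIdeal.1 x.2))

variable (I) in
/-- The indecomposable projective module at a vertex. -/
abbrev vertexModule (v : Q.V) : FGModuleCat.{u} (PathAlgebra k Q ⧸ I) :=
  FGModuleCat.of _ (vertexIdeal I v)

instance (v : Q.V) : Module.Projective (PathAlgebra k Q ⧸ I) (vertexModule I v) :=
  projective_vertexIdeal v

section Presentation

variable {M : FGModuleCat.{u} (PathAlgebra k Q ⧸ I)}

/-- The kernel of the map `A e_v ⟶ M` given by an element of `M`. -/
def relationIdeal (v : Q.V) (m : M) : Ideal (PathAlgebra k Q ⧸ I) :=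
  vertexIdeal I v ⊓ LinearMap.ker (LinearMap.toSpanSingleton (PathAlgebra k Q ⧸ I) M m)

lemma mem_relationIdeal {v : Q.V} {m : M} {x : PathAlgebra k Q ⧸ I} :
    x ∈ relationIdeal v m ↔ x * vertexElt I v = x ∧ x • m = 0 := by
  rw [relationIdeal, Submodule.mem_inf, mem_vertexIdeal]
  rfl

/-- The kernel of the map `A e_v ⟶ M` given by an element of `M`. -/
abbrev relationModule (v : Q.V) (m : M) : FGModuleCat.{u} (PathAlgebra k Q ⧸ I) :=
  FGModuleCat.of _ (relationIdeal v m)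

/-- The inclusion into `A e_v`. -/
def relationι (v : Q.V) (m : M) : relationModule v m ⟶ vertexModule I v :=
  FGModuleCat.ofHom (Submodule.inclusion inf_le_left)

/-- The map `A e_v ⟶ M` given by an element of `M`. -/
def presentation (v : Q.V) (m : M) : vertexModule I v ⟶ M :=
  FGModuleCat.ofHom
    (LinearMap.toSpanSingleton (PathAlgebra k Q ⧸ I) M m ∘ₗ (vertexIdeal I v).subtype)

lemma presentation_apply (v : Q.V) (m : M) (x : vertexIdeal I v) :
    (presentation v m).hom.hom x = x.1 • m := rfl

/-- Syzygies are computed from these sequences. No minimality is needed: by `exists_connecting_iso`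
the kernel of any surjection from a projective module is stably the syzygy. -/
lemma shortExact_presentation {v : Q.V} {m : M} (hv : vertexElt I v • m = m)
    (hm : ∀ y : M, ∃ x : PathAlgebra k Q ⧸ I, x • m = y) :
    ShortExact (relationι v m) (presentation v m) where
  injective := Submodule.inclusion_injective (inf_le_left : relationIdeal v m ≤ vertexIdeal I v)
  exact x := ⟨fun hx => ⟨⟨x.1, x.2, hx⟩, rfl⟩, by rintro ⟨y, rfl⟩; exact y.2.2⟩
  surjective y := by
    obtain ⟨x, rfl⟩ := hm y
    exact ⟨⟨x * vertexElt I v, mem_vertexIdeal.2 (by rw [mul_assoc, vertexElt_mul_self])⟩, by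
      rw [presentation_apply, mul_smul, hv]⟩

end Presentation

end Projectives

/-- The arrows of a quiver that start at a vertex. -/
abbrev ArrowsFrom (Q : FinQuiver.{u}) (v : Q.V) : Type u := {x : Q.E // Q.s x = v}

instance arrowsFromFintype (Q : FinQuiver.{u}) (v : Q.V) : Fintype (ArrowsFrom Q v) := Fintype.ofFinite _

/-! ### Simple modules over the radical square zero algebra and their syzygies -/

section SimpleModules

variable {k : Type u} [Field k] {Q : FinQuiver.{u}}

/-- The simple module `S_v`, as a finitely generated module. -/
def simpleFG (k : Type u) [Field k] (Q : FinQuiver.{u}) (v : Q.V) :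
    FGModuleCat.{u} (RadSquareZero k Q) :=
  have := isSimpleModule_simpleModule (k := k) v
  ⟨simpleModule k Q v, (inferInstance : Module.Finite _ (simpleModule k Q v))⟩

instance (v : Q.V) : IsSimpleModule (RadSquareZero k Q) (simpleFG k Q v) :=
  isSimpleModule_simpleModule v

/-- Elements of the field as elements of `S_v`. -/
def toSimple (v : Q.V) (c : k) : simpleFG k Q v := c

/-- Elements of `S_v` as elements of the field. -/
def ofSimple (v : Q.V) (x : simpleFG k Q v) : k := x

lemma smul_toSimple (v : Q.V) (b : RadSquareZero k Q) (c : k) :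
    b • toSimple v c = toSimple v (quotChar (arrowIdeal k Q ^ 2) v b * c) := rfl

lemma ofSimple_smul (v : Q.V) (b : RadSquareZero k Q) (x : simpleFG k Q v) :
    ofSimple v (b • x) = quotChar (arrowIdeal k Q ^ 2) v b * ofSimple v x := rfl

lemma toSimple_ofSimple (v : Q.V) (x : simpleFG k Q v) : toSimple v (ofSimple v x) = x := rfl

lemma toSimple_eq_smul (v : Q.V) (c : k) :
    toSimple v c = algebraMap k (RadSquareZero k Q) c • toSimple v 1 := by
  rw [smul_toSimple, mul_one, AlgHom.commutes]
  rfl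

/-- Linear maps out of `S_v`. -/
def simpleLift {v : Q.V} {M : FGModuleCat.{u} (RadSquareZero k Q)} (m : M)
    (h : ∀ b : RadSquareZero k Q,
      b • m = algebraMap k (RadSquareZero k Q) (quotChar (arrowIdeal k Q ^ 2) v b) • m) :
    simpleFG k Q v ⟶ M :=
  let f : simpleFG k Q v →ₗ[RadSquareZero k Q] M :=
    { toFun := fun x => algebraMap k (RadSquareZero k Q) (ofSimple v x) • m
      map_add' := fun x y => by
        change algebraMap k (RadSquareZero k Q) (ofSimple v x + ofSimple v y) • m = _
        rw [map_add, add_smul]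
      map_smul' := fun b x => by
        rw [ofSimple_smul, RingHom.id_apply, ← mul_smul, ← Algebra.commutes, mul_smul _ b, h b,
          ← mul_smul, ← map_mul, mul_comm] }
  (FGModuleCat.ofHom f :)

lemma simpleLift_toSimple {v : Q.V} {M : FGModuleCat.{u} (RadSquareZero k Q)} {m : M}
    (h : ∀ b : RadSquareZero k Q,
      b • m = algebraMap k (RadSquareZero k Q) (quotChar (arrowIdeal k Q ^ 2) v b) • m) (c : k) :
    (simpleLift m h).hom.hom (toSimple v c) = algebraMap k (RadSquareZero k Q) c • m := rfl

/-- Simple modules of `kQ/J²` are of the form `S_v`. -/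
theorem exists_simpleFG_equiv (T : Type u) [AddCommGroup T] [Module (RadSquareZero k Q) T]
    [IsSimpleModule (RadSquareZero k Q) T] :
    ∃ v : Q.V, Nonempty (T ≃ₗ[RadSquareZero k Q] simpleFG k Q v) := by
  obtain ⟨v, t, ht, h⟩ := exists_smul_eq_quotChar_smul (I := arrowIdeal k Q ^ 2) T
  refine ⟨v, ⟨(LinearEquiv.ofBijective (simpleLift (M := FGModuleCat.of _ T) t h).hom.hom
    ?_).symm⟩⟩
  refine (LinearMap.bijective_or_eq_zero _).resolve_right fun h0 => ht ?_
  have := LinearMap.congr_fun h0 (toSimple v 1)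
  rw [simpleLift_toSimple, map_one, one_smul] at this
  exact this

/-- Semisimple modules of `kQ/J²` are finite direct sums of modules of the form `S_v`. -/
theorem exists_familySum_simpleObj (X : SSCat (RadSquareZero k Q)) :
    ∃ (n : ℕ) (a : Fin n → Q.V),
      Nonempty (FamilySum (fun j => simpleObj k Q (a j)) X) := by
  obtain ⟨⟨M⟩, hM⟩ := X
  have : IsSemisimpleModule (RadSquareZero k Q) M := hM
  obtain ⟨n, S, e, hS⟩ := IsSemisimpleModule.exists_linearEquiv_fin_dfinsupp
    (RadSquareZero k Q) M
  choose a ha using fun j => exists_simpleFG_equiv (k := k) (Q := Q) (S j)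
  let e' : M ≃ₗ[RadSquareZero k Q] (∀ j, simpleFG k Q (a j)) :=
    e.trans ((DFinsupp.linearEquivFunOnFintype).trans
      (LinearEquiv.piCongrRight fun j => (ha j).some))
  let E : FGModuleCat.of (RadSquareZero k Q) (∀ j, simpleFG k Q (a j)) ≅ M :=
    ⟨FGModuleCat.ofHom e'.symm.toLinearMap, FGModuleCat.ofHom e'.toLinearMap,
      FGModuleCat.hom_ext (LinearMap.ext e'.apply_symm_apply),
      FGModuleCat.hom_ext (LinearMap.ext e'.symm_apply_apply)⟩
  exact ⟨n, a, ⟨(((piSum fun j => simpleFG k Q (a j)).ofIso E).map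
    (CategoryTheory.Quotient.functor (stableRel (RadSquareZero k Q)))).toFullSubcategory⟩⟩

/-- Morphisms between modules of the form `S_v` are scalar. -/
theorem exists_eq_scalarHom_simpleObj (v w : Q.V) (f : simpleObj k Q v ⟶ simpleObj k Q w) :
    ∃ c : k, f = scalarHom (simpleObj k Q) c v w := by
  obtain ⟨f₀, hf₀⟩ := StableCat.exists_ofHom (M := simpleFG k Q v) (N := simpleFG k Q w) f.hom
  have h1 : ∀ (b : RadSquareZero k Q) (x : simpleFG k Q v), f₀.hom.hom (b • x) =
      b • f₀.hom.hom x := fun b x => map_smul f₀.hom.hom b x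
  by_cases h : v = w
  · subst h
    refine ⟨ofSimple v (f₀.hom.hom (toSimple v 1)), ?_⟩
    rw [scalarHom_self]
    refine ObjectProperty.hom_ext _ (hf₀.symm.trans ?_)
    refine Eq.trans (congrArg _ ?_)
      (StableCat.ofHom_smul (ofSimple v (f₀.hom.hom (toSimple v 1))) (𝟙 (simpleFG k Q v)))
    refine FGModuleCat.hom_ext (LinearMap.ext fun x => ?_)
    change f₀.hom.hom x = algebraMap k (RadSquareZero k Q) _ • x
    rw [← toSimple_ofSimple v x, toSimple_eq_smul, h1, ← mul_smul, ← map_mul, mul_comm, map_mul,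
      mul_smul, ← toSimple_eq_smul, toSimple_ofSimple]
  · refine ⟨0, ?_⟩
    rw [scalarHom_ne _ _ h]
    refine ObjectProperty.hom_ext _ (hf₀.symm.trans ?_)
    have : f₀ = 0 := by
      refine FGModuleCat.hom_ext (LinearMap.ext fun x => ?_)
      -- The idempotent `e_v` acts as the identity on `S_v` and as zero on `S_w`.
      have h2 : vertexElt (arrowIdeal k Q ^ 2) v • x = x := by
        rw [← toSimple_ofSimple v x, smul_toSimple, quotChar_vertexElt_self, one_mul]
      rw [← h2, h1]
      change toSimple w (quotChar (arrowIdeal k Q ^ 2) w (vertexElt _ v) * ofSimple w _) = 0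
      rw [quotChar_vertexElt_ne _ (Ne.symm h), zero_mul]
      rfl
    rw [this]
    exact StableCat.ofHom_zero

/-- All paths of length at least two vanish in `kQ/J²`, so only trivial paths and arrows have to be
tested. -/
lemma eq_zero_of_coeff_eq_zero {x : RadSquareZero k Q}
    (h₀ : ∀ v, quotChar (arrowIdeal k Q ^ 2) v x = 0)
    (h₁ : ∀ a, quotArrowCoeff (arrowIdeal k Q ^ 2) a x = 0) : x = 0 := by
  classical
  obtain ⟨f, rfl⟩ := Ideal.Quotient.mk_surjective x
  refine Ideal.Quotient.eq_zero_iff_mem.2 ?_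
  refine mem_of_path_mem (P := (arrowIdeal k Q ^ 2).restrictScalars k) fun p hp => ?_
  refine path_mem_arrowIdeal_pow 2 p ?_
  by_contra hl
  obtain ⟨v, l, hpath⟩ := p
  rcases l with - | ⟨a, l⟩
  · exact hp (h₀ v)
  · rcases l with - | ⟨b, l⟩
    · refine hp (Eq.trans ?_ (h₁ a))
      obtain rfl : Q.s a = v := hpath.1
      rfl
    · exact hl (by simp [QPath.length])

/-- Arrows kill arrows, so only the `e_{t(a)}` part of `b` acts: each arrow spans a copy of the
simple module at its end. -/
lemma mul_arrowElt_eq (b : RadSquareZero k Q) (a : Q.E) :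
    b * arrowElt (arrowIdeal k Q ^ 2) a = algebraMap k (RadSquareZero k Q)
      (quotChar (arrowIdeal k Q ^ 2) (Q.t a) b) * arrowElt (arrowIdeal k Q ^ 2) a := by
  rw [← sub_eq_zero, ← sub_mul]
  refine eq_zero_of_coeff_eq_zero (fun v => ?_) fun c => ?_
  · rw [map_mul, quotChar_arrowElt, mul_zero]
  · rw [quotArrowCoeff_mul, quotChar_arrowElt, mul_zero, add_zero, map_sub, AlgHom.commutes]
    by_cases h : c = a
    · subst h
      rw [Algebra.algebraMap_self_apply, sub_self, zero_mul]
    · rw [quotArrowCoeff_arrowElt_ne _ h, mul_zero]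

/-- The relations of the module `S_v`. -/
abbrev simpleRelation (v : Q.V) : FGModuleCat.{u} (RadSquareZero k Q) :=
  relationModule (I := arrowIdeal k Q ^ 2) v (toSimple v 1 : simpleFG k Q v)

lemma mem_simpleRelation {v : Q.V} {x : RadSquareZero k Q} :
    x ∈ relationIdeal (I := arrowIdeal k Q ^ 2) v (toSimple v 1 : simpleFG k Q v) ↔
      x * vertexElt (arrowIdeal k Q ^ 2) v = x ∧ quotChar (arrowIdeal k Q ^ 2) v x = 0 := by
  rw [mem_relationIdeal, smul_toSimple, mul_one]
  rfl

lemma shortExact_simpleFG (v : Q.V) : ShortExact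
    (relationι (I := arrowIdeal k Q ^ 2) v (toSimple v 1 : simpleFG k Q v))
    (presentation v (toSimple v 1 : simpleFG k Q v)) :=
  shortExact_presentation (by rw [smul_toSimple, quotChar_vertexElt_self, one_mul])
    fun y => ⟨algebraMap k (RadSquareZero k Q) (ofSimple v y), (toSimple_eq_smul v _).symm⟩

/-- The relations of `S_v` are the direct sum of the simple modules at the ends of the arrows that
start at `v`. -/
def simpleRelationSum (v : Q.V) :
    FamilySum (fun x : ArrowsFrom Q v => simpleFG k Q (Q.t x.1))
      (simpleRelation (k := k) v) where
  ι x := simpleLift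
    (M := simpleRelation (k := k) v)
    ⟨arrowElt (arrowIdeal k Q ^ 2) x.1, mem_simpleRelation.2
      ⟨by obtain ⟨x, rfl⟩ := x; exact arrowElt_mul_vertexElt _ x, quotChar_arrowElt _ _ _⟩⟩
    fun b => Subtype.ext (mul_arrowElt_eq b x.1)
  π x :=
    let f : simpleRelation (k := k) v →ₗ[RadSquareZero k Q] simpleFG k Q (Q.t x.1) :=
    { toFun := fun y => toSimple _ (quotArrowCoeff (arrowIdeal k Q ^ 2) x.1 y.1)
      map_add' := fun y z => congrArg (toSimple _) (map_add _ y.1 z.1)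
      map_smul' := fun b y => by
        have h : quotChar (arrowIdeal k Q ^ 2) (Q.s x.1) y.1 = 0 := by
          rw [x.2]
          exact (mem_simpleRelation.1 y.2).2
        change toSimple _ (quotArrowCoeff _ x.1 (b * y.1)) = b • toSimple _ _
        rw [quotArrowCoeff_mul, h, mul_zero, add_zero, smul_toSimple] }
    (FGModuleCat.ofHom f :)
  ι_π_self x := by
    refine FGModuleCat.hom_ext (LinearMap.ext fun y => ?_)
    change quotArrowCoeff (arrowIdeal k Q ^ 2) x.1
      (algebraMap k (RadSquareZero k Q) (ofSimple _ y) * arrowElt _ x.1) = ofSimple _ y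
    rw [← Algebra.smul_def, map_smul, quotArrowCoeff_arrowElt_self, smul_eq_mul, mul_one]
  ι_π_ne {x x'} h := by
    refine FGModuleCat.hom_ext (LinearMap.ext fun y => ?_)
    change quotArrowCoeff (arrowIdeal k Q ^ 2) x'.1
      (algebraMap k (RadSquareZero k Q) (ofSimple _ y) * arrowElt _ x.1) = 0
    rw [← Algebra.smul_def, map_smul,
      quotArrowCoeff_arrowElt_ne _ fun h' => h (Subtype.ext h'.symm), smul_zero]
  total := by
    refine FGModuleCat.hom_ext (LinearMap.ext fun y => ?_)
    obtain ⟨hy, hy₀⟩ := mem_simpleRelation.1 y.2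
    refine (FGModuleCat_sum_apply _ _ _).trans (Subtype.ext ?_)
    change ((∑ x : ArrowsFrom Q v, (_ : relationIdeal (I := arrowIdeal k Q ^ 2) v
      (toSimple v 1 : simpleFG k Q v)) : relationIdeal (I := arrowIdeal k Q ^ 2) v
      (toSimple v 1 : simpleFG k Q v)) : RadSquareZero k Q) = y.1
    rw [AddSubmonoidClass.coe_finsetSum]
    change ∑ x : ArrowsFrom Q v, algebraMap k (RadSquareZero k Q)
      (quotArrowCoeff (arrowIdeal k Q ^ 2) x.1 y.1) * arrowElt (arrowIdeal k Q ^ 2) x.1 = y.1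
    have hχ : ∀ w, quotChar (arrowIdeal k Q ^ 2) w y.1 = 0 := fun w =>
      quotChar_eq_zero_of_mem (mem_arrowSpan_of_mem_vertexIdeal (mem_vertexIdeal.2 hy) hy₀) w
    rw [← sub_eq_zero]
    -- Coefficients are compared: a relation of `S_v` has no trivial paths, and no arrows other than
    -- those starting at `v`.
    refine eq_zero_of_coeff_eq_zero (fun w => ?_) fun c => ?_
    · rw [map_sub, map_sum, hχ, sub_zero]
      exact Finset.sum_eq_zero fun x _ => by rw [map_mul, quotChar_arrowElt, mul_zero]
    · rw [map_sub, map_sum, sub_eq_zero]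
      simp_rw [← Algebra.smul_def, map_smul, smul_eq_mul]
      by_cases hc : Q.s c = v
      · rw [Finset.sum_eq_single ⟨c, hc⟩]
        · rw [quotArrowCoeff_arrowElt_self, mul_one]
        · intro x _ hx
          rw [quotArrowCoeff_arrowElt_ne _ fun h => hx (Subtype.ext h.symm), mul_zero]
        · intro h
          exact absurd (Finset.mem_univ _) h
      · have h1 : quotArrowCoeff (arrowIdeal k Q ^ 2) c y.1 = 0 := by
          rw [← hy, quotArrowCoeff_mul, quotArrowCoeff_vertexElt, mul_zero, zero_add,
            quotChar_vertexElt_ne _ hc, mul_zero]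
        rw [h1]
        refine Finset.sum_eq_zero fun x _ => ?_
        rw [quotArrowCoeff_arrowElt_ne _ fun h => hc ((congrArg Q.s h).trans x.2), mul_zero]

/-- The syzygy of `S_v` is the direct sum of the simple modules at the ends of the arrows that
start at `v`. -/
theorem nonempty_familySum_syzygy_simpleObj (v : Q.V) :
    Nonempty (FamilySum (fun x : ArrowsFrom Q v => simpleObj k Q (Q.t x.1))
      ((ssSyzygyFunctor (jacobson_radSquareZero (k := k) (Q := Q))).obj (simpleObj k Q v))) := by
  obtain ⟨h, hh⟩ := (shortExact_simpleFG (k := k) v).exists_isConnecting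
  obtain ⟨e, -⟩ := (shortExact_simpleFG (k := k) v).exists_connecting_iso hh
  exact ⟨(((simpleRelationSum v).map
    (CategoryTheory.Quotient.functor (stableRel (RadSquareZero k Q)))).ofIso
      e.symm).toFullSubcategory⟩

/-- The identity of `M` factors through a projective `P`, and the map from `P` to `M` lifts along
`p`. -/
lemma exists_section_of_id_eq_zero {R : Type u} [Ring R] {M N : FGModuleCat.{u} R}
    (h : 𝟙 (StableCat.of M) = 0) (p : N ⟶ M) (hp : Function.Surjective p.hom.hom) :
    ∃ s : M ⟶ N, s ≫ p = 𝟙 M := by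
  rw [← StableCat.ofHom_id, StableCat.ofHom_eq_zero_iff] at h
  obtain ⟨P, hP, a, b, hab⟩ := h
  obtain ⟨b', hb'⟩ := Module.projective_lifting_property p.hom.hom b.hom.hom hp
  refine ⟨a ≫ FGModuleCat.ofHom b', ?_⟩
  rw [Category.assoc, ← hab]
  congr 1
  exact FGModuleCat.hom_ext hb'

lemma id_eq_zero_of_shortExact {R : Type u} [Ring R] {X P M : FGModuleCat.{u} R}
    [Module.Projective R P] {f : X ⟶ P} {g : P ⟶ M} (hs : ShortExact f g) (hX : 𝟙 X = 0) :
    𝟙 (StableCat.of M) = 0 := by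
  have hf : f = 0 := by rw [← Category.id_comp f, hX, Limits.zero_comp]
  have hinj : Function.Injective g.hom.hom := by
    rw [← LinearMap.ker_eq_bot, LinearMap.ker_eq_bot']
    intro x hx
    obtain ⟨y, rfl⟩ := (hs.exact x).1 hx
    rw [hf]
    rfl
  have : Module.Projective R M :=
    Module.Projective.of_equiv (LinearEquiv.ofBijective g.hom.hom ⟨hinj, hs.surjective⟩)
  rw [← StableCat.ofHom_id, StableCat.ofHom_eq_zero_iff, ← Category.comp_id (𝟙 M)]
  exact FactorsThroughProjective.of_projective _ _

/-- The simple module `S_v` is projective if and only if no arrow starts at `v`. -/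
theorem id_simpleObj_eq_zero_iff (v : Q.V) :
    𝟙 (simpleObj k Q v) = 0 ↔ ∀ x : Q.E, Q.s x ≠ v := by
  constructor
  · intro h x hx
    have h0 : 𝟙 (StableCat.of (simpleFG k Q v)) = 0 := congrArg (fun a => a.hom) h
    obtain ⟨s, hs⟩ := exists_section_of_id_eq_zero h0 _ (shortExact_simpleFG v).surjective
    -- A section of `A e_v ⟶ S_v` sends the generator to some `z` with `e_v`-coefficient `1`. An
    -- arrow `x` starting at `v` kills the generator, hence `z`, yet the coefficient of `x` in `x z`
    -- is `1`.
    let z : vertexIdeal (arrowIdeal k Q ^ 2) v := s.hom.hom (toSimple v 1)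
    have hz : quotChar (arrowIdeal k Q ^ 2) v z.1 = 1 := by
      have : (s ≫ presentation v (toSimple v 1 : simpleFG k Q v)).hom.hom (toSimple v 1) =
          toSimple v 1 := by rw [hs]; rfl
      change z.1 • toSimple v (1 : k) = toSimple v 1 at this
      rw [smul_toSimple, mul_one] at this
      exact this
    have h1 : arrowElt (arrowIdeal k Q ^ 2) x * z.1 = 0 := by
      have h2 : arrowElt (arrowIdeal k Q ^ 2) x • z = 0 := by
        change arrowElt (arrowIdeal k Q ^ 2) x • s.hom.hom (toSimple v 1) = 0
        rw [← map_smul, smul_toSimple, quotChar_arrowElt, zero_mul]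
        exact map_zero s.hom.hom
      exact congrArg Subtype.val h2
    have h3 := quotArrowCoeff_mul (arrowIdeal k Q ^ 2) x (arrowElt _ x) z.1
    rw [h1, map_zero, quotChar_arrowElt, zero_mul, zero_add, quotArrowCoeff_arrowElt_self, hx, hz,
      mul_one] at h3
    exact zero_ne_one h3
  · intro h
    refine ObjectProperty.hom_ext _ (id_eq_zero_of_shortExact (shortExact_simpleFG (k := k) v) ?_)
    have : IsEmpty (ArrowsFrom Q v) := ⟨fun x => h x.1 x.2⟩
    classical
    rw [← (simpleRelationSum (k := k) v).total]
    exact Fintype.sum_empty _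

end SimpleModules

/-! ### Subpaths and starting vertices -/

section Paths

variable {Q : FinQuiver.{u}}

lemma isPathFrom_of_append {v : Q.V} {m : List Q.E} : ∀ {l : List Q.E}, Q.IsPathFrom v (l ++ m) →
    Q.IsPathFrom v m ∧ Q.IsPathFrom (Q.endpoint v m) l
  | [], h => ⟨h, trivial⟩
  | _ :: l, h => by
    obtain ⟨h₁, h₂⟩ := isPathFrom_of_append h.2
    exact ⟨h₁, h.1.trans (Q.endpoint_append v l m), h₂⟩

/-- The first arrow traversed fixes the start; only trivial paths carry it as additional data. -/
lemma isPathFrom_source_unique {v w : Q.V} : ∀ {l : List Q.E}, l ≠ [] → Q.IsPathFrom v l →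
    Q.IsPathFrom w l → v = w
  | [], h, _, _ => absurd rfl h
  | [_], _, hv, hw => hv.1.symm.trans hw.1
  | _ :: b :: l, _, hv, hw => isPathFrom_source_unique (List.cons_ne_nil b l) hv.2 hw.2

end Paths

/-! ### Arrows of the relation quiver with a given start -/

section Relations

variable {k : Type u} [Field k] {Q : FinQuiver.{u}} {I : Ideal (PathAlgebra k Q)}

variable (I) in
/-- The arrows of the relation quiver that start at an arrow `a`. -/
def Relations (a : Q.E) : Type u := ArrowsFrom (relationQuiver I) a

instance (a : Q.E) : Fintype (Relations I a) := arrowsFromFintype (relationQuiver I) a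

/-- The end of an arrow of the relation quiver, as an arrow of the original quiver. -/
def relationEnd {a : Q.E} (x : Relations I a) : Q.E := x.1.1.1

lemma s_relationEnd {a : Q.E} (x : Relations I a) : Q.s (relationEnd x) = Q.t a := by
  obtain ⟨x, rfl⟩ := x
  exact x.2.1

lemma relationEnd_injective {a : Q.E} :
    Function.Injective (relationEnd : Relations I a → Q.E) :=
  fun x y h => Subtype.ext (Subtype.ext (Prod.ext h (x.2.trans y.2.symm)))

end Relations

/-! ### Quadratic monomial ideals: splitting elements by their starting arrow -/

section Monomial

variable {k : Type u} [Field k] {Q : FinQuiver.{u}} {I : Ideal (PathAlgebra k Q)}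

lemma path_mem_of_infix [I.IsTwoSided] {p q : Q.QPath} (hq : path k q ∈ I) (hl : q.arrows ≠ [])
    {l m : List Q.E} (h : p.arrows = l ++ q.arrows ++ m) : path k p ∈ I := by
  obtain ⟨v, a, hp⟩ := p
  obtain rfl : a = l ++ q.arrows ++ m := h
  obtain ⟨hm, hp'⟩ := isPathFrom_of_append hp
  obtain ⟨hq', hl'⟩ := isPathFrom_of_append hp'
  have hs : q.source = Q.endpoint v m := isPathFrom_source_unique hl q.isPathFrom hq'
  rw [← hs] at hl'
  have h1 : path k (⟨v, l ++ q.arrows ++ m, hp⟩ : Q.QPath) =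
      path k (⟨q.target, l, hl'⟩ : Q.QPath) * path k q * path k (⟨v, m, hm⟩ : Q.QPath) := by
    rw [path_mul_of_eq (p := ⟨q.target, l, hl'⟩) (q := q) rfl,
      path_mul_of_eq (p := QPath.comp ⟨q.target, l, hl'⟩ q rfl) (q := ⟨v, m, hm⟩) hs]
    rfl
  rw [h1]
  exact Ideal.mul_mem_right _ _ (Ideal.mul_mem_left _ _ hq)

variable [IsQuadraticMonomial I]

/-- A quadratic monomial ideal is spanned by the paths that contain a path of length two in it. -/
lemma mem_of_infix_mem (P : Submodule k (PathAlgebra k Q))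
    (h : ∀ (p q : Q.QPath) (l m : List Q.E), path k q ∈ I → q.length = 2 →
      p.arrows = l ++ q.arrows ++ m → path k p ∈ P) {f : PathAlgebra k Q} (hf : f ∈ I) :
    f ∈ P := by
  obtain ⟨G, hG, hI⟩ := IsQuadraticMonomial.exists_generators (I := I)
  rw [hI] at hf
  have hf : f ∈ TwoSidedIdeal.span (path k '' G) := hf
  rw [TwoSidedIdeal.mem_span_iff_mem_addSubgroup_closure] at hf
  refine AddSubgroup.closure_induction ?_ P.zero_mem (fun _ _ _ _ => P.add_mem)
    (fun _ _ => P.neg_mem) hf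
  rintro _ ⟨_, ⟨x, -, _, ⟨q, hq, rfl⟩, rfl⟩, y, -, rfl⟩
  have hqI : path k q ∈ I := hI ▸ subset_twoSidedSpan _ ⟨q, hq, rfl⟩
  refine mem_of_path_mem (P := P.comap (LinearMap.mulLeft k (x * path k q))) (f := y)
    fun r _ => ?_
  change x * path k q * path k r ∈ P
  rw [mul_assoc]
  refine mem_of_path_mem (P := P.comap (LinearMap.mulRight k (path k q * path k r))) (f := x)
    fun p _ => ?_
  change path k p * (path k q * path k r) ∈ P
  by_cases hqr : q.source = r.target
  · rw [path_mul_of_eq hqr]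
    by_cases hpq : p.source = (q.comp r hqr).target
    · rw [path_mul_of_eq hpq]
      exact h _ q p.arrows r.arrows hqI (hG q hq) (List.append_assoc _ _ _).symm
    · rw [path_mul_of_ne hpq]
      exact P.zero_mem
  · rw [path_mul_of_ne hqr, mul_zero]
    exact P.zero_mem

open Classical in
variable (k) in
/-- The projection of the path algebra to the span of the paths that start with an arrow. -/
def lastProj (c : Q.E) : PathAlgebra k Q →ₗ[k] PathAlgebra k Q :=
  Finsupp.linearCombination k fun p : Q.QPath =>
    if p.arrows.getLast? = some c then path k p else 0

open Classical in
lemma lastProj_path (c : Q.E) (p : Q.QPath) :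
    lastProj k c (path k p) = if p.arrows.getLast? = some c then path k p else 0 :=
  (Finsupp.linearCombination_single k (1 : k) p).trans (one_smul _ _)

open Classical in
variable (k) in
/-- The removal of an arrow `a` at the start of the paths that start with `a` followed by `c`. -/
def lastDrop (c a : Q.E) : PathAlgebra k Q →ₗ[k] PathAlgebra k Q :=
  Finsupp.linearCombination k fun p : Q.QPath =>
    if h : ∃ q : Q.QPath, q.arrows.getLast? = some c ∧
      ∃ hq : q.source = Q.t a, p = q.comp (arrowPath Q a) hq then path k h.choose else 0

lemma lastDrop_comp {c a : Q.E} {q : Q.QPath} (hc : q.arrows.getLast? = some c)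
    (hq : q.source = Q.t a) : lastDrop k c a (path k (q.comp (arrowPath Q a) hq)) = path k q := by
  refine (Finsupp.linearCombination_single k (1 : k) _).trans ((one_smul _ _).trans ?_)
  have h : ∃ q' : Q.QPath, q'.arrows.getLast? = some c ∧
      ∃ hq' : q'.source = Q.t a, q.comp (arrowPath Q a) hq = q'.comp (arrowPath Q a) hq' :=
    ⟨q, hc, hq, rfl⟩
  rw [dif_pos h]
  obtain ⟨-, hs, he⟩ := h.choose_spec
  exact congrArg _ (QPath.ext (hs.trans hq.symm)
    (List.append_cancel_right (congrArg QPath.arrows he)).symm)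

lemma lastDrop_of_not {c a : Q.E} {p : Q.QPath} (h : ¬∃ q : Q.QPath,
    q.arrows.getLast? = some c ∧ ∃ hq : q.source = Q.t a, p = q.comp (arrowPath Q a) hq) :
    lastDrop k c a (path k p) = 0 := by
  refine (Finsupp.linearCombination_single k (1 : k) _).trans ((one_smul _ _).trans ?_)
  rw [dif_neg h]

/-- Because `s(c) = t(a)`, multiplication by `a` kills no path starting with `c`, and erasing `a`
afterwards recovers exactly those paths. -/
lemma lastDrop_mul_path {c a : Q.E} (h : Q.s c = Q.t a) (f : PathAlgebra k Q) :
    lastDrop k c a (f * path k (arrowPath Q a)) = lastProj k c f := by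
  have key : lastDrop k c a ∘ₗ LinearMap.mulRight k (path k (arrowPath Q a)) = lastProj k c := by
    refine linearMap_ext fun p => ?_
    change lastDrop k c a (path k p * path k (arrowPath Q a)) = _
    by_cases hp : p.source = Q.t a
    · rw [path_mul_of_eq (q := arrowPath Q a) hp, lastProj_path]
      by_cases hc : p.arrows.getLast? = some c
      · rw [if_pos hc, lastDrop_comp hc]
      · rw [if_neg hc, lastDrop_of_not]
        rintro ⟨q, hq, hs, he⟩
        have : p.arrows = q.arrows := List.append_cancel_right (congrArg QPath.arrows he)
        exact hc (this ▸ hq)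
    · rw [path_mul_of_ne (q := arrowPath Q a) hp, lastProj_path, map_zero, if_neg]
      intro hc
      obtain ⟨v, l, hl⟩ := p
      obtain ⟨l, rfl⟩ := List.getLast?_eq_some_iff.1 hc
      exact hp ((isPathFrom_concat hl).2.symm.trans h)
  exact LinearMap.congr_fun key f

/-- `I` is spanned by paths, and `lastProj k c` keeps or kills each path. -/
lemma lastProj_mem (c : Q.E) {f : PathAlgebra k Q} (hf : f ∈ I) : lastProj k c f ∈ I := by
  refine mem_of_infix_mem (P := (I.restrictScalars k).comap (lastProj k c))
    (fun p q l m hq hl h => ?_) hf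
  change lastProj k c (path k p) ∈ I
  rw [lastProj_path]
  split_ifs
  · refine path_mem_of_infix hq (fun h0 => ?_) h
    rw [QPath.length, h0] at hl
    exact absurd hl (by simp)
  · exact I.zero_mem

/-- This is where generation in degree two enters. A path `r a` in the spanning set of `I` contains
a relation of length two; if `r` starts with `c`, the relation either is `ca`, which is excluded, or
lies inside `r`, so `r` is still in `I`. -/
lemma lastDrop_mem {c a : Q.E} (hca : ∀ h : Q.s c = Q.t a,
    path k ((arrowPath Q c).comp (arrowPath Q a) h) ∉ I) {f : PathAlgebra k Q} (hf : f ∈ I) :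
    lastDrop k c a f ∈ I := by
  refine mem_of_infix_mem (P := (I.restrictScalars k).comap (lastDrop k c a))
    (fun p q l m hq hl h => ?_) hf
  change lastDrop k c a (path k p) ∈ I
  have hq0 : q.arrows ≠ [] := fun h0 => by
    rw [QPath.length, h0] at hl
    exact absurd hl (by simp)
  by_cases hp : ∃ q : Q.QPath, q.arrows.getLast? = some c ∧
      ∃ hq : q.source = Q.t a, p = q.comp (arrowPath Q a) hq
  · obtain ⟨r, hr, hs, rfl⟩ := hp
    rw [lastDrop_comp hr]
    have h : r.arrows ++ [a] = l ++ q.arrows ++ m := h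
    rcases List.eq_nil_or_concat m with rfl | ⟨m, b, rfl⟩
    · exfalso
      obtain ⟨v, r, hr'⟩ := r
      obtain ⟨w, q, hq'⟩ := q
      obtain ⟨r, rfl⟩ := List.getLast?_eq_some_iff.1 hr
      obtain ⟨x, y, rfl⟩ := List.length_eq_two.1 hl
      have h : r ++ [c] ++ [a] = l ++ [x, y] ++ [] := h
      have h' : r ++ [c, a] = l ++ [x, y] := by simpa using h
      obtain ⟨-, h''⟩ := List.append_inj' h' rfl
      obtain ⟨rfl, rfl⟩ : c = x ∧ a = y := by simpa using h''
      have hw : w = Q.s a := hq'.2.1.symm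
      subst hw
      exact hca hq'.1 hq
    · rw [List.concat_eq_append, ← List.append_assoc] at h
      exact path_mem_of_infix hq hq0 (List.append_inj' h rfl).1
  · rw [lastDrop_of_not hp]
    exact I.zero_mem

variable (I) in
/-- The projection to the span of the paths that start with an arrow, on the quotient by a
quadratic monomial ideal. -/
def arrowProj (c : Q.E) : (PathAlgebra k Q ⧸ I) →ₗ[k] (PathAlgebra k Q ⧸ I) :=
  Submodule.mapQ (I.restrictScalars k) (I.restrictScalars k) (lastProj k c)
    fun _ hf => lastProj_mem c hf

lemma arrowProj_mk (c : Q.E) (f : PathAlgebra k Q) :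
    arrowProj I c (Ideal.Quotient.mk I f) = Ideal.Quotient.mk I (lastProj k c f) := rfl

lemma lastProj_mul_path_self (c : Q.E) (f : PathAlgebra k Q) :
    lastProj k c (f * path k (arrowPath Q c)) = f * path k (arrowPath Q c) := by
  have key : lastProj k c ∘ₗ LinearMap.mulRight k (path k (arrowPath Q c)) =
      LinearMap.mulRight k (path k (arrowPath Q c)) := by
    refine linearMap_ext fun p => ?_
    change lastProj k c (path k p * path k (arrowPath Q c)) = path k p * path k (arrowPath Q c)
    by_cases hp : p.source = Q.t c
    · rw [path_mul_of_eq (q := arrowPath Q c) hp, lastProj_path, if_pos]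
      exact List.getLast?_concat
    · rw [path_mul_of_ne (q := arrowPath Q c) hp, map_zero]
  exact LinearMap.congr_fun key f

lemma lastProj_mul_path_ne {c b : Q.E} (h : c ≠ b) (f : PathAlgebra k Q) :
    lastProj k c (f * path k (arrowPath Q b)) = 0 := by
  have key : lastProj k c ∘ₗ LinearMap.mulRight k (path k (arrowPath Q b)) = 0 := by
    refine linearMap_ext fun p => ?_
    change lastProj k c (path k p * path k (arrowPath Q b)) = 0
    by_cases hp : p.source = Q.t b
    · rw [path_mul_of_eq (q := arrowPath Q b) hp, lastProj_path, if_neg]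
      intro hc
      have : some b = some c := (List.getLast?_concat (l := p.arrows)).symm.trans hc
      exact h (Option.some.inj this).symm
    · rw [path_mul_of_ne (q := arrowPath Q b) hp, map_zero]
  exact LinearMap.congr_fun key f

lemma arrowProj_mul_arrowElt_self (c : Q.E) (x : PathAlgebra k Q ⧸ I) :
    arrowProj I c (x * arrowElt I c) = x * arrowElt I c := by
  obtain ⟨f, rfl⟩ := Ideal.Quotient.mk_surjective x
  rw [arrowElt, ← map_mul, arrowProj_mk, lastProj_mul_path_self]

lemma arrowProj_mul_arrowElt_ne {c b : Q.E} (h : c ≠ b) (x : PathAlgebra k Q ⧸ I) :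
    arrowProj I c (x * arrowElt I b) = 0 := by
  obtain ⟨f, rfl⟩ := Ideal.Quotient.mk_surjective x
  rw [arrowElt, ← map_mul, arrowProj_mk, lastProj_mul_path_ne h, map_zero]

lemma arrowSpan_induction {P : (PathAlgebra k Q ⧸ I) → Prop} (zero : P 0)
    (add : ∀ x y, P x → P y → P (x + y)) (mul : ∀ x a, P (x * arrowElt I a))
    {y : PathAlgebra k Q ⧸ I} (hy : y ∈ arrowSpan I) : P y := by
  refine Submodule.closure_induction (p := fun y _ => P y) zero (fun x y _ _ => add x y) ?_ hy
  rintro x _ ⟨a, rfl⟩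
  exact mul x a

/-- Left multiplication does not change the starting arrow of a nontrivial path. Trivial paths must
be excluded, since multiplying them by an arrow creates a starting arrow. -/
lemma arrowProj_mul (c : Q.E) (x : PathAlgebra k Q ⧸ I) {y : PathAlgebra k Q ⧸ I}
    (hy : y ∈ arrowSpan I) : arrowProj I c (x * y) = x * arrowProj I c y := by
  refine arrowSpan_induction (P := fun y => arrowProj I c (x * y) = x * arrowProj I c y)
    ?_ (fun y z hy hz => ?_) (fun y a => ?_) hy
  · rw [mul_zero, map_zero, mul_zero]
  · rw [mul_add, map_add, hy, hz, map_add, mul_add]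
  · rw [← mul_assoc]
    by_cases h : c = a
    · subst h
      rw [arrowProj_mul_arrowElt_self, arrowProj_mul_arrowElt_self, mul_assoc]
    · rw [arrowProj_mul_arrowElt_ne h, arrowProj_mul_arrowElt_ne h, mul_zero]

/-- Every nontrivial path has exactly one starting arrow; so `arrowSpan I` is the direct sum of the
left ideals `Aα`. -/
lemma sum_arrowProj {y : PathAlgebra k Q ⧸ I} (hy : y ∈ arrowSpan I) :
    ∑ c, arrowProj I c y = y := by
  refine arrowSpan_induction (P := fun y => ∑ c, arrowProj I c y = y)
    ?_ (fun y z hy hz => ?_) (fun y a => ?_) hy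
  · exact Finset.sum_eq_zero fun c _ => map_zero _
  · exact (Finset.sum_congr rfl fun c _ => map_add _ _ _).trans
      (Finset.sum_add_distrib.trans (congrArg₂ _ hy hz))
  · rw [Finset.sum_eq_single a]
    · exact arrowProj_mul_arrowElt_self a y
    · exact fun c _ h => arrowProj_mul_arrowElt_ne h y
    · exact fun h => absurd (Finset.mem_univ _) h

variable (I) in
/-- The left ideal generated by an arrow. -/
abbrev arrowLeftIdeal (a : Q.E) : Ideal (PathAlgebra k Q ⧸ I) := Ideal.span {arrowElt I a}

lemma arrowProj_mem (c : Q.E) {y : PathAlgebra k Q ⧸ I} (hy : y ∈ arrowSpan I) :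
    arrowProj I c y ∈ arrowLeftIdeal I c := by
  refine arrowSpan_induction (P := fun y => arrowProj I c y ∈ arrowLeftIdeal I c)
    ?_ (fun y z hy hz => ?_) (fun y a => ?_) hy
  · rw [map_zero]
    exact Ideal.zero_mem _
  · rw [map_add]
    exact Ideal.add_mem _ hy hz
  · by_cases h : c = a
    · subst h
      rw [arrowProj_mul_arrowElt_self]
      exact Ideal.mem_span_singleton'.2 ⟨y, rfl⟩
    · rw [arrowProj_mul_arrowElt_ne h]
      exact Ideal.zero_mem _

lemma arrowProj_of_mem {c : Q.E} {y : PathAlgebra k Q ⧸ I} (hy : y ∈ arrowLeftIdeal I c) :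
    arrowProj I c y = y := by
  obtain ⟨x, rfl⟩ := Ideal.mem_span_singleton'.1 hy
  exact arrowProj_mul_arrowElt_self c x

lemma arrowProj_of_mem_ne {c b : Q.E} (h : c ≠ b) {y : PathAlgebra k Q ⧸ I}
    (hy : y ∈ arrowLeftIdeal I b) : arrowProj I c y = 0 := by
  obtain ⟨x, rfl⟩ := Ideal.mem_span_singleton'.1 hy
  exact arrowProj_mul_arrowElt_ne h x

lemma arrowProj_mul_vertexElt_self {c : Q.E} {y : PathAlgebra k Q ⧸ I} (hy : y ∈ arrowSpan I) :
    arrowProj I c (y * vertexElt I (Q.s c)) = arrowProj I c y := by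
  refine arrowSpan_induction
    (P := fun y => arrowProj I c (y * vertexElt I (Q.s c)) = arrowProj I c y)
    ?_ (fun y z hy hz => ?_) (fun y a => ?_) hy
  · rw [zero_mul]
  · rw [add_mul, map_add, hy, hz, map_add]
  · rw [mul_assoc]
    by_cases h : Q.s a = Q.s c
    · rw [← h, arrowElt_mul_vertexElt]
    · rw [arrowElt_mul_vertexElt_of_ne I h, mul_zero, map_zero,
        arrowProj_mul_arrowElt_ne fun h' => h (congrArg Q.s h'.symm)]

lemma arrowProj_mul_vertexElt_of_ne {c : Q.E} {v : Q.V} (h : Q.s c ≠ v)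
    {y : PathAlgebra k Q ⧸ I} (hy : y ∈ arrowSpan I) :
    arrowProj I c (y * vertexElt I v) = 0 := by
  refine arrowSpan_induction (P := fun y => arrowProj I c (y * vertexElt I v) = 0)
    ?_ (fun y z hy hz => ?_) (fun y a => ?_) hy
  · rw [zero_mul, map_zero]
  · rw [add_mul, map_add, hy, hz, add_zero]
  · rw [mul_assoc]
    by_cases ha : Q.s a = v
    · rw [← ha, arrowElt_mul_vertexElt,
        arrowProj_mul_arrowElt_ne fun h' => h ((congrArg Q.s h').trans ha)]
    · rw [arrowElt_mul_vertexElt_of_ne I ha, mul_zero, map_zero]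

/-- An element annihilated by an arrow `a` has no terms that start with an arrow `c`, unless `ca`
is a relation. -/
lemma arrowProj_eq_zero_of_mul_arrowElt {c a : Q.E} (hca : ¬∃ h : Q.s c = Q.t a,
    path k ((arrowPath Q c).comp (arrowPath Q a) h) ∈ I) {x : PathAlgebra k Q ⧸ I}
    (hv : x * vertexElt I (Q.t a) = x) (hx : x ∈ arrowSpan I) (h : x * arrowElt I a = 0) :
    arrowProj I c x = 0 := by
  by_cases hs : Q.s c = Q.t a
  · obtain ⟨f, rfl⟩ := Ideal.Quotient.mk_surjective x
    rw [arrowElt, ← map_mul] at h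
    -- A representative `f` satisfies `f a ∈ I`; erasing `a` stays in `I` and leaves the part of `f`
    -- that starts with `c`.
    rw [arrowProj_mk, ← lastDrop_mul_path hs]
    exact Ideal.Quotient.eq_zero_iff_mem.2
      (lastDrop_mem (fun h h' => hca ⟨h, h'⟩) (Ideal.Quotient.eq_zero_iff_mem.1 h))
  · rw [← hv]
    exact arrowProj_mul_vertexElt_of_ne hs hx

lemma relationEnd_mul {a : Q.E} (x : Relations I a) :
    arrowElt I (relationEnd x) * arrowElt I a = 0 := by
  obtain ⟨x, rfl⟩ := x
  obtain ⟨h, hI⟩ := x.2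
  change arrowElt I x.1.1 * arrowElt I x.1.2 = 0
  rw [arrowElt, arrowElt, ← map_mul, path_mul_of_eq (p := arrowPath Q x.1.1)
    (q := arrowPath Q x.1.2) h]
  exact Ideal.Quotient.eq_zero_iff_mem.2 hI

end Monomial

/-! ### The left ideals `Aα`: syzygies and the maps between them -/

section ArrowModules

variable {k : Type u} [Field k] {Q : FinQuiver.{u}} {I : Ideal (PathAlgebra k Q)}
  [IsQuadraticMonomial I]

variable (I) in
/-- The left ideal `Aα`, as a finitely generated module. -/
abbrev arrowModule (a : Q.E) : FGModuleCat.{u} (PathAlgebra k Q ⧸ I) :=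
  FGModuleCat.of _ (arrowLeftIdeal I a)

/-- A left ideal in the span of the arrows is a direct sum of left ideals `Aα`, if it contains the
starting arrows of all of its elements. -/
def arrowFamilySum {K : Ideal (PathAlgebra k Q ⧸ I)} (hK : K ≤ arrowSpan I) {J : Type*}
    [Fintype J] {γ : J → Q.E} (hγ : Function.Injective γ) (hmem : ∀ j, arrowElt I (γ j) ∈ K)
    (hproj : ∀ x ∈ K, ∀ c, c ∉ Set.range γ → arrowProj I c x = 0) :
    FamilySum (fun j => arrowModule I (γ j)) (FGModuleCat.of (PathAlgebra k Q ⧸ I) K) where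
  ι j := FGModuleCat.ofHom (Submodule.inclusion
    ((Ideal.span_singleton_le_iff_mem _).2 (hmem j) : arrowLeftIdeal I (γ j) ≤ K))
  π j := FGModuleCat.ofHom
    { toFun := fun y => ⟨arrowProj I (γ j) y.1, arrowProj_mem _ (hK y.2)⟩
      map_add' := fun y z => Subtype.ext (map_add (arrowProj I (γ j)) y.1 z.1)
      map_smul' := fun x y => Subtype.ext (arrowProj_mul (γ j) x (hK y.2)) }
  ι_π_self j := FGModuleCat.hom_ext (LinearMap.ext fun y => Subtype.ext (arrowProj_of_mem y.2))
  ι_π_ne {j l} h := FGModuleCat.hom_ext (LinearMap.ext fun y =>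
    Subtype.ext (arrowProj_of_mem_ne (fun h' => h (hγ h'.symm)) y.2))
  total := by
    classical
    refine FGModuleCat.hom_ext (LinearMap.ext fun y => ?_)
    refine (FGModuleCat_sum_apply _ _ _).trans (Subtype.ext ?_)
    refine (AddSubmonoidClass.coe_finsetSum (S := K) _ _).trans ?_
    change ∑ j, arrowProj I (γ j) y.1 = y.1
    refine Eq.trans ?_ (sum_arrowProj (hK y.2))
    rw [← Finset.sum_image (s := Finset.univ) (g := γ) (f := fun c => arrowProj I c y.1)
      (fun _ _ _ _ h => hγ h)]
    refine Finset.sum_subset (Finset.subset_univ _) fun c _ hc => hproj _ y.2 c fun ⟨j, hj⟩ =>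
      hc (Finset.mem_image.2 ⟨j, Finset.mem_univ j, hj⟩)

variable (I) in
/-- The generator of `Aα`. -/
def arrowGen (a : Q.E) : arrowModule I a := ⟨arrowElt I a, Ideal.mem_span_singleton_self _⟩

lemma shortExact_arrowModule (a : Q.E) :
    ShortExact (relationι (Q.t a) (arrowGen I a)) (presentation (Q.t a) (arrowGen I a)) :=
  shortExact_presentation (Subtype.ext (vertexElt_mul_arrowElt I a)) fun y => by
    obtain ⟨x, hx⟩ := Ideal.mem_span_singleton'.1 y.2
    exact ⟨x, Subtype.ext hx⟩

lemma mem_arrowRelation {a : Q.E} {x : PathAlgebra k Q ⧸ I} :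
    x ∈ relationIdeal (Q.t a) (arrowGen I a) ↔
      x * vertexElt I (Q.t a) = x ∧ x * arrowElt I a = 0 := by
  rw [mem_relationIdeal]
  exact and_congr_right fun _ => Subtype.ext_iff

/-- The coefficient of `a` in `x a` is the coefficient of `e_{t(a)}` in `x`, so the latter vanishes
when `x a = 0`. -/
lemma arrowRelation_le (a : Q.E) : relationIdeal (Q.t a) (arrowGen I a) ≤ arrowSpan I := by
  intro x hx
  obtain ⟨h₁, h₂⟩ := mem_arrowRelation.1 hx
  refine mem_arrowSpan_of_mem_vertexIdeal (mem_vertexIdeal.2 h₁) ?_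
  have := quotArrowCoeff_mul I a x (arrowElt I a)
  rw [h₂, map_zero, quotArrowCoeff_arrowElt_self, quotChar_arrowElt, mul_zero, add_zero,
    mul_one] at this
  exact this.symm

/-- The relations of `Aα` are the direct sum of the left ideals `Aβ` with `βα` in `I`. -/
def arrowRelationSum (a : Q.E) :
    FamilySum (fun x : Relations I a => arrowModule I (relationEnd x))
      (relationModule (Q.t a) (arrowGen I a)) :=
  arrowFamilySum (arrowRelation_le a) relationEnd_injective
    (fun x => mem_arrowRelation.2
      ⟨by rw [← s_relationEnd x, arrowElt_mul_vertexElt], relationEnd_mul x⟩)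
    (fun x hx c hc => by
      obtain ⟨h₁, h₂⟩ := mem_arrowRelation.1 hx
      refine arrowProj_eq_zero_of_mul_arrowElt (fun h => hc ?_) h₁ (arrowRelation_le a hx) h₂
      exact ⟨⟨⟨(c, a), h⟩, rfl⟩, rfl⟩)

/-- The module `Aα` is projective if and only if no arrow of the relation quiver starts at `α`. -/
theorem id_arrowObj_eq_zero_iff (a : Q.E) :
    𝟙 (arrowObj I a) = 0 ↔ ∀ x : (relationQuiver I).E, (relationQuiver I).s x ≠ a := by
  constructor
  · intro h x hx
    have h : 𝟙 (StableCat.of (arrowModule I a)) = 0 := h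
    obtain ⟨s, hs⟩ := exists_section_of_id_eq_zero h _ (shortExact_arrowModule a).surjective
    -- A section of `A e_{t(a)} ⟶ Aa` gives `z` with `z a = a`, hence with `e_{t(a)}`-coefficient
    -- `1`. A relation `b a = 0` forces `b z = 0`, although `b` occurs in `b z` with coefficient
    -- `1`.
    let z : vertexIdeal I (Q.t a) := s.hom.hom (arrowGen I a)
    have hz : z.1 * arrowElt I a = arrowElt I a := by
      have : (s ≫ presentation (Q.t a) (arrowGen I a)).hom.hom (arrowGen I a) =
          arrowGen I a := by rw [hs]; rfl
      exact congrArg Subtype.val this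
    let b : Q.E := relationEnd (⟨x, hx⟩ : Relations I a)
    have h₁ : arrowElt I b * z.1 = 0 := by
      have h₂ : arrowElt I b • z = 0 := by
        change arrowElt I b • s.hom.hom (arrowGen I a) = 0
        rw [← map_smul, show arrowElt I b • arrowGen I a = 0 from
          Subtype.ext (relationEnd_mul (⟨x, hx⟩ : Relations I a))]
        exact map_zero s.hom.hom
      exact congrArg Subtype.val h₂
    have hχ : quotChar I (Q.t a) z.1 = 1 := by
      have := quotArrowCoeff_mul I a z.1 (arrowElt I a)
      rw [hz, quotArrowCoeff_arrowElt_self, quotChar_arrowElt, mul_zero, add_zero, mul_one] at this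
      exact this.symm
    have h₃ := quotArrowCoeff_mul I b (arrowElt I b) z.1
    rw [h₁, map_zero, quotChar_arrowElt, zero_mul, zero_add, quotArrowCoeff_arrowElt_self, one_mul,
      s_relationEnd (⟨x, hx⟩ : Relations I a), hχ] at h₃
    exact zero_ne_one h₃
  · intro h
    refine id_eq_zero_of_shortExact (shortExact_arrowModule a) ?_
    have : IsEmpty (Relations I a) := ⟨fun x => h x.1 x.2⟩
    rw [← (arrowRelationSum (I := I) a).total]
    exact Fintype.sum_empty _

/-- A morphism `Aα ⟶ Aβ` lifts to presentations. -/
lemma exists_presentation_map {a b : Q.E} (g : arrowModule I a ⟶ arrowModule I b) :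
    ∃ w : PathAlgebra k Q ⧸ I, w * vertexElt I (Q.t b) = w ∧
    ∃ (u : relationModule (Q.t a) (arrowGen I a) ⟶ relationModule (Q.t b) (arrowGen I b))
      (v : vertexModule I (Q.t a) ⟶ vertexModule I (Q.t b)),
      relationι (Q.t a) (arrowGen I a) ≫ v = u ≫ relationι (Q.t b) (arrowGen I b) ∧
      presentation (Q.t a) (arrowGen I a) ≫ g = v ≫ presentation (Q.t b) (arrowGen I b) ∧
      ∀ x, (u.hom.hom x).1 = x.1 * w := by
  -- `g` sends the generator `a` to `w b`, so right multiplication by `w e_{t(b)}` lifts it to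
  -- presentations.
  obtain ⟨w, hw⟩ := Ideal.mem_span_singleton'.1 (g.hom.hom (arrowGen I a)).2
  let v : vertexIdeal I (Q.t a) →ₗ[PathAlgebra k Q ⧸ I] vertexIdeal I (Q.t b) :=
    ((LinearMap.toSpanSingleton (PathAlgebra k Q ⧸ I) (PathAlgebra k Q ⧸ I)
      (w * vertexElt I (Q.t b))).domRestrict _).codRestrict _ fun x => by
        rw [mem_vertexIdeal, LinearMap.domRestrict_apply, LinearMap.toSpanSingleton_apply,
          smul_eq_mul, mul_assoc, mul_assoc w, vertexElt_mul_self]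
  have hv : presentation (Q.t a) (arrowGen I a) ≫ g =
      FGModuleCat.ofHom v ≫ presentation (Q.t b) (arrowGen I b) := by
    refine FGModuleCat.hom_ext (LinearMap.ext fun x => Subtype.ext ?_)
    change (g.hom.hom (x.1 • arrowGen I a)).1 = x.1 * (w * vertexElt I (Q.t b)) * arrowElt I b
    rw [map_smul, mul_assoc, mul_assoc, vertexElt_mul_arrowElt, hw]
    rfl
  obtain ⟨u, hu⟩ := (shortExact_arrowModule b).exists_factor (relationι _ _ ≫ FGModuleCat.ofHom v)
    (by rw [Category.assoc, ← hv, ← Category.assoc, (shortExact_arrowModule a).comp,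
      Limits.zero_comp])
  refine ⟨w * vertexElt I (Q.t b), by rw [mul_assoc, vertexElt_mul_self], u, FGModuleCat.ofHom v,
    hu.symm, hv, fun x => ?_⟩
  exact congrArg (fun f : relationModule (Q.t a) (arrowGen I a) ⟶ vertexModule I (Q.t b) =>
    (f.hom.hom x).1) hu

/-- The components of the maps induced on relations are scalar in the stable category. -/
lemma exists_component_eq_scalarHom {a b : Q.E} {w : PathAlgebra k Q ⧸ I}
    (hw : w * vertexElt I (Q.t b) = w)
    (u : relationModule (Q.t a) (arrowGen I a) ⟶ relationModule (Q.t b) (arrowGen I b))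
    (hu : ∀ x, (u.hom.hom x).1 = x.1 * w)
    (x : Relations I a) (y : Relations I b) :
    ∃ c : k, StableCat.ofHom ((arrowRelationSum a).ι x ≫ u ≫ (arrowRelationSum b).π y) =
      scalarHom (arrowObj I) c (relationEnd x) (relationEnd y) := by
  set c := quotChar I (Q.t b) w with hc
  have hw' : w - c • vertexElt I (Q.t b) ∈ arrowSpan I := by
    have := mul_vertexElt_sub_mem w (Q.t b)
    rwa [hw] at this
  -- The part of `w` in the span of the arrows contributes to this component only `z ↦ z d`, which
  -- extends to the free module `A` and so is stably zero.
  set d := arrowProj I (relationEnd y) (w - c • vertexElt I (Q.t b)) with hd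
  let f : arrowModule I (relationEnd x) ⟶ FGModuleCat.of _ (PathAlgebra k Q ⧸ I) :=
    FGModuleCat.ofHom (arrowLeftIdeal I (relationEnd x)).subtype
  let g : FGModuleCat.of _ (PathAlgebra k Q ⧸ I) ⟶ arrowModule I (relationEnd y) :=
    FGModuleCat.ofHom (LinearMap.toSpanSingleton _ _ ⟨d, arrowProj_mem _ hw'⟩)
  have hfg : StableCat.ofHom (f ≫ g) = 0 := by
    rw [StableCat.ofHom_eq_zero_iff]
    have : Module.Projective (PathAlgebra k Q ⧸ I)
      (FGModuleCat.of (PathAlgebra k Q ⧸ I) (PathAlgebra k Q ⧸ I)) :=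
      inferInstanceAs (Module.Projective (PathAlgebra k Q ⧸ I) (PathAlgebra k Q ⧸ I))
    exact FactorsThroughProjective.of_projective f g
  have key : ∀ z : arrowLeftIdeal I (relationEnd x),
      (((arrowRelationSum a).ι x ≫ u ≫ (arrowRelationSum b).π y).hom.hom z).1 =
        c • arrowProj I (relationEnd y) (z.1 * vertexElt I (Q.t b)) + z.1 * d := by
    intro z
    have h₁ : (((arrowRelationSum a).ι x ≫ u ≫ (arrowRelationSum b).π y).hom.hom z).1 =
        arrowProj I (relationEnd y) (z.1 * w) := congrArg (arrowProj I (relationEnd y)) (hu _)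
    rw [h₁, hd, ← arrowProj_mul _ _ hw', mul_sub, map_sub, mul_smul_comm, map_smul,
      add_sub_cancel]
  have hz : ∀ z : arrowLeftIdeal I (relationEnd x),
      arrowProj I (relationEnd y) (z.1 * vertexElt I (Q.t b)) =
        arrowProj I (relationEnd y) z.1 := by
    intro z
    obtain ⟨z₀, hz₀⟩ := Ideal.mem_span_singleton'.1 z.2
    rw [← s_relationEnd y, arrowProj_mul_vertexElt_self]
    rw [← hz₀]
    exact Ideal.mul_mem_left _ _ (Ideal.subset_span ⟨_, rfl⟩)
  -- What remains is `c` times the projection of one summand onto another, which is `c` if the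
  -- arrows agree and zero otherwise.
  by_cases h : relationEnd x = relationEnd y
  · refine ⟨c, ?_⟩
    have h₂ : ∀ {e : Q.E} (h : relationEnd x = e) (g : arrowModule I (relationEnd x) ⟶
        arrowModule I e), (∀ z, (g.hom.hom z).1 = c • z.1) →
        StableCat.ofHom g = scalarHom (arrowObj I) c (relationEnd x) e := by
      rintro _ rfl g hg
      rw [scalarHom_self]
      refine Eq.trans (congrArg _ ?_) (StableCat.ofHom_smul c (𝟙 (arrowModule I (relationEnd x))))
      refine FGModuleCat.hom_ext (LinearMap.ext fun z => Subtype.ext ((hg z).trans ?_))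
      exact Algebra.smul_def c z.1
    rw [← h₂ h (((arrowRelationSum a).ι x ≫ u ≫ (arrowRelationSum b).π y) - f ≫ g) ?_]
    · rw [sub_eq_add_neg, StableCat.ofHom_add, StableCat.ofHom_neg, hfg, neg_zero, add_zero]
    · intro z
      change (((arrowRelationSum a).ι x ≫ u ≫ (arrowRelationSum b).π y).hom.hom z).1 -
        z.1 * d = c • z.1
      rw [key, hz, ← h, arrowProj_of_mem z.2, add_sub_cancel_right]
  · refine ⟨0, ?_⟩
    refine ((congrArg StableCat.ofHom (FGModuleCat.hom_ext (LinearMap.ext fun z =>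
      Subtype.ext ?_))).trans hfg).trans (scalarHom_ne (arrowObj I) (0 : k) h).symm
    rw [key, hz, arrowProj_of_mem_ne (Ne.symm h) z.2, smul_zero, zero_add]
    rfl

variable (I) in
/-- The syzygy of `Aα` is the direct sum of the left ideals `Aβ` with `βα` in `I`, in such a way
that the components of all maps between syzygies of these modules are scalar. -/
theorem exists_familySum_syzygy_arrowObj :
    ∃ D : ∀ a : Q.E, FamilySum (fun x : Relations I a => arrowObj I (relationEnd x))
      ((syzygyFunctor (PathAlgebra k Q ⧸ I)).obj (arrowObj I a)),
    ∀ (a b : Q.E) (g : arrowObj I a ⟶ arrowObj I b) (x : Relations I a) (y : Relations I b),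
      ∃ c : k, (D a).ι x ≫ (syzygyFunctor (PathAlgebra k Q ⧸ I)).map g ≫ (D b).π y =
        scalarHom (arrowObj I) c (relationEnd x) (relationEnd y) := by
  choose h hh using fun a : Q.E => (shortExact_arrowModule (I := I) a).exists_isConnecting
  choose e he using fun a : Q.E => (shortExact_arrowModule (I := I) a).exists_connecting_iso (hh a)
  refine ⟨fun a => ((arrowRelationSum a).map
    (CategoryTheory.Quotient.functor (stableRel (PathAlgebra k Q ⧸ I)))).ofIso (e a).symm,
    fun a b g x y => ?_⟩
  obtain ⟨g₀, rfl⟩ := StableCat.exists_ofHom (M := arrowModule I a) (N := arrowModule I b) g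
  obtain ⟨w, hw, u, v, hu, hv, huw⟩ := exists_presentation_map g₀
  have hnat := (shortExact_arrowModule b).connecting_naturality (hh a) (hh b) u v g₀ hu hv
  rw [← he a, ← he b] at hnat
  have hΩ : (syzygyFunctor (PathAlgebra k Q ⧸ I)).map (StableCat.ofHom g₀) =
      (e a).hom ≫ StableCat.ofHom u ≫ (e b).inv :=
    ((Iso.eq_comp_inv (e b)).2 hnat.symm).trans (Category.assoc _ _ _)
  obtain ⟨c, hc⟩ := exists_component_eq_scalarHom hw u huw x y
  refine ⟨c, Eq.trans ?_ hc⟩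
  rw [StableCat.ofHom_comp, StableCat.ofHom_comp]
  change (StableCat.ofHom ((arrowRelationSum a).ι x) ≫ (e a).inv) ≫
    (syzygyFunctor (PathAlgebra k Q ⧸ I)).map (StableCat.ofHom g₀) ≫
    (e b).hom ≫ StableCat.ofHom ((arrowRelationSum b).π y) = _
  rw [hΩ]
  simp only [Category.assoc, Iso.inv_hom_id_assoc]

/-- The syzygy of a simple module is a direct sum of left ideals `Aα`. -/
theorem exists_familySum_syzygy_of_isSimpleModule (M : FGModuleCat.{u} (PathAlgebra k Q ⧸ I))
    [IsSimpleModule (PathAlgebra k Q ⧸ I) M] :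
    ∃ v : Q.V, Nonempty (FamilySum (fun a : ArrowsFrom Q v => arrowObj I a.1)
      ((syzygyFunctor (PathAlgebra k Q ⧸ I)).obj (StableCat.of M))) := by
  obtain ⟨v, t, ht, hx⟩ := exists_smul_eq_quotChar_smul (I := I) M
  have hs : ShortExact (relationι v t) (presentation v t) :=
    shortExact_presentation (by rw [hx, quotChar_vertexElt_self, map_one, one_smul])
      (LinearMap.surjective_of_ne_zero
        (f := LinearMap.toSpanSingleton (PathAlgebra k Q ⧸ I) M t) fun h0 => ht (by
          have := LinearMap.congr_fun h0 1
          rwa [LinearMap.toSpanSingleton_apply, one_smul] at this))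
  -- `A` acts on `t` by a character, so the kernel of `A e_v ⟶ M` consists of the elements of `A
  -- e_v` without `e_v`-term; it is the sum of all `Aα` with `s(α) = v`.
  have hmem : ∀ x : PathAlgebra k Q ⧸ I, x ∈ relationIdeal v t ↔
      x * vertexElt I v = x ∧ quotChar I v x = 0 := by
    intro x
    rw [mem_relationIdeal, hx]
    refine and_congr_right fun _ => ⟨fun h => ?_, fun h => by rw [h, map_zero, zero_smul]⟩
    by_contra hne
    refine ht ?_
    rw [← one_smul (PathAlgebra k Q ⧸ I) t, ← map_one (algebraMap k (PathAlgebra k Q ⧸ I)),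
      ← inv_mul_cancel₀ hne, map_mul, mul_smul, h, smul_zero]
  have hle : relationIdeal v t ≤ arrowSpan I := fun x hx => by
    obtain ⟨h₁, h₂⟩ := (hmem x).1 hx
    exact mem_arrowSpan_of_mem_vertexIdeal (mem_vertexIdeal.2 h₁) h₂
  have D : FamilySum (fun a : ArrowsFrom Q v => arrowModule I a.1) (relationModule v t) :=
    arrowFamilySum hle Subtype.val_injective
      (fun a => (hmem _).2 ⟨by obtain ⟨a, rfl⟩ := a; exact arrowElt_mul_vertexElt I a,
        quotChar_arrowElt I v a.1⟩)
      (fun x hx c hc => by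
        rw [← ((hmem x).1 hx).1]
        exact arrowProj_mul_vertexElt_of_ne (fun h => hc ⟨⟨c, h⟩, rfl⟩) (hle hx))
  obtain ⟨h, hh⟩ := hs.exists_isConnecting
  obtain ⟨e, -⟩ := hs.exists_connecting_iso hh
  exact ⟨v, ⟨(D.map (CategoryTheory.Quotient.functor
    (stableRel (PathAlgebra k Q ⧸ I)))).ofIso e.symm⟩⟩

end ArrowModules

/-! ### Comparing loop functors through matching decompositions -/

section LoopedSums

universe v₁ v₂ u₁ u₂ w w'

variable {C : Type u₁} [Category.{v₁} C] [Preadditive C] {D : Type u₂} [Category.{v₂} D]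
  [Preadditive D]

/-- Direct sums do not depend on the index set. -/
def FamilySum.reindex {J : Type*} {J' : Type*} [Fintype J] [Fintype J'] {S : J → C} {X : C}
    (s : FamilySum S X) (e : J' ≃ J) : FamilySum (fun j => S (e j)) X where
  ι j := s.ι (e j)
  π j := s.π (e j)
  ι_π_self j := s.ι_π_self (e j)
  ι_π_ne h := s.ι_π_ne fun h' => h (e.injective h')
  total := (e.sum_comp fun j => s.π j ≫ s.ι j).trans s.total

lemma FamilySum.eq_sum {J : Type*} {J' : Type*} [Fintype J] [Fintype J'] {S : J → C}
    {S' : J' → C} {X Y : C} (s : FamilySum S X) (t : FamilySum S' Y) (g : X ⟶ Y) :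
    g = ∑ i, ∑ j, s.π i ≫ (s.ι i ≫ g ≫ t.π j) ≫ t.ι j := by
  refine s.ext_from fun i => t.ext_to fun j => ?_
  simp only [← Preadditive.comp_sum]
  rw [s.ι_sum, t.sum_π, Category.assoc]

variable {Ω : C ⥤ C} {Δ : D ⥤ D} [Δ.Additive] {F : C ⥤ D} [F.Additive]
  {ι : Type w} {S : ι → C}

/-- Looped morphisms lift along a looped functor, if they do between the objects of a generating
family. -/
theorem exists_loop_lift_of_generators
    (hC : ∀ X : C, ∃ (n : ℕ) (a : Fin n → ι), Nonempty (FamilySum (fun j => S (a j)) X))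
    (δ : Ω ⋙ F ≅ F ⋙ Δ)
    (h : ∀ (a b : ι) (g : F.obj (S a) ⟶ F.obj (S b)), ∃ f : Ω.obj (S a) ⟶ Ω.obj (S b),
      Δ.map g = δ.inv.app (S a) ≫ F.map f ≫ δ.hom.app (S b))
    {X Y : C} (g : F.obj X ⟶ F.obj Y) :
    ∃ f : Ω.obj X ⟶ Ω.obj Y, Δ.map g = δ.inv.app X ≫ F.map f ≫ δ.hom.app Y := by
  obtain ⟨n, a, ⟨s⟩⟩ := hC X
  obtain ⟨m, b, ⟨t⟩⟩ := hC Y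
  choose f hf using fun i j => h (a i) (b j) (F.map (s.ι i) ≫ g ≫ F.map (t.π j))
  refine ⟨∑ i, ∑ j, Ω.map (s.π i) ≫ f i j ≫ Ω.map (t.ι j), ?_⟩
  have hg := (s.map F).eq_sum (t.map F) g
  have hinv : ∀ i, δ.inv.app X ≫ F.map (Ω.map (s.π i)) =
      Δ.map (F.map (s.π i)) ≫ δ.inv.app (S (a i)) := fun i => (δ.inv.naturality (s.π i)).symm
  have hhom : ∀ j, F.map (Ω.map (t.ι j)) ≫ δ.hom.app Y =
      δ.hom.app (S (b j)) ≫ Δ.map (F.map (t.ι j)) := fun j => δ.hom.naturality (t.ι j)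
  have hterm : ∀ i j, Δ.map (F.map (s.π i) ≫ (F.map (s.ι i) ≫ g ≫ F.map (t.π j)) ≫
      F.map (t.ι j)) =
        δ.inv.app X ≫ F.map (Ω.map (s.π i) ≫ f i j ≫ Ω.map (t.ι j)) ≫ δ.hom.app Y := by
    intro i j
    rw [Δ.map_comp, Δ.map_comp, hf, F.map_comp, F.map_comp]
    simp only [Category.assoc]
    rw [hhom, ← Category.assoc (δ.inv.app X), hinv, Category.assoc]
  refine (congrArg Δ.map hg).trans ?_
  simp only [Functor.map_sum, Preadditive.sum_comp, Preadditive.comp_sum]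
  exact Finset.sum_congr rfl fun i _ => Finset.sum_congr rfl fun j _ => hterm i j

lemma inv_comp_map_scalarHom {k : Type*} [Field k] [Linear k C] [Linear k D] [Functor.Linear k F]
    {A : ι → D} (φ : ∀ a, F.obj (S a) ≅ A a) (c : k) (a b : ι) :
    (φ a).inv ≫ F.map (scalarHom S c a b) ≫ (φ b).hom = scalarHom A c a b := by
  by_cases h : a = b
  · subst h
    simp [Functor.map_smul]
  · simp [scalarHom_ne _ _ h]
variable {k : Type*} [Field k] [Linear k C] [Linear k D] [Ω.Additive] [Functor.Linear k Ω] [Functor.Linear k Δ]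
  [Functor.Linear k F] {A : ι → D} {J : ι → Type w'} [∀ a, Fintype (J a)] {τ : ∀ {a}, J a → ι}

/-- A functor commutes with loop functors that decompose the objects of a generating family in the
same way, and looped morphisms lift along it, if the components of looped morphisms are scalar. -/
theorem exists_loopIso_of_scalar
    (hC : ∀ X : C, ∃ (n : ℕ) (a : Fin n → ι), Nonempty (FamilySum (fun j => S (a j)) X))
    (hS : ∀ (a b : ι) (f : S a ⟶ S b), ∃ c : k, f = scalarHom S c a b)
    (φ : ∀ a, F.obj (S a) ≅ A a) (s : ∀ a, FamilySum (fun x : J a => S (τ x)) (Ω.obj (S a)))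
    (t : ∀ a, FamilySum (fun x : J a => A (τ x)) (Δ.obj (A a)))
    (ht : ∀ (a b : ι) (g : A a ⟶ A b) (x : J a) (y : J b), ∃ c : k,
      (t a).ι x ≫ Δ.map g ≫ (t b).π y = scalarHom A c (τ x) (τ y)) :
    ∃ δ : Ω ⋙ F ≅ F ⋙ Δ, ∀ {X Y : C} (g : F.obj X ⟶ F.obj Y),
      ∃ f : Ω.obj X ⟶ Ω.obj Y, Δ.map g = δ.inv.app X ≫ F.map f ≫ δ.hom.app Y := by
  let s' : ∀ a, FamilySum (fun x : J a => A (τ x)) (F.obj (Ω.obj (S a))) := fun a =>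
    ((s a).map F).congr fun x => φ (τ x)
  let t' : ∀ a, FamilySum (fun x : J a => A (τ x)) (Δ.obj (F.obj (S a))) := fun a =>
    (t a).ofIso (Δ.mapIso (φ a).symm)
  -- On a generator `δ` identifies corresponding summands; since maps between generators are scalar,
  -- no naturality has to be verified.
  obtain ⟨δ, hδ⟩ := exists_natIso_of_scalar S hC hS (Ω ⋙ F) (F ⋙ Δ) fun a => (s' a).iso (t' a)
  refine ⟨δ, fun g => exists_loop_lift_of_generators hC δ (fun a b g => ?_) g⟩
  choose c hc using ht a b ((φ a).inv ≫ g ≫ (φ b).hom)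
  -- The lift has the same matrix of scalars as `Δ.map g`, now read between the summands of `Ω.obj
  -- (S a)` and `Ω.obj (S b)`.
  refine ⟨∑ x, ∑ y, (s a).π x ≫ scalarHom S (c x y) (τ x) (τ y) ≫ (s b).ι y, ?_⟩
  have hι : ∀ x, (t' a).ι x ≫ δ.inv.app (S a) = (s' a).ι x := by
    intro x
    have : (s' a).ι x ≫ δ.hom.app (S a) = (t' a).ι x := by
      rw [hδ]
      exact (s' a).ι_sum x _
    rw [← this, Category.assoc, Iso.hom_inv_id_app]
    exact Category.comp_id _
  have hπ : ∀ y, δ.hom.app (S b) ≫ (t' b).π y = (s' b).π y := by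
    intro y
    rw [hδ]
    exact (t' b).sum_π y _
  refine (t' a).ext_from fun x => (t' b).ext_to fun y => ?_
  have h₁ : (t' a).ι x ≫ Δ.map g ≫ (t' b).π y = scalarHom A (c x y) (τ x) (τ y) := by
    rw [← hc]
    change ((t a).ι x ≫ Δ.map (φ a).inv) ≫ Δ.map g ≫ Δ.map (φ b).hom ≫ (t b).π y = _
    simp only [Functor.map_comp, Category.assoc]
  have h₂ : (s a).ι x ≫ (∑ x, ∑ y, (s a).π x ≫ scalarHom S (c x y) (τ x) (τ y) ≫ (s b).ι y) ≫
      (s b).π y = scalarHom S (c x y) (τ x) (τ y) := by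
    simp only [← Preadditive.comp_sum]
    rw [← Category.assoc, (s a).ι_sum, (s b).sum_π]
  generalize (∑ x, ∑ y, (s a).π x ≫ scalarHom S (c x y) (τ x) (τ y) ≫ (s b).ι y) = f at h₂ ⊢
  have h₃ : (t' a).ι x ≫ (δ.inv.app (S a) ≫ F.map f ≫ δ.hom.app (S b)) ≫ (t' b).π y =
      (s' a).ι x ≫ F.map f ≫ (s' b).π y := by
    rw [← hι, ← hπ]
    simp only [Category.assoc]
  refine (Category.assoc _ _ _).trans (h₁.trans (Eq.symm ((Category.assoc _ _ _).trans
    (h₃.trans ?_))))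
  rw [← inv_comp_map_scalarHom φ, ← h₂, F.map_comp, F.map_comp]
  change ((φ (τ x)).inv ≫ F.map ((s a).ι x)) ≫ F.map f ≫ F.map ((s b).π y) ≫ (φ (τ y)).hom = _
  simp only [Category.assoc]

end LoopedSums

/-! ### The first power of the comparison isomorphism -/

section LoopPow

universe v₁ v₂ u₁ u₂

variable {C : Type u₁} [Category.{v₁} C] {D : Type u₂} [Category.{v₂} D] {Ω : C ⥤ C} {Δ : D ⥤ D}
  {F : C ⥤ D} (δ : Ω ⋙ F ≅ F ⋙ Δ)

lemma loopIsoPow_one_hom_app (X : C) : (loopIsoPow δ 1).hom.app X = δ.hom.app X := by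
  change 𝟙 (F.obj (Ω.obj X)) ≫ (𝟙 _ ≫ 𝟙 _) ≫ 𝟙 _ ≫ δ.hom.app X ≫ 𝟙 (Δ.obj (F.obj X)) = _
  simp

lemma loopIsoPow_one_inv_app (X : C) : (loopIsoPow δ 1).inv.app X = δ.inv.app X := by
  change (((𝟙 (Δ.obj (F.obj X)) ≫ δ.inv.app X) ≫ 𝟙 _) ≫ (𝟙 _ ≫ 𝟙 _)) ≫ 𝟙 (F.obj (Ω.obj X)) = _
  simp

end LoopPow

/-! ### The functor `F` and its properties -/

section KeyFunctor

variable {k : Type u} [Field k] {Q : FinQuiver.{u}} (I : Ideal (PathAlgebra k Q))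

/-- The simple module of the radical square zero algebra of the relation quiver, for an arrow. -/
def relationSimple (a : Q.E) : SSCat (RadSquareZero k (relationQuiver I)) :=
  simpleObj k (relationQuiver I) a

lemma exists_familySum_relationSimple (X : SSCat (RadSquareZero k (relationQuiver I))) :
    ∃ (n : ℕ) (a : Fin n → Q.E), Nonempty (FamilySum (fun j => relationSimple I (a j)) X) :=
  exists_familySum_simpleObj X

lemma exists_eq_scalarHom_relationSimple (a b : Q.E) (f : relationSimple I a ⟶ relationSimple I b) :
    ∃ c : k, f = scalarHom (relationSimple I) c a b :=
  exists_eq_scalarHom_simpleObj (Q := relationQuiver I) a b f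

lemma nonempty_familySum_syzygy_relationSimple (a : Q.E) :
    Nonempty (FamilySum (fun x : Relations I a => relationSimple I (relationEnd x))
      ((ssSyzygyFunctor (jacobson_radSquareZero (k := k) (Q := relationQuiver I))).obj
        (relationSimple I a))) :=
  nonempty_familySum_syzygy_simpleObj (Q := relationQuiver I) a

variable [IsQuadraticMonomial I]

/-- Both sides say that no arrow of the relation quiver starts at `a`. One implication makes the
functor well defined, the other makes it faithful. -/
lemma id_relationSimple_eq_zero_iff (a : Q.E) :
    𝟙 (relationSimple I a) = 0 ↔ 𝟙 (arrowObj I a) = 0 :=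
  (id_simpleObj_eq_zero_iff (Q := relationQuiver I) a).trans (id_arrowObj_eq_zero_iff a).symm

theorem exists_isKeyFunctor :
    ∃ F : SSCat (RadSquareZero k (relationQuiver I)) ⥤ StableCat (PathAlgebra k Q ⧸ I),
      IsKeyFunctor I F := by
  obtain ⟨F, h₁, h₂, h₃⟩ := exists_linear_functor_of_scalar (k := k) (relationSimple I)
    (arrowObj I) (exists_familySum_relationSimple I) (fun n a => StableCat.exists_familySum _)
    (exists_eq_scalarHom_relationSimple I) fun a => (id_relationSimple_eq_zero_iff I a).1
  exact ⟨F, h₁, h₂, h₃⟩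

variable {I} {F F' : SSCat (RadSquareZero k (relationQuiver I)) ⥤ StableCat (PathAlgebra k Q ⧸ I)}

theorem IsKeyFunctor.nonempty_iso (h : IsKeyFunctor I F) (h' : IsKeyFunctor I F') :
    Nonempty (F ≅ F') := by
  have := h.additive
  have := h.linear
  have := h'.additive
  have := h'.linear
  obtain ⟨η, -⟩ := exists_natIso_of_scalar (k := k) (relationSimple I)
    (exists_familySum_relationSimple I) (exists_eq_scalarHom_relationSimple I) F F' fun a =>
      (h.obj_simple a).some ≪≫ (h'.obj_simple a).some.symm
  exact ⟨η⟩

theorem IsKeyFunctor.exists_loopIso (h : IsKeyFunctor I F) :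
    ∃ δ : ssSyzygyFunctor (jacobson_radSquareZero (k := k) (Q := relationQuiver I)) ⋙ F ≅
        F ⋙ syzygyFunctor (PathAlgebra k Q ⧸ I),
      ∀ {X Y : SSCat (RadSquareZero k (relationQuiver I))} (g : F.obj X ⟶ F.obj Y),
        ∃ f : (ssSyzygyFunctor jacobson_radSquareZero).obj X ⟶
            (ssSyzygyFunctor jacobson_radSquareZero).obj Y,
          (syzygyFunctor (PathAlgebra k Q ⧸ I)).map g =
            δ.inv.app X ≫ F.map f ≫ δ.hom.app Y := by
  have := h.additive
  have := h.linear
  obtain ⟨D, hD⟩ := exists_familySum_syzygy_arrowObj I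
  exact exists_loopIso_of_scalar (k := k) (S := relationSimple I) (A := arrowObj I)
    (exists_familySum_relationSimple I) (exists_eq_scalarHom_relationSimple I)
    (fun a => (h.obj_simple a).some)
    (fun a => (nonempty_familySum_syzygy_relationSimple I a).some) D hD

/-- One loop is enough: the syzygy is a finite sum of modules `Aα`, and so the image of the
corresponding sum of modules `S_α`. -/
lemma IsKeyFunctor.eventuallyInImage_of_isSimpleModule (h : IsKeyFunctor I F)
    (M : FGModuleCat.{u} (PathAlgebra k Q ⧸ I)) [IsSimpleModule (PathAlgebra k Q ⧸ I) M] :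
    EventuallyInImage (syzygyFunctor (PathAlgebra k Q ⧸ I)) F (StableCat.of M) := by
  have := h.additive
  obtain ⟨v, ⟨s⟩⟩ := exists_familySum_syzygy_of_isSimpleModule M
  let e := (Fintype.equivFin (ArrowsFrom Q v)).symm
  obtain ⟨W, ⟨t⟩⟩ := SSCat.exists_familySum fun j => relationSimple I (e j).1
  exact EventuallyInImage.of_loop (eventuallyInImage_obj
    ((s.reindex e).iso ((t.map F).congr fun j => (h.obj_simple (e j).1).some)))

theorem IsKeyFunctor.exists_isPreTriangleEquivalence (h : IsKeyFunctor I F) :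
    ∃ δ : ssSyzygyFunctor (jacobson_radSquareZero (k := k) (Q := relationQuiver I)) ⋙ F ≅
        F ⋙ syzygyFunctor (PathAlgebra k Q ⧸ I),
      IsPreTriangleEquivalence (ssLeftTriangles jacobson_radSquareZero) stableLeftTriangles
        F δ := by
  have := h.additive
  have := h.linear
  obtain ⟨δ, hδ⟩ := h.exists_loopIso
  refine ⟨δ, h.additive, fun T hT => map_mem_stableLeftTriangles _ F δ hT, ?_, ?_, ?_⟩
  · intro X Y g
    obtain ⟨f, hf⟩ := hδ g
    refine ⟨1, f, ?_⟩
    change (syzygyFunctor (PathAlgebra k Q ⧸ I)).map g = _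
    rw [loopIsoPow_one_hom_app, loopIsoPow_one_inv_app]
    exact hf
  · intro X Y f f' hf
    -- `F` is faithful, so no loop is needed.
    refine ⟨0, ?_⟩
    change f = f'
    rw [← sub_eq_zero]
    refine map_injective_of_scalar (k := k) (relationSimple I) (exists_familySum_relationSimple I)
      (exists_eq_scalarHom_relationSimple I) F (fun a ha => ?_) (by rw [F.map_sub, hf, sub_self])
    obtain ⟨e⟩ := h.obj_simple a
    refine (id_relationSimple_eq_zero_iff I a).2 ?_
    have ha : 𝟙 (F.obj (simpleObj k (relationQuiver I) a)) = 0 := ha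
    rw [← e.inv_hom_id, ← Category.id_comp e.hom, ha, Limits.zero_comp, Limits.comp_zero]
  · exact fun Z => QuadMon.eventuallyInImage_of_isSimpleModule δ hδ
      (fun M _ => h.eventuallyInImage_of_isSimpleModule M) Z

end KeyFunctor

end QuadMon

end

theorem lemma4p5 {k : Type u} [Field k] (Q : FinQuiver.{u}) (I : Ideal (PathAlgebra k Q))
    [IsQuadraticMonomial I] :
    (∃ F : SSCat (RadSquareZero k (relationQuiver I)) ⥤ StableCat (PathAlgebra k Q ⧸ I),
      IsKeyFunctor I F) ∧
    (∀ F F' : SSCat (RadSquareZero k (relationQuiver I)) ⥤ StableCat (PathAlgebra k Q ⧸ I),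
      IsKeyFunctor I F → IsKeyFunctor I F' → Nonempty (F ≅ F')) ∧
    (∀ F : SSCat (RadSquareZero k (relationQuiver I)) ⥤ StableCat (PathAlgebra k Q ⧸ I),
      IsKeyFunctor I F →
      ∃ δ : ssSyzygyFunctor (jacobson_radSquareZero (k := k) (Q := relationQuiver I)) ⋙ F ≅
          F ⋙ syzygyFunctor (PathAlgebra k Q ⧸ I),
        IsPreTriangleEquivalence (ssLeftTriangles jacobson_radSquareZero) stableLeftTriangles
          F δ) :=
  ⟨exists_isKeyFunctor I, fun _ _ h h' => h.nonempty_iso h',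
    fun _ h => h.exists_isPreTriangleEquivalence⟩
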